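/- Let $H=\ell^2(\iota)$ with $\iota$ countable (separable one-particle space, orthonormal basis of modes), write $\bar T$ and $T^T$ for the entrywise conjugate and the transpose of an operator, $\|T\|_1=\operatorname{Sp}\sqrt{T^\dagger T}$, $\|T\|_2=[\operatorname{Sp}(T^\dagger T)]^{1/2}$, and let $\det$ be the Fredholm determinant. Fix $t\ge 0$ and let $C(\tau)$, $\tau\in[0,t]$, be a measurable family of self-adjoint trace class operators on $H$ with $\int_0^t\|C(\tau)\|_1d\tau<\infty$. Then the following holds. 1. The time-ordered exponential $R_{\tau,0}=\mathrm{Texp}[-i\int_0^\tau C(s)ds]$, i.e. the solution of $R_{\tau,0}x=x-i\int_0^\tau C(s)R_{s,0}x\,ds$ for all $x\in H$, exists and is unitary, and $R_{\tau,0}-1$ is trace class for all $\tau\in[0,t]$. It depends continuously on $C$: for every $\eta>0$ there is $\delta>0$ such that, for every family $C'$ of the same kind with $\int_0^t\|C'(s)-C(s)\|_1ds\le\delta$ and $R'_{\tau,0}=\mathrm{Texp}[-i\int_0^\tau C'(s)ds]$, one has $\|R'_{\tau,0}-R_{\tau,0}\|_1\le\eta$ for all $\tau\in[0,t]$. 2.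 $\operatorname{Sp}C$ is integrable on $[0,t]$ and, for all $\tau\in[0,t]$, $$\det R_{\tau,0}=\exp\Big\{-i\int_0^\tau \operatorname{Sp}C(s)\,ds\Big\}.$$ 3. Let $\epsilon=1$ (bosons) or $\epsilon=-1$ (fermions), let $d$ be a real integrable function on $[0,t]$, and let $A(\tau)$ be a measurable, uniformly bounded family of operators with $A^T=\epsilon A$. Put $R_{0,\tau}=R_{\tau,0}^{-1}$ and suppose that $F(\tau)=\int_0^\tau \bar R_{0,s}\bar A(s)R_{s,0}\,ds$ is Hilbert-Schmidt and $G(\tau)=R_{0,\tau}A(\tau)\bar R_{\tau,0}F(\tau)$ is trace class for all $\tau\in[0,t]$, with $\|F(\tau)\|_2$ and $\|G(\tau)\|_1$ integrable on $[0,t]$. Let $$D_{\tau,0}=\begin{pmatrix}\Phi(\tau)&\Psi(\tau)\\ \bar\Psi(\tau)&\bar\Phi(\tau)\end{pmatrix}=\mathrm{Texp}\Big\{-i\int_0^\tau\begin{pmatrix}C(s)&A(s)\\-\bar A(s)&-\bar C(s)\end{pmatrix}ds\Big\}$$ (this exists), and for fermions assume that $\Phi(\tau)$ has a bounded inverse for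 all $\tau\in[0,t]$. Then $\bar\Phi(\tau)-1$ is trace class and $\det\bar\Phi(\tau)\ne0$ for all $\tau\in[0,t]$, the function $\tau\mapsto\det\bar\Phi(\tau)$ has a continuous square root on $[0,t]$ that equals $1$ at $\tau=0$, and, with $[\det\bar\Phi(\tau)]^{-\epsilon/2}$ computed from this square root, the evolution operators $\hat U_{\tau,0}$ of the Hamiltonian $$\hat H(\tau)=\tfrac12\big[2\hat a^\dagger C(\tau)\hat a+\hat aA^\dagger(\tau)\hat a+\hat a^\dagger A(\tau)\hat a^\dagger\big]+d(\tau)$$ in the bosonic or fermionic Fock space over $H$ have the vacuum-to-vacuum amplitude $$\langle vac|\hat U_{\tau,0}|vac\rangle=[\det\bar\Phi(\tau)]^{-\epsilon/2}\exp\Big\{i\int_0^\tau\Big[\frac{\epsilon}{2}\operatorname{Sp}C(s)-d(s)\Big]ds\Big\},\qquad \tau\in[0,t].$$ Here, since $\hat H(\tau)$ need not be defined on the vacuum when $A(\tau)$ is only bounded, evolution operators are unitary operators $\hat U_{\tau,0}$, $\tau\in[0,t]$, that satisfy the time-integrated equation $i\partial_\tau\hat U_{\tau,0}=\hat H(\tau)\hat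 U_{\tau,0}$, $\hat U_{0,0}=1$, in the matrix elements between occupation number states (sums over the modes in $\hat aA^\dagger\hat a$ being convergent for almost every time), for which the mean number of particles in $\hat U_{\tau,0}|m\rangle$ is bounded in $\tau\in[0,t]$ for every occupation number state $|m\rangle$, and for which the Heisenberg operators $\hat a(\tau)=\hat U_{\tau,0}^\dagger\hat a\,\hat U_{\tau,0}$ satisfy the time-integrated Heisenberg equations $i\partial_\tau\hat a(\tau)=C(\tau)\hat a(\tau)+A(\tau)\hat a^\dagger(\tau)$ in the same matrix elements. -/

import Mathlib

open MeasureTheory Filter Topology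
open scoped ENNReal ComplexConjugate

noncomputable section

namespace QuadraticQFT

/-! ### One-particle space, complex conjugation, trace ideals, Fredholm determinant -/

/-- The one-particle Hilbert space `ℓ²(ι)`; `ι` labels the modes. -/
abbrev OneParticle (ι : Type*) := lp (fun _ : ι => ℂ) 2

/-- Bounded operators on the one-particle space. -/
abbrev Op (ι : Type*) := OneParticle ι →L[ℂ] OneParticle ι

/-- The matrix element `T_{ij}`. -/
def entry {ι : Type*} [DecidableEq ι] (T : Op ι) (i j : ι) : ℂ :=
  (T (lp.single 2 j (1 : ℂ))) i

/-- The complex conjugate operator `T̄`, with matrix elements `conj T_{ij}`. -/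
def conjOp {ι : Type*} (T : Op ι) : Op ι :=
  ((starₗᵢ ℂ : OneParticle ι ≃ₗᵢ⋆[ℂ] OneParticle ι) :
      OneParticle ι →L⋆[ℂ] OneParticle ι).comp
    (T.comp ((starₗᵢ ℂ : OneParticle ι ≃ₗᵢ⋆[ℂ] OneParticle ι) :
      OneParticle ι →L⋆[ℂ] OneParticle ι))

/-- The positive operator `√(T† T)` on a Hilbert space. -/
def absOp {H : Type*} [NormedAddCommGroup H] [InnerProductSpace ℂ H] [CompleteSpace H]
    (T : H →L[ℂ] H) : H →L[ℂ] H :=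
  CFC.sqrt (star T * T)

/-- The trace norm `‖T‖₁ = Sp √(T† T)`, with values in `[0, ∞]`. -/
def traceNorm {ι : Type*} [DecidableEq ι] (T : Op ι) : ℝ≥0∞ :=
  ∑' i, ENNReal.ofReal (entry (absOp T) i i).re

/-- `T` is trace class. -/
def IsTraceClass {ι : Type*} [DecidableEq ι] (T : Op ι) : Prop := traceNorm T < ⊤

/-- The Hilbert-Schmidt norm `‖T‖₂ = [Sp (T† T)]^{1/2}`, with values in `[0, ∞]`. -/
def hsNorm {ι : Type*} [DecidableEq ι] (T : Op ι) : ℝ≥0∞ :=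
  (∑' i, ENNReal.ofReal (entry (star T * T) i i).re) ^ (1 / 2 : ℝ)

/-- The trace `Sp T = ∑ T_{ii}` (of a trace class operator). -/
def sp {ι : Type*} [DecidableEq ι] (T : Op ι) : ℂ := ∑' i, entry T i i

/-- The Fredholm determinant of an operator `T` such that `T - 1` is trace class: the limit,
along the finite sets `S` of modes, of the determinants of the finite sections
`(T_{ij})_{i,j ∈ S}`. -/
def fredholmDet {ι : Type*} [DecidableEq ι] (T : Op ι) : ℂ :=
  limUnder atTop (fun S : Finset ι => Matrix.det (fun i j : S => entry T i j))

/-! ### Time-ordered exponentials -/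

/-- `U τ = Texp[-i ∫₀^τ h(s) ds]` for `τ ∈ [0,t]`: the solution of
`U_τ x = x - i ∫₀^τ h(s) U_s x ds` for every vector `x`. -/
def IsTexp {K : Type*} [NormedAddCommGroup K] [NormedSpace ℂ K]
    (t : ℝ) (h U : ℝ → K →L[ℂ] K) : Prop :=
  ∀ x : K, ∀ τ ∈ Set.Icc 0 t,
    IntervalIntegrable (fun s => h s (U s x)) volume 0 τ ∧
    U τ x = x - Complex.I • ∫ s in (0 : ℝ)..τ, h s (U s x)

/-- `C(τ)`, `τ ∈ [0,t]`, is a (weakly measurable) family of self-adjoint trace class operators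
whose trace norm is integrable on `[0,t]`. -/
structure IsTraceClassPath {ι : Type*} [DecidableEq ι] (t : ℝ) (C : ℝ → Op ι) : Prop where
  measurable : ∀ i j, AEMeasurable (fun τ => entry (C τ) i j) (volume.restrict (Set.Icc 0 t))
  selfAdjoint : ∀ τ ∈ Set.Icc 0 t, IsSelfAdjoint (C τ)
  traceClass : ∀ τ ∈ Set.Icc 0 t, IsTraceClass (C τ)
  integrable : ∫⁻ τ in Set.Icc 0 t, traceNorm (C τ) < ⊤

/-- The generator `[[C, A], [-Ā, -C̄]]` of the classical (linear canonical) dynamics. -/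
def canonGen {ι : Type*} (C A : Op ι) :
    (OneParticle ι × OneParticle ι) →L[ℂ] (OneParticle ι × OneParticle ι) :=
  (C.comp (ContinuousLinearMap.fst ℂ (OneParticle ι) (OneParticle ι))
      + A.comp (ContinuousLinearMap.snd ℂ (OneParticle ι) (OneParticle ι))).prod
    (-(conjOp A).comp (ContinuousLinearMap.fst ℂ (OneParticle ι) (OneParticle ι))
      - (conjOp C).comp (ContinuousLinearMap.snd ℂ (OneParticle ι) (OneParticle ι)))

/-- The upper left block `Φ` of `D = [[Φ, Ψ], [Ψ̄, Φ̄]]`. -/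
def phiBlock {ι : Type*}
    (D : (OneParticle ι × OneParticle ι) →L[ℂ] (OneParticle ι × OneParticle ι)) : Op ι :=
  (ContinuousLinearMap.fst ℂ _ _).comp (D.comp (ContinuousLinearMap.inl ℂ _ _))

/-- The conditions on `A` and `d` under which the matrix elements of the evolution operator are
considered. Here `ε = 1` for bosons, `ε = -1` for fermions, and `R τ = R_{τ,0}` is the unitary
`Texp[-i ∫₀^τ C]`, so that `R_{0,τ} = (R τ)†`. -/
structure EvolutionConditions {ι : Type*} [DecidableEq ι] (ε : ℤˣ) (t : ℝ)
    (A : ℝ → Op ι) (d : ℝ → ℝ) (R : ℝ → Op ι) : Prop where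
  measurable : ∀ i j, AEMeasurable (fun τ => entry (A τ) i j) (volume.restrict (Set.Icc 0 t))
  /-- `Aᵀ = ε A` -/
  transpose : ∀ τ ∈ Set.Icc 0 t, ∀ i j, entry (A τ) j i = ((ε : ℤ) : ℂ) * entry (A τ) i j
  bounded : ∃ a : ℝ, ∀ τ ∈ Set.Icc 0 t, ‖A τ‖ < a
  /-- `F(τ) = ∫₀^τ R̄_{0,s} Ā(s) R_{s,0} ds` is Hilbert-Schmidt and
  `G(τ) = R_{0,τ} A(τ) R̄_{τ,0} F(τ)` is trace class, with integrable norms. -/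
  exists_F : ∃ F : ℝ → Op ι,
    (∀ τ ∈ Set.Icc 0 t, ∀ x : OneParticle ι,
      F τ x = ∫ s in (0 : ℝ)..τ, (conjOp (star (R s)) * conjOp (A s) * R s) x) ∧
    (∀ τ ∈ Set.Icc 0 t, hsNorm (F τ) < ⊤) ∧
    (∫⁻ τ in Set.Icc 0 t, hsNorm (F τ) < ⊤) ∧
    (∀ τ ∈ Set.Icc 0 t, IsTraceClass (star (R τ) * A τ * conjOp (R τ) * F τ)) ∧
    (∫⁻ τ in Set.Icc 0 t, traceNorm (star (R τ) * A τ * conjOp (R τ) * F τ) < ⊤)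
  integrable_d : IntervalIntegrable d volume 0 t

/-! ### Fock space in the occupation number representation -/

/-- Occupation numbers: finitely many particles, at most one per mode for fermions. -/
def Occ (ε : ℤˣ) (ι : Type*) := {n : ι →₀ ℕ // ε = -1 → ∀ α, n α ≤ 1}

/-- The bosonic (`ε = 1`) or fermionic (`ε = -1`) Fock space. -/
abbrev Fock (ε : ℤˣ) (ι : Type*) := lp (fun _ : Occ ε ι => ℂ) 2

/-- No particles. -/
def Occ.zero (ε : ℤˣ) (ι : Type*) : Occ ε ι := ⟨0, fun _ _ => Nat.zero_le 1⟩

open Classical in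
/-- The state with the occupation numbers `m`. -/
def ket {ε : ℤˣ} {ι : Type*} (m : Occ ε ι) : Fock ε ι := lp.single 2 m (1 : ℂ)

/-- The vacuum. -/
def vac (ε : ℤˣ) (ι : Type*) : Fock ε ι := ket (Occ.zero ε ι)

/-- The sign `ε ^ (number of particles in the modes below α)`; it is `1` for bosons. -/
def modeSign {ε : ℤˣ} {ι : Type*} [LinearOrder ι] (α : ι) (n : Occ ε ι) : ℂ :=
  ((ε : ℤ) : ℂ) ^ (∑ β ∈ n.1.support.filter (· < α), n.1 β)

open Classical in
/-- The annihilation operator `a_α`, on all functions of the occupation numbers. -/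
def annih {ε : ℤˣ} {ι : Type*} [LinearOrder ι] (α : ι) (χ : Occ ε ι → ℂ) (n : Occ ε ι) : ℂ :=
  if h : ε = -1 → ∀ β, (n.1 + Finsupp.single α 1 : ι →₀ ℕ) β ≤ 1 then
    modeSign α n * (Real.sqrt (n.1 α + 1) : ℂ) * χ ⟨n.1 + Finsupp.single α 1, h⟩
  else 0

/-- The creation operator `a†_α`, on all functions of the occupation numbers. -/
def create {ε : ℤˣ} {ι : Type*} [LinearOrder ι] (α : ι) (χ : Occ ε ι → ℂ) (n : Occ ε ι) : ℂ :=
  if n.1 α = 0 then 0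
  else modeSign α n * (Real.sqrt (n.1 α) : ℂ) *
    χ ⟨n.1 - Finsupp.single α 1, fun h β => (Nat.sub_le _ _).trans (n.2 h β)⟩

/-- The (formal) Hamiltonian `½ [2 a† C a + a A† a + a† A a†] + d`, acting on functions of the
occupation numbers. -/
def hamiltonian {ε : ℤˣ} {ι : Type*} [LinearOrder ι] (C A : Op ι) (d : ℝ)
    (χ : Occ ε ι → ℂ) (n : Occ ε ι) : ℂ :=
  (∑' α, ∑' β, entry C α β * create α (annih β χ) n)
  + (1 / 2) * (∑' α, ∑' β, entry (star A) α β * annih α (annih β χ) n)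
  + (1 / 2) * (∑' α, ∑' β, entry A α β * create α (create β χ) n)
  + d * χ n

/-- The matrix element `⟨k| a_α(s) |m⟩` of the Heisenberg operator `a_α(s) = U_s† a_α U_s`. -/
def heisAnnih {ε : ℤˣ} {ι : Type*} [LinearOrder ι] (U : ℝ → Fock ε ι →L[ℂ] Fock ε ι)
    (s : ℝ) (α : ι) (k m : Occ ε ι) : ℂ :=
  ∑' n, conj ((U s (ket k)) n) * annih α (U s (ket m)) n

/-- The matrix element `⟨k| a†_α(s) |m⟩` of the Heisenberg operator `a†_α(s) = U_s† a†_α U_s`. -/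
def heisCreate {ε : ℤˣ} {ι : Type*} [LinearOrder ι] (U : ℝ → Fock ε ι →L[ℂ] Fock ε ι)
    (s : ℝ) (α : ι) (k m : Occ ε ι) : ℂ :=
  ∑' n, conj ((U s (ket k)) n) * create α (U s (ket m)) n

/-- `U τ = Û_{τ,0}`, `τ ∈ [0,t]`, is the evolution generated by the Hamiltonian
`½ [2 a† C a + a A† a + a† A a†] + d`. As `A(τ)` is only assumed to be bounded, this Hamiltonian
need not be defined on the vacuum, so the equation of motion `i ∂_τ Û = Ĥ Û` is imposed on the
matrix elements between the states with finitely many particles, together with the Heisenberg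
equations `i ∂_τ a_α(τ) = (C a(τ) + A a†(τ))_α` for the creation and annihilation operators. -/
structure IsEvolution {ε : ℤˣ} {ι : Type*} [LinearOrder ι] (t : ℝ) (C A : ℝ → Op ι) (d : ℝ → ℝ)
    (U : ℝ → Fock ε ι →L[ℂ] Fock ε ι) : Prop where
  unitary : ∀ τ ∈ Set.Icc 0 t, U τ ∈ unitary (Fock ε ι →L[ℂ] Fock ε ι)
  /-- The sum over modes in `⟨n| a A† a U_s |m⟩` converges. -/
  summable : ∀ n m : Occ ε ι, ∀ᵐ s ∂(volume.restrict (Set.Icc 0 t)),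
    Summable (fun α => ∑' β, entry (star (A s)) α β * annih α (annih β (U s (ket m))) n)
  /-- Schrödinger equation, integrated in time. -/
  schrodinger : ∀ n m : Occ ε ι, ∀ τ ∈ Set.Icc 0 t,
    IntervalIntegrable (fun s => hamiltonian (C s) (A s) (d s) (U s (ket m)) n) volume 0 τ ∧
    (U τ (ket m)) n = (ket m : Fock ε ι) n
      - Complex.I * ∫ s in (0 : ℝ)..τ, hamiltonian (C s) (A s) (d s) (U s (ket m)) n
  /-- The mean number of particles in `U_τ |m⟩` is finite, uniformly in `τ`, so that the
  Heisenberg operators have matrix elements between the states `|k⟩`, `|m⟩`. -/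
  number : ∀ m : Occ ε ι, ∃ K : ℝ, ∀ τ ∈ Set.Icc 0 t,
    ∑' n : Occ ε ι, ((n.1.sum fun _ j => j : ℕ) : ℝ≥0∞) * ‖(U τ (ket m)) n‖ₑ ^ 2
      ≤ ENNReal.ofReal K
  /-- Heisenberg equations, integrated in time (those for `a†_α` are their adjoints). -/
  heisenberg : ∀ (α : ι) (k m : Occ ε ι), ∀ τ ∈ Set.Icc 0 t,
    IntervalIntegrable (fun s => ∑' β, (entry (C s) α β * heisAnnih U s β k m
      + entry (A s) α β * heisCreate U s β k m)) volume 0 τ ∧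
    heisAnnih U τ α k m = heisAnnih U 0 α k m
      - Complex.I * ∫ s in (0 : ℝ)..τ, ∑' β, (entry (C s) α β * heisAnnih U s β k m
          + entry (A s) α β * heisCreate U s β k m)

end QuadraticQFT

end

/-!
All differential equations are read in integrated form, `f τ = f 0 + ∫₀^τ f'` (`IsPrimitive`);
the product rule, the chain rule and Gronwall's inequality hold in this sense because `f` is
absolutely continuous. Time-ordered exponentials with an integrable generator exist by Picard
iteration and are unique by Gronwall's inequality.

*The path `C`.* For self-adjoint `C` and `C'`, the derivative of `R† R'` is `-i R† (C' - C) R'`.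
With `C' = C` this shows that `R` is isometric; it is then unitary, because a norm continuous
one-sided inverse that starts at `1` is two-sided (`mul_eq_one_of_continuousOn`). With `C' ≠ C`
it bounds `‖R' - R‖₁ = ‖R† R' - 1‖₁` by `∫ ‖C' - C‖₁` (`traceNorm_texp_sub_le`). The trace norm
is treated through the polar decomposition and the variational formula `traceNorm_le`.

*Determinants.* If `Ṫ = V T`, `T 0 = 1`, with `V` trace class, `∫ ‖V‖₁ < ∞` and `T` invertible,
then `det T = exp ∫ Sp V` (`fredholmDet_eq_exp`). Indeed, let `P` be the projection onto a finite
set of modes. The sections `P T P + (1 - P)` tend to `T` in norm, uniformly in time, hence are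
eventually invertible at all times, and Liouville's formula for matrices writes `det P T P` as
the exponential of the integral of the trace of a matrix that depends on `V`, `T` and the inverse
of the section. This trace differs from `Sp V` by at most a constant times `‖V (1 - P)‖₁`, whose
integral tends to `0` by dominated convergence.

*The block `Φ̄`.* The lower right block of `D` satisfies `Φ̄˙ = i (C̄ + Ā Ψ Φ̄⁻¹) Φ̄`. For bosons
it is invertible because the dynamics preserves the form with signature `diag (1, -1)`, which
gives `Φ̄† Φ̄ = 1 + Ψ† Ψ`. That `Ā Ψ` is trace class is the content of
`isTraceL1_mul_of_interaction`: in the interaction picture `P = R† Ψ` and `Q = R̄† Φ̄` solve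
`Ṗ = c B† Q`, `Q̇ = c' B P` with `B = Ḟ`, and integration by parts expresses `B P` by `B F†`,
which is trace class by the hypothesis on `G`, and by a remainder `B X` such that the derivative
of `X` is a product of two Hilbert-Schmidt operators. Hence `det Φ̄ = exp ∫ Sp V` with
`V = i (C̄ + Ā Ψ Φ̄⁻¹)`, and `exp (½ ∫ Sp V)` is a continuous square root of it.

*The vacuum.* By the Heisenberg equations, the matrix elements of `(a(τ), a†(τ))` evolve with
`D`. Since `a` annihilates the vacuum, this gives `a = Z a†` on `χ = U |vac⟩`, where
`Z = Ψ Φ̄⁻¹`, first for the matrix elements with the vectors `U |k⟩` (`IsEvolution.modes_eq`),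
then for those with all vectors (`IsEvolution.annih_eq`). The second step needs that
`y ↦ (⟨y, a†_α χ⟩)_α` is bounded from the Fock space to `ℓ²`, which holds when `χ` has a finite
mean number of particles (`create_kernel_le`). Inserted into the Schrödinger equation, this
relation turns the equation for the vacuum amplitude `u` into the scalar equation
`u̇ = -i (½ Sp (A† Z) + d) u`. Its solution is compared with the square root of `det Φ̄` by means
of `Sp (A† Z) = ε Sp (Ā Z)`.
-/

open MeasureTheory Filter Topology
open scoped ENNReal ComplexConjugate

noncomputable section

namespace QuadraticQFT

/-! ### Primitives of integrable functions on an interval -/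

/-- On `[0, t]`, `f` is a primitive of the integrable function `f'`. This is the meaning of the
differential equation `ḟ = f'` when the right hand side is only integrable in time: `f` is
absolutely continuous, and `f'` is its derivative almost everywhere. -/
structure IsPrimitive {E : Type*} [NormedAddCommGroup E] [NormedSpace ℝ E] (t : ℝ)
    (f f' : ℝ → E) : Prop where
  integrable : IntervalIntegrable f' volume 0 t
  eq : ∀ τ ∈ Set.Icc 0 t, f τ = f 0 + ∫ s in (0 : ℝ)..τ, f' s

section Primitive

set_option linter.unusedSectionVars false

variable {E : Type*} [NormedAddCommGroup E] [NormedSpace ℝ E]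
variable {G : Type*} [NormedAddCommGroup G] [NormedSpace ℝ G]
variable {t : ℝ} {f f' : ℝ → E}

lemma intervalIntegrable_sub {g : ℝ → E} (hg : IntervalIntegrable g volume 0 t) {a b : ℝ}
    (ha : a ∈ Set.Icc 0 t) (hb : b ∈ Set.Icc 0 t) : IntervalIntegrable g volume a b := by
  refine hg.mono_set ?_
  rw [Set.uIcc_of_le (ha.1.trans ha.2)]
  exact Set.uIcc_subset_Icc ha hb

lemma integrableOn_Icc_of_intervalIntegrable {g : ℝ → E} (ht : 0 ≤ t)
    (hg : IntervalIntegrable g volume 0 t) : IntegrableOn g (Set.Icc 0 t) :=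
  (intervalIntegrable_iff_integrableOn_Icc_of_le ht).1 hg

lemma aestronglyMeasurable_Icc_of_intervalIntegrable {g : ℝ → E} (ht : 0 ≤ t)
    (hg : IntervalIntegrable g volume 0 t) :
    AEStronglyMeasurable g (volume.restrict (Set.Icc 0 t)) :=
  (integrableOn_Icc_of_intervalIntegrable ht hg).aestronglyMeasurable

lemma intervalIntegrable_of_norm_le {g : ℝ → E} {b : ℝ → ℝ} (ht : 0 ≤ t)
    (hb : IntervalIntegrable b volume 0 t)
    (hg : AEStronglyMeasurable g (volume.restrict (Set.Icc 0 t)))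
    (h : ∀ s ∈ Set.Icc 0 t, ‖g s‖ ≤ b s) : IntervalIntegrable g volume 0 t := by
  rw [intervalIntegrable_iff_integrableOn_Icc_of_le ht] at hb ⊢
  refine Integrable.mono' hb hg ?_
  filter_upwards [self_mem_ae_restrict measurableSet_Icc] with s hs using h s hs

lemma IsPrimitive.sub_eq (hf : IsPrimitive t f f') {a b : ℝ}
    (ha : a ∈ Set.Icc 0 t) (hb : b ∈ Set.Icc 0 t) : f b - f a = ∫ s in a..b, f' s := by
  have h0 : (0 : ℝ) ∈ Set.Icc 0 t := ⟨le_rfl, ha.1.trans ha.2⟩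
  rw [hf.eq a ha, hf.eq b hb, add_sub_add_left_eq_sub,
    intervalIntegral.integral_interval_sub_left (intervalIntegrable_sub hf.integrable h0 hb)
      (intervalIntegrable_sub hf.integrable h0 ha)]

lemma IsPrimitive.continuousOn (hf : IsPrimitive t f f') : ContinuousOn f (Set.Icc 0 t) := by
  by_cases ht : 0 ≤ t
  · have h1 := intervalIntegral.continuousOn_primitive_interval
      (μ := volume) (a := 0) (b := t) (f := f')
      (by rw [Set.uIcc_of_le ht]; exact integrableOn_Icc_of_intervalIntegrable ht hf.integrable)
    rw [Set.uIcc_of_le ht] at h1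
    exact (continuousOn_const.add h1).congr (fun τ hτ => hf.eq τ hτ)
  · rw [Set.Icc_eq_empty ht]; exact continuousOn_empty f

lemma IsPrimitive.congr {g g' : ℝ → E} (ht : 0 ≤ t) (hf : IsPrimitive t f f')
    (h : ∀ s ∈ Set.Icc 0 t, g s = f s) (h' : ∀ s ∈ Set.Icc 0 t, g' s = f' s) :
    IsPrimitive t g g' := by
  have h0 : (0 : ℝ) ∈ Set.Icc 0 t := ⟨le_rfl, ht⟩
  constructor
  · refine hf.integrable.congr ?_
    intro s hs
    rw [Set.uIoc_of_le ht] at hs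
    exact (h' s ⟨hs.1.le, hs.2⟩).symm
  · intro τ hτ
    rw [h τ hτ, h 0 h0, hf.eq τ hτ]
    congr 1
    refine intervalIntegral.integral_congr fun s hs => ?_
    rw [Set.uIcc_of_le hτ.1] at hs
    exact (h' s ⟨hs.1, hs.2.trans hτ.2⟩).symm

/-- A function whose increments are dominated by those of the primitive of an integrable function is
absolutely continuous. -/
lemma absolutelyContinuousOnInterval_of_dist_le {X : Type*} [PseudoMetricSpace X] {h : ℝ → X}
    {b : ℝ → ℝ} (ht : 0 ≤ t) (hb : IntervalIntegrable b volume 0 t)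
    (hd : ∀ x ∈ Set.Icc 0 t, ∀ y ∈ Set.Icc 0 t, dist (h x) (h y) ≤ |∫ s in x..y, b s|) :
    AbsolutelyContinuousOnInterval h 0 t := by
  have hG := hb.absolutelyContinuousOnInterval_intervalIntegral (c := 0) (by simp)
  have h0 : (0 : ℝ) ∈ Set.Icc 0 t := ⟨le_rfl, ht⟩
  refine squeeze_zero' ?_ ?_ hG
  · exact Eventually.of_forall fun E => Finset.sum_nonneg fun _ _ => dist_nonneg
  · have : ∀ᶠ (E : ℕ × (ℕ → ℝ × ℝ)) in AbsolutelyContinuousOnInterval.totalLengthFilter ⊓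
        𝓟 (AbsolutelyContinuousOnInterval.disjWithin 0 t),
        E ∈ AbsolutelyContinuousOnInterval.disjWithin 0 t := eventually_inf_principal.mpr (by simp)
    filter_upwards [this] with E hE
    refine Finset.sum_le_sum fun i hi => ?_
    obtain ⟨h1, h2⟩ := hE.1 i hi
    rw [Set.uIcc_of_le ht] at h1 h2
    refine (hd _ h1 _ h2).trans (le_of_eq ?_)
    rw [dist_comm, Real.dist_eq, intervalIntegral.integral_interval_sub_left
      (intervalIntegrable_sub hb h0 h2) (intervalIntegrable_sub hb h0 h1)]

lemma IsPrimitive.ae_hasDerivAt [CompleteSpace E] (ht : 0 ≤ t) (hf : IsPrimitive t f f') :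
    ∀ᵐ x, x ∈ Set.Icc 0 t → HasDerivAt f (f' x) x := by
  have h₁ : ∀ᵐ x : ℝ, x ≠ 0 := by simp [ae_iff, measure_singleton]
  have h₂ : ∀ᵐ x : ℝ, x ≠ t := by simp [ae_iff, measure_singleton]
  filter_upwards [hf.integrable.ae_hasDerivAt_integral, h₁, h₂] with x hx hx0 hxt hxI
  have h := hx (by rwa [Set.uIcc_of_le ht]) 0 (by simp)
  refine (h.const_add (f 0)).congr_of_eventuallyEq ?_
  have : Set.Ioo 0 t ∈ 𝓝 x :=
    Ioo_mem_nhds (lt_of_le_of_ne hxI.1 hx0.symm) (lt_of_le_of_ne hxI.2 hxt)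
  filter_upwards [this] with y hy
  exact hf.eq y ⟨hy.1.le, hy.2.le⟩

/-- An absolutely continuous function is a primitive of its almost everywhere derivative, when
this is integrable. -/
lemma isPrimitive_of_ae_hasDerivAt [CompleteSpace E] (ht : 0 ≤ t) {b : ℝ → ℝ}
    (hb : IntervalIntegrable b volume 0 t)
    (hd : ∀ x ∈ Set.Icc 0 t, ∀ y ∈ Set.Icc 0 t, dist (f x) (f y) ≤ |∫ s in x..y, b s|)
    (hf' : IntervalIntegrable f' volume 0 t)
    (h : ∀ᵐ x, x ∈ Set.Icc 0 t → HasDerivAt f (f' x) x) : IsPrimitive t f f' := by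
  refine ⟨hf', fun τ hτ => ?_⟩
  have h0 : (0 : ℝ) ∈ Set.Icc 0 t := ⟨le_rfl, ht⟩
  have hp : IsPrimitive t (fun τ => ∫ s in (0 : ℝ)..τ, f' s) f' := ⟨hf', by simp⟩
  have hac : AbsolutelyContinuousOnInterval (fun τ => f τ - ∫ s in (0 : ℝ)..τ, f' s) 0 t := by
    refine absolutelyContinuousOnInterval_of_dist_le (b := fun s => |b s| + ‖f' s‖) ht
      (hb.abs.add hf'.norm) fun x hx y hy => ?_
    have e1 : dist (f x - ∫ s in (0 : ℝ)..x, f' s) (f y - ∫ s in (0 : ℝ)..y, f' s)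
        ≤ |(∫ s in x..y, |b s|)| + |(∫ s in x..y, ‖f' s‖)| := by
      refine (dist_sub_sub_le _ _ _ _).trans (add_le_add ((hd x hx y hy).trans ?_) ?_)
      · simpa only [Real.norm_eq_abs] using
          intervalIntegral.norm_integral_le_abs_integral_norm (f := b) (a := x) (b := y)
            (μ := volume)
      · rw [dist_comm, dist_eq_norm, hp.sub_eq hx hy]
        exact intervalIntegral.norm_integral_le_abs_integral_norm
    refine e1.trans (le_of_eq ?_)
    rw [intervalIntegral.integral_add (intervalIntegrable_sub hb.abs hx hy)
      (intervalIntegrable_sub hf'.norm hx hy)]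
    rcases le_total x y with hxy | hxy
    · have i1 : 0 ≤ ∫ s in x..y, |b s| :=
        intervalIntegral.integral_nonneg hxy fun _ _ => abs_nonneg _
      have i2 : 0 ≤ ∫ s in x..y, ‖f' s‖ :=
        intervalIntegral.integral_nonneg hxy fun _ _ => norm_nonneg _
      rw [abs_of_nonneg i1, abs_of_nonneg i2, abs_of_nonneg (add_nonneg i1 i2)]
    · have i1 : 0 ≤ ∫ s in y..x, |b s| :=
        intervalIntegral.integral_nonneg hxy fun _ _ => abs_nonneg _
      have i2 : 0 ≤ ∫ s in y..x, ‖f' s‖ :=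
        intervalIntegral.integral_nonneg hxy fun _ _ => norm_nonneg _
      rw [intervalIntegral.integral_symm y x, intervalIntegral.integral_symm y x, ← neg_add,
        abs_neg, abs_neg, abs_neg, abs_of_nonneg i1, abs_of_nonneg i2,
        abs_of_nonneg (add_nonneg i1 i2)]
  obtain ⟨c, hc⟩ := hac.const_of_ae_hasDerivAt_zero (by
    filter_upwards [h, hp.ae_hasDerivAt ht] with x hx1 hx2 hx
    rw [Set.uIcc_of_le ht] at hx
    simpa using (hx1 hx).fun_sub (hx2 hx))
  rw [Set.uIcc_of_le ht] at hc
  have e1 := hc τ hτ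
  have e0 := hc 0 h0
  simp only [intervalIntegral.integral_same, sub_zero] at e0
  rw [e0, ← e1]; abel

/-- The chain rule for a continuously differentiable function of a primitive. -/
lemma IsPrimitive.comp_contDiff [CompleteSpace E] [CompleteSpace G] (ht : 0 ≤ t)
    (hf : IsPrimitive t f f') {φ : E → G} (hφ : ContDiff ℝ 1 φ) :
    IsPrimitive t (fun s => φ (f s)) (fun s => fderiv ℝ φ (f s) (f' s)) := by
  have hK : IsCompact (f '' Set.Icc 0 t) := isCompact_Icc.image_of_continuousOn hf.continuousOn
  obtain ⟨K, hLip⟩ := (hφ.locallyLipschitz.locallyLipschitzOn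
    (s := f '' Set.Icc 0 t)).exists_lipschitzOnWith_of_compact hK
  -- `φ ∘ f` is absolutely continuous since `φ` is Lipschitz on the compact range of `f`
  have hcont : ContinuousOn (fun s => fderiv ℝ φ (f s)) (Set.Icc 0 t) :=
    (hφ.continuous_fderiv one_ne_zero).comp_continuousOn hf.continuousOn
  obtain ⟨c, hc⟩ := isCompact_Icc.exists_bound_of_continuousOn hcont
  refine isPrimitive_of_ae_hasDerivAt ht (b := fun s => K * ‖f' s‖)
    (hf.integrable.norm.const_mul _) (fun x hx y hy => ?_) ?_ ?_
  · refine (hLip.dist_le_mul _ ⟨x, hx, rfl⟩ _ ⟨y, hy, rfl⟩).trans ?_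
    rw [intervalIntegral.integral_const_mul, abs_mul, abs_of_nonneg (NNReal.coe_nonneg K),
      dist_comm, dist_eq_norm, hf.sub_eq hx hy]
    exact mul_le_mul_of_nonneg_left intervalIntegral.norm_integral_le_abs_integral_norm K.2
  · refine intervalIntegrable_of_norm_le ht (b := fun s => c * ‖f' s‖)
      (hf.integrable.norm.const_mul _) ?_ fun s hs => ?_
    · exact (ContinuousLinearMap.id ℝ (E →L[ℝ] G)).aestronglyMeasurable_comp₂
        (hcont.aestronglyMeasurable measurableSet_Icc)
        (aestronglyMeasurable_Icc_of_intervalIntegrable ht hf.integrable)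
    · exact (ContinuousLinearMap.le_opNorm _ _).trans
        (mul_le_mul_of_nonneg_right (hc s hs) (norm_nonneg _))
  · filter_upwards [hf.ae_hasDerivAt ht] with x hx hxI
    exact ((hφ.differentiable one_ne_zero).differentiableAt.hasFDerivAt).comp_hasDerivAt x (hx hxI)

lemma IsPrimitive.prodMk (ht : 0 ≤ t) {g g' : ℝ → G} [CompleteSpace E] [CompleteSpace G]
    (hf : IsPrimitive t f f') (hg : IsPrimitive t g g') :
    IsPrimitive t (fun s => (f s, g s)) (fun s => (f' s, g' s)) := by
  have hi : IntervalIntegrable (fun s => (f' s, g' s)) volume 0 t := by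
    rw [intervalIntegrable_iff_integrableOn_Icc_of_le ht]
    exact (integrableOn_Icc_of_intervalIntegrable ht hf.integrable).prodMk
      (integrableOn_Icc_of_intervalIntegrable ht hg.integrable)
  refine ⟨hi, fun τ hτ => ?_⟩
  have h0 : (0 : ℝ) ∈ Set.Icc 0 t := ⟨le_rfl, ht⟩
  have hi' := intervalIntegrable_sub hi h0 hτ
  refine Prod.ext ?_ ?_
  · have := (ContinuousLinearMap.fst ℝ E G).intervalIntegral_comp_comm hi'
    simp only [ContinuousLinearMap.coe_fst'] at this
    simp only [Prod.fst_add, ← this]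
    exact hf.eq τ hτ
  · have := (ContinuousLinearMap.snd ℝ E G).intervalIntegral_comp_comm hi'
    simp only [ContinuousLinearMap.coe_snd'] at this
    simp only [Prod.snd_add, ← this]
    exact hg.eq τ hτ

/-- The product rule for a bounded bilinear map. -/
lemma IsPrimitive.bilin {F : Type*} [NormedAddCommGroup F] [NormedSpace ℝ F] (ht : 0 ≤ t)
    [CompleteSpace E] [CompleteSpace G] [CompleteSpace F]
    {g g' : ℝ → G} (hf : IsPrimitive t f f') (hg : IsPrimitive t g g') (B : E →L[ℝ] G →L[ℝ] F) :
    IsPrimitive t (fun s => B (f s) (g s)) (fun s => B (f s) (g' s) + B (f' s) (g s)) := by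
  have h := (hf.prodMk ht hg).comp_contDiff ht (φ := fun p : E × G => B p.1 p.2)
    B.isBoundedBilinearMap.contDiff
  refine h.congr ht (fun _ _ => rfl) fun s _ => ?_
  have := (B.isBoundedBilinearMap.hasFDerivAt (f s, g s)).fderiv
  simp only [this, IsBoundedBilinearMap.deriv_apply]

lemma IsPrimitive.clm {F : Type*} [NormedAddCommGroup F] [NormedSpace ℝ F] [CompleteSpace E]
    [CompleteSpace F] (hf : IsPrimitive t f f') (B : E →L[ℝ] F) :
    IsPrimitive t (fun s => B (f s)) (fun s => B (f' s)) := by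
  refine ⟨?_, fun τ hτ => ?_⟩
  · exact ⟨B.integrable_comp hf.integrable.1, B.integrable_comp hf.integrable.2⟩
  · rw [hf.eq τ hτ, map_add, ← B.intervalIntegral_comp_comm
      (intervalIntegrable_sub hf.integrable ⟨le_rfl, hτ.1.trans hτ.2⟩ hτ)]

lemma IsPrimitive.add {g g' : ℝ → E} (hf : IsPrimitive t f f') (hg : IsPrimitive t g g') :
    IsPrimitive t (fun s => f s + g s) (fun s => f' s + g' s) := by
  refine ⟨hf.integrable.add hg.integrable, fun τ hτ => ?_⟩
  have h0 : (0 : ℝ) ∈ Set.Icc 0 t := ⟨le_rfl, hτ.1.trans hτ.2⟩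
  rw [hf.eq τ hτ, hg.eq τ hτ, intervalIntegral.integral_add
    (intervalIntegrable_sub hf.integrable h0 hτ) (intervalIntegrable_sub hg.integrable h0 hτ)]
  abel

lemma isPrimitive_const (c : E) : IsPrimitive t (fun _ => c) (fun _ => (0 : E)) :=
  ⟨by simp, by simp⟩

lemma isPrimitive_sum {κ : Type*} (J : Finset κ) {φ φ' : κ → ℝ → E}
    (h : ∀ k ∈ J, IsPrimitive t (φ k) (φ' k)) :
    IsPrimitive t (fun s => ∑ k ∈ J, φ k s) (fun s => ∑ k ∈ J, φ' k s) := by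
  classical
  induction J using Finset.induction_on with
  | empty => simpa using isPrimitive_const (t := t) (0 : E)
  | insert k J hk ih =>
    simp_rw [Finset.sum_insert hk]
    exact (h k (Finset.mem_insert_self k J)).add
      (ih fun j hj => h j (Finset.mem_insert_of_mem hj))

lemma isPrimitive_integral (hf' : IntervalIntegrable f' volume 0 t) :
    IsPrimitive t (fun τ => ∫ s in (0 : ℝ)..τ, f' s) f' := ⟨hf', by simp⟩

/-- A primitive of a vanishing function is constant. -/
lemma IsPrimitive.const_of_zero (hf : IsPrimitive t f f') (h : ∀ s ∈ Set.Icc 0 t, f' s = 0)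
    {τ : ℝ} (hτ : τ ∈ Set.Icc 0 t) : f τ = f 0 := by
  rw [hf.eq τ hτ, intervalIntegral.integral_congr (g := fun _ => (0 : E))]
  · simp
  · intro s hs
    rw [Set.uIcc_of_le hτ.1] at hs
    exact h s ⟨hs.1, hs.2.trans hτ.2⟩

lemma isPrimitive_exp_integral {c : ℝ → ℂ} (ht : 0 ≤ t) (hc : IntervalIntegrable c volume 0 t) :
    IsPrimitive t (fun τ => Complex.exp (∫ s in (0 : ℝ)..τ, c s))
      (fun τ => c τ * Complex.exp (∫ s in (0 : ℝ)..τ, c s)) := by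
  have h := (isPrimitive_integral hc).comp_contDiff ht (φ := Complex.exp) Complex.contDiff_exp
  refine h.congr ht (fun _ _ => rfl) fun s _ => ?_
  have := (Complex.hasDerivAt_exp (∫ r in (0 : ℝ)..s, c r)).hasFDerivAt.restrictScalars ℝ
  simp [this.fderiv]

lemma isPrimitive_real_exp_integral {c : ℝ → ℝ} (ht : 0 ≤ t)
    (hc : IntervalIntegrable c volume 0 t) :
    IsPrimitive t (fun τ => Real.exp (∫ s in (0 : ℝ)..τ, c s))
      (fun τ => c τ * Real.exp (∫ s in (0 : ℝ)..τ, c s)) := by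
  have h := (isPrimitive_integral hc).comp_contDiff ht (φ := Real.exp) Real.contDiff_exp
  refine h.congr ht (fun _ _ => rfl) fun s _ => ?_
  have := (Real.hasDerivAt_exp (∫ r in (0 : ℝ)..s, c r)).hasFDerivAt
  simp [this.fderiv]

/-- The solution of the scalar linear equation `y' = c y`. -/
lemma IsPrimitive.eq_exp {c y : ℝ → ℂ} (ht : 0 ≤ t) (hc : IntervalIntegrable c volume 0 t)
    (hy : IsPrimitive t y (fun s => c s * y s)) {τ : ℝ} (hτ : τ ∈ Set.Icc 0 t) :
    y τ = y 0 * Complex.exp (∫ s in (0 : ℝ)..τ, c s) := by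
  have h1 := isPrimitive_exp_integral ht hc.neg
  have h2 := (hy.bilin ht h1 (ContinuousLinearMap.mul ℝ ℂ)).const_of_zero (fun s _ => by
    simp only [ContinuousLinearMap.mul_apply', Pi.neg_apply]; ring) hτ
  simp only [ContinuousLinearMap.mul_apply', Pi.neg_apply, intervalIntegral.integral_neg,
    intervalIntegral.integral_same, Complex.exp_zero, mul_one] at h2
  rw [← h2, mul_assoc, ← Complex.exp_add]
  simp

/-- Gronwall's inequality with an integrable coefficient. -/
lemma gronwall {g u : ℝ → ℝ} {a : ℝ} (ht : 0 ≤ t) (hg : IntervalIntegrable g volume 0 t)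
    (hg0 : ∀ s ∈ Set.Icc 0 t, 0 ≤ g s) (hgu : IntervalIntegrable (fun s => g s * u s) volume 0 t)
    (hu : ∀ τ ∈ Set.Icc 0 t, u τ ≤ a + ∫ s in (0 : ℝ)..τ, g s * u s) {τ : ℝ}
    (hτ : τ ∈ Set.Icc 0 t) : u τ ≤ a * Real.exp (∫ s in (0 : ℝ)..τ, g s) := by
  have h1 := isPrimitive_real_exp_integral ht hg.neg
  have hF := (isPrimitive_const a (t := t)).add (isPrimitive_integral hgu)
  have h2 := hF.bilin ht h1 (ContinuousLinearMap.mul ℝ ℝ)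
  have e := h2.eq τ hτ
  simp only [ContinuousLinearMap.mul_apply', Pi.neg_apply, intervalIntegral.integral_neg,
    intervalIntegral.integral_same, Real.exp_zero, mul_one, add_zero] at e
  -- `(a + ∫ g u) exp (-∫ g)` is decreasing, and starts at `a`
  have hneg : (∫ s in (0 : ℝ)..τ, ((a + ∫ r in (0 : ℝ)..s, g r * u r) *
      (-g s * Real.exp (-∫ r in (0 : ℝ)..s, g r))
      + (0 + g s * u s) * Real.exp (-∫ r in (0 : ℝ)..s, g r))) ≤ 0 := by
    rw [← neg_nonneg, ← intervalIntegral.integral_neg]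
    refine intervalIntegral.integral_nonneg hτ.1 fun s hs => ?_
    have hs' : s ∈ Set.Icc 0 t := ⟨hs.1, hs.2.trans hτ.2⟩
    have := mul_nonneg (mul_nonneg (hg0 s hs') (sub_nonneg.2 (hu s hs')))
      (Real.exp_pos (-∫ r in (0 : ℝ)..s, g r)).le
    nlinarith
  have e2 : (a + ∫ s in (0 : ℝ)..τ, g s * u s) * Real.exp (-∫ s in (0 : ℝ)..τ, g s) ≤ a := by
    rw [e]; linarith
  rw [Real.exp_neg, ← div_eq_mul_inv, div_le_iff₀ (Real.exp_pos _)] at e2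
  exact (hu τ hτ).trans e2

end Primitive

/-! ### Linear evolution equations with integrable coefficients -/

section Texp

variable {K : Type*} [NormedAddCommGroup K] [NormedSpace ℂ K] {t : ℝ}
  {h U : ℝ → K →L[ℂ] K} {g : ℝ → ℝ}

/-- A family of bounded operators on `[0, t]` whose norm is bounded by the integrable function `g`.
Measurability is required in the form in which it is used: the family maps measurable paths of
vectors to measurable paths of vectors. -/
structure IsL1Generator (t : ℝ) (h : ℝ → K →L[ℂ] K) (g : ℝ → ℝ) : Prop where
  integrable : IntervalIntegrable g volume 0 t
  norm_le : ∀ s ∈ Set.Icc 0 t, ‖h s‖ ≤ g s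
  measurable : ∀ y : ℝ → K, AEStronglyMeasurable y (volume.restrict (Set.Icc 0 t)) →
    AEStronglyMeasurable (fun s => h s (y s)) (volume.restrict (Set.Icc 0 t))

lemma IsL1Generator.nonneg (hg : IsL1Generator t h g) {s : ℝ} (hs : s ∈ Set.Icc 0 t) : 0 ≤ g s :=
  (norm_nonneg _).trans (hg.norm_le s hs)

lemma IsL1Generator.intervalIntegrable_apply (ht : 0 ≤ t) (hg : IsL1Generator t h g) {y : ℝ → K}
    (hy : ContinuousOn y (Set.Icc 0 t)) :
    IntervalIntegrable (fun s => -Complex.I • h s (y s)) volume 0 t := by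
  obtain ⟨c, hc⟩ := isCompact_Icc.exists_bound_of_continuousOn hy
  refine intervalIntegrable_of_norm_le ht (b := fun s => g s * c) (hg.integrable.mul_const c)
    ((hg.measurable y (hy.aestronglyMeasurable measurableSet_Icc)).const_smul (-Complex.I))
    fun s hs => ?_
  rw [norm_smul, norm_neg, Complex.norm_I, one_mul]
  exact (ContinuousLinearMap.le_opNorm _ _).trans
    (mul_le_mul (hg.norm_le s hs) (hc s hs) (norm_nonneg _) (hg.nonneg hs))

/-- The a priori bound for the solutions of `y' = -i h y`, by Gronwall's inequality. -/
lemma IsL1Generator.norm_solution_le (ht : 0 ≤ t) (hg : IsL1Generator t h g) {y : ℝ → K}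
    (hy : IsPrimitive t y (fun s => -Complex.I • h s (y s))) {τ : ℝ} (hτ : τ ∈ Set.Icc 0 t) :
    ‖y τ‖ ≤ ‖y 0‖ * Real.exp (∫ s in (0 : ℝ)..τ, g s) := by
  have hgy : IntervalIntegrable (fun s => g s * ‖y s‖) volume 0 t :=
    hg.integrable.mul_continuousOn (by rw [Set.uIcc_of_le ht]; exact hy.continuousOn.norm)
  refine gronwall (u := fun τ => ‖y τ‖) ht hg.integrable (fun s hs => hg.nonneg hs) hgy
    (fun σ hσ => ?_) hτ
  have h0 : (0 : ℝ) ∈ Set.Icc 0 t := ⟨le_rfl, ht⟩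
  rw [hy.eq σ hσ]
  refine (norm_add_le _ _).trans (add_le_add le_rfl ?_)
  refine intervalIntegral.norm_integral_le_of_norm_le hσ.1 (Eventually.of_forall fun s hs => ?_)
    (intervalIntegrable_sub hgy h0 hσ)
  have hs' : s ∈ Set.Icc 0 t := ⟨hs.1.le, hs.2.trans hσ.2⟩
  rw [norm_smul, norm_neg, Complex.norm_I, one_mul]
  exact (ContinuousLinearMap.le_opNorm _ _).trans
    (mul_le_mul_of_nonneg_right (hg.norm_le s hs') (norm_nonneg _))

lemma IsL1Generator.solution_unique (ht : 0 ≤ t) (hg : IsL1Generator t h g) {y z : ℝ → K}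
    (hy : IsPrimitive t y (fun s => -Complex.I • h s (y s)))
    (hz : IsPrimitive t z (fun s => -Complex.I • h s (z s))) (h0 : y 0 = z 0) {τ : ℝ}
    (hτ : τ ∈ Set.Icc 0 t) : y τ = z τ := by
  have hz' : IsPrimitive t (fun s => -z s) (fun s => -(-Complex.I • h s (z s))) :=
    ⟨hz.integrable.neg, fun τ hτ => by
      rw [intervalIntegral.integral_neg, hz.eq τ hτ, neg_add]⟩
  have hd : IsPrimitive t (fun s => y s + -z s) (fun s => -Complex.I • h s (y s + -z s)) := by
    refine (hy.add hz').congr ht (fun _ _ => rfl) fun s _ => ?_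
    rw [map_add, map_neg, smul_add, smul_neg]
  have := hg.norm_solution_le ht hd hτ
  rw [h0, add_neg_cancel, norm_zero, zero_mul] at this
  exact add_neg_eq_zero.1 (norm_le_zero_iff.1 this)

/-- Existence for `y' = -i h y`: Picard's map is a contraction in the sup norm weighted by
`exp (-2 ∫ g)`. -/
lemma IsL1Generator.exists_solution [CompleteSpace K] (ht : 0 ≤ t) (hg : IsL1Generator t h g)
    (x : K) : ∃ y : ℝ → K, y 0 = x ∧ IsPrimitive t y (fun s => -Complex.I • h s (y s)) := by
  have h0 : (0 : ℝ) ∈ Set.Icc 0 t := ⟨le_rfl, ht⟩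
  have hg2 : IntervalIntegrable (fun s => 2 * g s) volume 0 t := hg.integrable.const_mul 2
  have hw := isPrimitive_real_exp_integral ht hg2
  set w : ℝ → ℝ := fun τ => Real.exp (∫ s in (0 : ℝ)..τ, 2 * g s) with hwdef
  have hwpos : ∀ τ, 0 < w τ := fun τ => Real.exp_pos _
  have hw0 : w 0 = 1 := by simp [hwdef]
  -- the unweighted function that belongs to an element of the Picard space
  let e : C(Set.Icc 0 t, K) → ℝ → K := fun z s => w s • z (Set.projIcc 0 t ht s)
  have he : ∀ z, ContinuousOn (e z) (Set.Icc 0 t) := fun z =>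
    hw.continuousOn.smul (z.continuous.comp continuous_projIcc).continuousOn
  have hP : ∀ z, IsPrimitive t (fun τ => x + ∫ s in (0 : ℝ)..τ, -Complex.I • h s (e z s))
      (fun s => -Complex.I • h s (e z s)) := fun z =>
    ⟨hg.intervalIntegrable_apply ht (he z), by simp⟩
  let Γ : C(Set.Icc 0 t, K) → C(Set.Icc 0 t, K) := fun z =>
    ⟨fun τ => (w τ)⁻¹ • (x + ∫ s in (0 : ℝ)..τ, -Complex.I • h s (e z s)), by
      have := (hw.continuousOn.inv₀ (fun s _ => (hwpos s).ne')).smul (hP z).continuousOn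
      exact continuousOn_iff_continuous_domRestrict.1 this⟩
  have hΓ : ContractingWith (1 / 2 : NNReal) Γ := by
    refine ⟨by rw [← NNReal.coe_lt_coe]; norm_num, LipschitzWith.of_dist_le_mul fun z z' => ?_⟩
    rw [ContinuousMap.dist_le (by positivity)]
    rintro ⟨τ, hτ⟩
    change dist ((w τ)⁻¹ • (x + ∫ s in (0 : ℝ)..τ, -Complex.I • h s (e z s)))
      ((w τ)⁻¹ • (x + ∫ s in (0 : ℝ)..τ, -Complex.I • h s (e z' s))) ≤ _
    rw [dist_smul₀, dist_add_left, dist_eq_norm, ← intervalIntegral.integral_sub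
      (intervalIntegrable_sub (hP z).integrable h0 hτ)
      (intervalIntegrable_sub (hP z').integrable h0 hτ)]
    have hb : IntervalIntegrable (fun s => (2 * g s * w s) * (dist z z' / 2)) volume 0 τ :=
      (intervalIntegrable_sub hw.integrable h0 hτ).mul_const _
    have hle : ‖∫ s in (0 : ℝ)..τ, (-Complex.I • h s (e z s) - -Complex.I • h s (e z' s))‖
        ≤ ∫ s in (0 : ℝ)..τ, (2 * g s * w s) * (dist z z' / 2) := by
      refine intervalIntegral.norm_integral_le_of_norm_le hτ.1
        (Eventually.of_forall fun s hs => ?_) hb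
      have hs' : s ∈ Set.Icc 0 t := ⟨hs.1.le, hs.2.trans hτ.2⟩
      rw [← smul_sub, norm_smul, norm_neg, Complex.norm_I, one_mul, ← map_sub]
      refine (ContinuousLinearMap.le_opNorm _ _).trans ?_
      have : ‖e z s - e z' s‖ ≤ w s * dist z z' := by
        change ‖w s • z _ - w s • z' _‖ ≤ _
        rw [← smul_sub, norm_smul, Real.norm_of_nonneg (hwpos s).le, ← dist_eq_norm]
        exact mul_le_mul_of_nonneg_left (ContinuousMap.dist_apply_le_dist _) (hwpos s).le
      refine (mul_le_mul (hg.norm_le s hs') this (norm_nonneg _) (hg.nonneg hs')).trans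
        (le_of_eq ?_)
      ring
    have hint : ∫ s in (0 : ℝ)..τ, (2 * g s * w s) * (dist z z' / 2)
        = (w τ - 1) * (dist z z' / 2) := by
      rw [intervalIntegral.integral_mul_const, ← hw.sub_eq h0 hτ, hw0]
    rw [hint] at hle
    rw [Real.norm_of_nonneg (inv_pos.2 (hwpos τ)).le, inv_mul_le_iff₀ (hwpos τ)]
    refine hle.trans ?_
    have : (0 : ℝ) ≤ dist z z' := dist_nonneg
    push_cast
    nlinarith [hwpos τ]
  have hfix := hΓ.fixedPoint_isFixedPt
  set z := hΓ.fixedPoint with hz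
  have hez : ∀ τ ∈ Set.Icc 0 t, e z τ = x + ∫ s in (0 : ℝ)..τ, -Complex.I • h s (e z s) := by
    intro τ hτ
    have h1 : Γ z ⟨τ, hτ⟩ = z ⟨τ, hτ⟩ := by rw [hfix]
    change w τ • z (Set.projIcc 0 t ht τ) = _
    rw [Set.projIcc_of_mem ht hτ, ← h1]
    exact smul_inv_smul₀ (hwpos τ).ne' _
  refine ⟨e z, by rw [hez 0 h0]; simp, (hP z).integrable, fun τ hτ => ?_⟩
  rw [hez τ hτ, hez 0 h0, intervalIntegral.integral_same, add_zero]

lemma IsTexp.zero_apply (ht : 0 ≤ t) (hU : IsTexp t h U) (x : K) : U 0 x = x := by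
  simpa using (hU x 0 ⟨le_rfl, ht⟩).2

lemma IsTexp.zero (ht : 0 ≤ t) (hU : IsTexp t h U) : U 0 = 1 :=
  ContinuousLinearMap.ext fun x => hU.zero_apply ht x

/-- `IsTexp` is the integrated form of `U̇ x = -i h U x`. -/
lemma IsTexp.isPrimitive (ht : 0 ≤ t) (hU : IsTexp t h U) (x : K) :
    IsPrimitive t (fun τ => U τ x) (fun s => -Complex.I • h s (U s x)) := by
  refine ⟨((hU x t ⟨ht, le_rfl⟩).1).smul (-Complex.I), fun τ hτ => ?_⟩
  rw [intervalIntegral.integral_smul, hU.zero_apply ht, (hU x τ hτ).2, neg_smul, sub_eq_add_neg]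

lemma IsL1Generator.exists_isTexp [CompleteSpace K] (ht : 0 ≤ t) (hg : IsL1Generator t h g) :
    ∃ U : ℝ → K →L[ℂ] K, IsTexp t h U := by
  choose y hy0 hy using hg.exists_solution ht
  have hadd : ∀ x x', ∀ τ ∈ Set.Icc 0 t, y (x + x') τ = y x τ + y x' τ := by
    intro x x' τ hτ
    refine hg.solution_unique ht (z := fun s => y x s + y x' s) (hy _) ?_ (by simp [hy0]) hτ
    refine ((hy x).add (hy x')).congr ht (fun _ _ => rfl) fun s _ => ?_
    rw [map_add, smul_add]
  have hsmul : ∀ (c : ℂ) x, ∀ τ ∈ Set.Icc 0 t, y (c • x) τ = c • y x τ := by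
    intro c x τ hτ
    refine hg.solution_unique ht (z := fun s => c • y x s) (hy _) ?_ (by simp [hy0]) hτ
    refine ⟨?_, fun τ hτ => ?_⟩
    · simp_rw [map_smul, smul_comm _ c]
      exact (hy x).integrable.smul c
    · simp_rw [map_smul, smul_comm _ c, intervalIntegral.integral_smul]
      rw [(hy x).eq τ hτ, smul_add, intervalIntegral.integral_smul]
  let U : ℝ → K →L[ℂ] K := fun τ => if hτ : τ ∈ Set.Icc 0 t then
    LinearMap.mkContinuous
      { toFun := fun x => y x τ
        map_add' := fun x x' => hadd x x' τ hτ
        map_smul' := fun c x => hsmul c x τ hτ } (Real.exp (∫ s in (0 : ℝ)..τ, g s))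
      (fun x => by
        have := hg.norm_solution_le ht (hy x) hτ
        rwa [hy0, mul_comm] at this) else 0
  have hUy : ∀ x, ∀ τ ∈ Set.Icc 0 t, U τ x = y x τ := by
    intro x τ hτ
    simp only [U, dif_pos hτ]
    rfl
  refine ⟨U, fun x τ hτ => ?_⟩
  have hp : IsPrimitive t (fun τ => U τ x) (fun s => -Complex.I • h s (U s x)) :=
    (hy x).congr ht (hUy x) fun s hs => by rw [hUy x s hs]
  have h0 : (0 : ℝ) ∈ Set.Icc 0 t := ⟨le_rfl, ht⟩
  have hi := intervalIntegrable_sub hp.integrable h0 hτ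
  constructor
  · have := hi.smul Complex.I
    refine this.congr fun s _ => ?_
    simp [smul_smul]
  · have := hp.eq τ hτ
    rw [intervalIntegral.integral_smul, hUy x 0 h0, hy0, neg_smul, ← sub_eq_add_neg] at this
    exact this

lemma IsTexp.norm_le (ht : 0 ≤ t) (hg : IsL1Generator t h g) (hU : IsTexp t h U) {τ : ℝ}
    (hτ : τ ∈ Set.Icc 0 t) : ‖U τ‖ ≤ Real.exp (∫ s in (0 : ℝ)..t, g s) := by
  refine ContinuousLinearMap.opNorm_le_bound _ (Real.exp_pos _).le fun x => ?_
  have := hg.norm_solution_le ht (hU.isPrimitive ht x) hτ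
  rw [hU.zero_apply ht] at this
  refine this.trans ?_
  rw [mul_comm]
  refine mul_le_mul_of_nonneg_right (Real.exp_le_exp.2 ?_) (norm_nonneg _)
  have h0 : (0 : ℝ) ∈ Set.Icc 0 t := ⟨le_rfl, ht⟩
  have ht' : t ∈ Set.Icc 0 t := ⟨ht, le_rfl⟩
  rw [← intervalIntegral.integral_add_adjacent_intervals
    (intervalIntegrable_sub hg.integrable h0 hτ) (intervalIntegrable_sub hg.integrable hτ ht')]
  refine le_add_of_nonneg_right (intervalIntegral.integral_nonneg hτ.2 fun s hs => ?_)
  exact hg.nonneg ⟨hτ.1.trans hs.1, hs.2⟩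

/-- A family of operators with strong derivative dominated by an integrable function is continuous
in the operator norm. -/
lemma continuousOn_of_isPrimitive {V : ℝ → K →L[ℂ] K} {V' : ℝ → K → K}
    (hg : IntervalIntegrable g volume 0 t)
    (hV : ∀ x, IsPrimitive t (fun τ => V τ x) (fun s => V' s x))
    (hV' : ∀ x, ∀ s ∈ Set.Icc 0 t, ‖V' s x‖ ≤ g s * ‖x‖) : ContinuousOn V (Set.Icc 0 t) := by
  have hG := (isPrimitive_integral hg).continuousOn
  intro τ hτ
  have h1 : Tendsto (fun σ => |(∫ s in (0 : ℝ)..σ, g s) - ∫ s in (0 : ℝ)..τ, g s|)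
      (𝓝[Set.Icc 0 t] τ) (𝓝 0) := by
    have := ((hG τ hτ).sub (continuousWithinAt_const (b := ∫ s in (0 : ℝ)..τ, g s))).abs
    simpa [ContinuousWithinAt] using this
  refine tendsto_iff_norm_sub_tendsto_zero.2 (squeeze_zero' (Eventually.of_forall fun _ =>
    norm_nonneg _) ?_ h1)
  filter_upwards [self_mem_nhdsWithin] with σ hσ
  refine ContinuousLinearMap.opNorm_le_bound _ (abs_nonneg _) fun x => ?_
  rw [sub_apply, (hV x).sub_eq hτ hσ, (isPrimitive_integral hg).sub_eq hτ hσ]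
  have hgx := (intervalIntegrable_sub hg hτ hσ).mul_const ‖x‖
  refine (intervalIntegral.norm_integral_le_abs_of_norm_le ?_ hgx).trans (le_of_eq ?_)
  · refine (ae_restrict_iff' measurableSet_uIoc).2 (Eventually.of_forall fun s hs => hV' x s ?_)
    have := Set.uIoc_subset_uIcc hs
    exact Set.uIcc_subset_Icc hτ hσ this
  · rw [intervalIntegral.integral_mul_const, abs_mul, abs_of_nonneg (norm_nonneg x)]

lemma IsTexp.continuousOn (ht : 0 ≤ t) (hg : IsL1Generator t h g) (hU : IsTexp t h U) :
    ContinuousOn U (Set.Icc 0 t) := by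
  refine continuousOn_of_isPrimitive (g := fun s => g s * Real.exp (∫ s in (0 : ℝ)..t, g s))
    (hg.integrable.mul_const _) (hU.isPrimitive ht) fun x s hs => ?_
  rw [norm_smul, norm_neg, Complex.norm_I, one_mul, mul_assoc]
  refine (ContinuousLinearMap.le_opNorm _ _).trans
    (mul_le_mul (hg.norm_le s hs) ?_ (norm_nonneg _) (hg.nonneg hs))
  exact (ContinuousLinearMap.le_opNorm _ _).trans
    (mul_le_mul_of_nonneg_right (hU.norm_le ht hg hs) (norm_nonneg _))

end Texp

/-- A continuous one-sided inverse is two-sided if it is so initially: `1 - D L` is an idempotent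
which depends continuously on the parameter, so it stays `0`. -/
lemma mul_eq_one_of_continuousOn {𝓐 : Type*} [NormedRing 𝓐] {t : ℝ} (ht : 0 ≤ t) {D L : ℝ → 𝓐}
    (hD : ContinuousOn D (Set.Icc 0 t)) (hL : ContinuousOn L (Set.Icc 0 t))
    (h : ∀ τ ∈ Set.Icc 0 t, L τ * D τ = 1) (h0 : D 0 * L 0 = 1) :
    ∀ τ ∈ Set.Icc 0 t, D τ * L τ = 1 := by
  have hid : ∀ τ ∈ Set.Icc 0 t, (1 - D τ * L τ) * (1 - D τ * L τ) = 1 - D τ * L τ := by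
    intro τ hτ
    have : D τ * L τ * (D τ * L τ) = D τ * L τ := by
      rw [mul_assoc, ← mul_assoc (L τ), h τ hτ, one_mul]
    rw [mul_sub, mul_one, sub_mul, one_mul, this, sub_self, sub_zero]
  have hsmall : ∀ τ ∈ Set.Icc 0 t, ‖1 - D τ * L τ‖ < 1 → D τ * L τ = 1 := by
    intro τ hτ hlt
    have h1 : ‖1 - D τ * L τ‖ ≤ ‖1 - D τ * L τ‖ * ‖1 - D τ * L τ‖ := by
      conv_lhs => rw [← hid τ hτ]
      exact norm_mul_le _ _
    have h2 : ‖1 - D τ * L τ‖ = 0 := by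
      by_contra hne
      have : 0 < ‖1 - D τ * L τ‖ := lt_of_le_of_ne (norm_nonneg _) (Ne.symm hne)
      nlinarith
    exact (sub_eq_zero.1 (norm_eq_zero.1 h2)).symm
  have hc : ContinuousOn (fun τ => ‖1 - D τ * L τ‖) (Set.Icc 0 t) :=
    (continuousOn_const.sub (hD.mul hL)).norm
  have hpre := isPreconnected_Icc.image _ hc
  intro τ hτ
  by_contra hne
  have hge : 1 ≤ ‖1 - D τ * L τ‖ := not_lt.1 fun hlt => hne (hsmall τ hτ hlt)
  have hmem : (1 / 2 : ℝ) ∈ (fun τ => ‖1 - D τ * L τ‖) '' Set.Icc 0 t := by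
    refine hpre.Icc_subset ⟨0, ⟨le_rfl, ht⟩, rfl⟩ ⟨τ, hτ, rfl⟩ ⟨?_, ?_⟩
    · simp [h0]
    · change (1 / 2 : ℝ) ≤ ‖1 - D τ * L τ‖; linarith
  obtain ⟨σ, hσ, hσe⟩ := hmem
  have := hsmall σ hσ (by change ‖1 - D σ * L σ‖ = 1 / 2 at hσe; rw [hσe]; norm_num)
  simp [this] at hσe

/-! ### Matrix elements, complex conjugation and weak measurability -/

section Basic

variable {ι : Type*} [DecidableEq ι]

/-- The standard basis vector of the mode `i`. -/
abbrev basisVec (i : ι) : OneParticle ι := lp.single 2 i (1 : ℂ)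

lemma inner_basisVec_left (i : ι) (x : OneParticle ι) : inner ℂ (basisVec i) x = x i := by
  rw [lp.inner_single_left]; simp

lemma norm_basisVec (i : ι) : ‖basisVec i‖ = 1 := by
  rw [basisVec, lp.norm_single (by norm_num)]; simp

lemma basisVec_apply (i j : ι) : basisVec i j = if j = i then (1 : ℂ) else 0 := by
  rw [basisVec, lp.coeFn_single, Pi.single_apply]

lemma entry_eq_inner (T : Op ι) (i j : ι) :
    entry T i j = inner ℂ (basisVec i) (T (basisVec j)) := by
  rw [inner_basisVec_left, entry]

lemma hasSum_basisVec (x : OneParticle ι) : HasSum (fun i => x i • basisVec i) x := by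
  have h := lp.hasSum_single (p := 2) (by norm_num) x
  refine h.congr_fun fun i => ?_
  rw [basisVec, ← lp.single_smul, smul_eq_mul, mul_one]

lemma hasSum_entry_mul (T : Op ι) (x : OneParticle ι) (i : ι) :
    HasSum (fun j => entry T i j * x j) (T x i) := by
  have h := ((innerSL ℂ (basisVec i)).comp T).hasSum (hasSum_basisVec x)
  simp only [ContinuousLinearMap.comp_apply, map_smul, innerSL_apply_apply, smul_eq_mul,
    inner_basisVec_left] at h
  refine h.congr_fun fun j => ?_
  rw [entry, mul_comm]

lemma hasSum_entry_mul_entry (A B : Op ι) (i j : ι) :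
    HasSum (fun k => entry A i k * entry B k j) (entry (A * B) i j) :=
  hasSum_entry_mul A (B (basisVec j)) i

lemma op_ext_apply {A B : Op ι} (h : ∀ i, A (basisVec i) = B (basisVec i)) : A = B := by
  ext1 x
  have hA := A.hasSum (hasSum_basisVec x)
  have hB := B.hasSum (hasSum_basisVec x)
  simp only [map_smul, h] at hA hB
  exact hA.unique hB

lemma op_ext {A B : Op ι} (h : ∀ i j, entry A i j = entry B i j) : A = B :=
  op_ext_apply fun j => lp.ext (funext fun i => h i j)

omit [DecidableEq ι] in
lemma op_ext_inner {A B : Op ι} (h : ∀ x y, inner ℂ x (A y) = inner ℂ x (B y)) : A = B :=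
  ContinuousLinearMap.ext fun y => ext_inner_left ℂ fun x => h x y

omit [DecidableEq ι] in
lemma inner_star_right (T : Op ι) (x y : OneParticle ι) :
    inner ℂ x (star T y) = inner ℂ (T x) y := by
  rw [ContinuousLinearMap.star_eq_adjoint, ContinuousLinearMap.adjoint_inner_right]

omit [DecidableEq ι] in
lemma inner_star_left (T : Op ι) (x y : OneParticle ι) :
    inner ℂ (star T x) y = inner ℂ x (T y) := by
  rw [ContinuousLinearMap.star_eq_adjoint, ContinuousLinearMap.adjoint_inner_left]

omit [DecidableEq ι] in
lemma op_mul_apply (A B : Op ι) (x : OneParticle ι) : (A * B) x = A (B x) := rfl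

omit [DecidableEq ι] in
lemma norm_star_op (A : Op ι) : ‖star A‖ = ‖A‖ := ContinuousLinearMap.adjoint.norm_map A

omit [DecidableEq ι] in
lemma norm_one_op_le : ‖(1 : Op ι)‖ ≤ 1 := ContinuousLinearMap.norm_id_le

lemma entry_star (T : Op ι) (i j : ι) : entry (star T) i j = conj (entry T j i) := by
  rw [entry_eq_inner, entry_eq_inner, inner_star_right, inner_conj_symm]

lemma entry_add (A B : Op ι) (i j : ι) : entry (A + B) i j = entry A i j + entry B i j := rfl
lemma entry_sub (A B : Op ι) (i j : ι) : entry (A - B) i j = entry A i j - entry B i j := rfl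
lemma entry_smul (c : ℂ) (A : Op ι) (i j : ι) : entry (c • A) i j = c * entry A i j := rfl

lemma entry_one (i j : ι) : entry (1 : Op ι) i j = if i = j then 1 else 0 := basisVec_apply j i

end Basic

section Conj

variable {ι : Type*}

lemma conjOp_apply (T : Op ι) (x : OneParticle ι) : conjOp T x = star (T (star x)) := rfl

lemma star_basisVec [DecidableEq ι] (i : ι) : star (basisVec i) = basisVec i := by
  refine lp.ext (funext fun j => ?_)
  rw [lp.star_apply, basisVec_apply]
  split_ifs <;> simp

lemma entry_conjOp [DecidableEq ι] (T : Op ι) (i j : ι) :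
    entry (conjOp T) i j = conj (entry T i j) := by
  rw [entry, conjOp_apply, star_basisVec]
  rfl

lemma conjOp_conjOp (T : Op ι) : conjOp (conjOp T) = T := by
  ext1 x; simp [conjOp_apply]

lemma conjOp_mul (A B : Op ι) : conjOp (A * B) = conjOp A * conjOp B := by
  ext1 x; simp [conjOp_apply]

lemma conjOp_one : conjOp (1 : Op ι) = 1 := by
  ext1 x; simp [conjOp_apply]

lemma conjOp_sub (A B : Op ι) : conjOp (A - B) = conjOp A - conjOp B := by
  ext1 x; simp [conjOp_apply]

lemma conjOp_smul (c : ℂ) (A : Op ι) : conjOp (c • A) = conj c • conjOp A := by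
  ext1 x; simp [conjOp_apply]

lemma norm_conjOp_le (A : Op ι) : ‖conjOp A‖ ≤ ‖A‖ := by
  refine ContinuousLinearMap.opNorm_le_bound _ (norm_nonneg _) fun x => ?_
  rw [conjOp_apply, norm_star]
  simpa using A.le_opNorm (star x)

lemma norm_conjOp (A : Op ι) : ‖conjOp A‖ = ‖A‖ :=
  le_antisymm (norm_conjOp_le A) (by simpa [conjOp_conjOp] using norm_conjOp_le (conjOp A))

lemma continuous_conjOp : Continuous (conjOp : Op ι → Op ι) := by
  refine (LipschitzWith.of_dist_le_mul (K := 1) fun A B => ?_).continuous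
  rw [dist_eq_norm, dist_eq_norm, ← conjOp_sub, norm_conjOp]; simp

lemma inner_star_star (x y : OneParticle ι) :
    inner ℂ (star x) (star y) = conj (inner ℂ x y) := by
  rw [lp.inner_eq_tsum, lp.inner_eq_tsum, Complex.conj_tsum]
  simp

lemma conjOp_star (A : Op ι) : conjOp (star A) = star (conjOp A) := by
  refine ContinuousLinearMap.ext fun y => ext_inner_left ℂ fun x => ?_
  rw [inner_star_right, conjOp_apply, conjOp_apply]
  have h1 := inner_star_star (star x) (star A (star y))
  have h2 := inner_star_star (A (star x)) (star y)
  rw [star_star] at h1 h2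
  rw [h1, h2, inner_star_right]

end Conj

section Measurability

variable {ι : Type*} [DecidableEq ι] [Countable ι] {μ : Measure ℝ}

/-- Weak measurability of a family of operators: the matrix elements are measurable. -/
def WeaklyMeasurable (μ : Measure ℝ) (V : ℝ → Op ι) : Prop :=
  ∀ i j, AEMeasurable (fun s => entry (V s) i j) μ

omit [Countable ι] in
lemma WeaklyMeasurable.add {V W : ℝ → Op ι} (hV : WeaklyMeasurable μ V)
    (hW : WeaklyMeasurable μ W) : WeaklyMeasurable μ (fun s => V s + W s) :=
  fun i j => (hV i j).add (hW i j)

omit [Countable ι] in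
lemma WeaklyMeasurable.sub {V W : ℝ → Op ι} (hV : WeaklyMeasurable μ V)
    (hW : WeaklyMeasurable μ W) : WeaklyMeasurable μ (fun s => V s - W s) :=
  fun i j => (hV i j).sub (hW i j)

omit [Countable ι] in
lemma WeaklyMeasurable.const_smul {V : ℝ → Op ι} (hV : WeaklyMeasurable μ V) (c : ℂ) :
    WeaklyMeasurable μ (fun s => c • V s) :=
  fun i j => (hV i j).const_mul c

omit [Countable ι] in
lemma WeaklyMeasurable.star {V : ℝ → Op ι} (hV : WeaklyMeasurable μ V) :
    WeaklyMeasurable μ (fun s => star (V s)) := by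
  intro i j
  simp_rw [entry_star]
  exact Complex.continuous_conj.measurable.comp_aemeasurable (hV j i)

omit [Countable ι] in
lemma WeaklyMeasurable.conjOp {V : ℝ → Op ι} (hV : WeaklyMeasurable μ V) :
    WeaklyMeasurable μ (fun s => conjOp (V s)) := by
  intro i j
  simp_rw [entry_conjOp]
  exact Complex.continuous_conj.measurable.comp_aemeasurable (hV i j)

omit [Countable ι] in
lemma weaklyMeasurable_const (A : Op ι) : WeaklyMeasurable μ (fun _ => A) :=
  fun _ _ => aemeasurable_const

lemma aemeasurable_of_hasSum {κ : Type*} [Countable κ] {f : κ → ℝ → ℂ} {F : ℝ → ℂ}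
    (hf : ∀ k, AEMeasurable (f k) μ) (h : ∀ s, HasSum (fun k => f k s) (F s)) :
    AEMeasurable F μ :=
  aemeasurable_of_tendsto_metrizable_ae (atTop : Filter (Finset κ))
    (f := fun S s => ∑ k ∈ S, f k s)
    (fun _ => Finset.aemeasurable_fun_sum _ fun k _ => hf k) (Eventually.of_forall h)

lemma WeaklyMeasurable.mul {V W : ℝ → Op ι} (hV : WeaklyMeasurable μ V)
    (hW : WeaklyMeasurable μ W) : WeaklyMeasurable μ (fun s => V s * W s) :=
  fun i j => aemeasurable_of_hasSum (fun k => (hV i k).mul (hW k j))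
    fun s => hasSum_entry_mul_entry (V s) (W s) i j

lemma aestronglyMeasurable_of_apply {y : ℝ → OneParticle ι}
    (h : ∀ i, AEMeasurable (fun s => y s i) μ) : AEStronglyMeasurable y μ := by
  refine aestronglyMeasurable_of_tendsto_ae (atTop : Filter (Finset ι))
    (f := fun (S : Finset ι) (s : ℝ) => ∑ i ∈ S, y s i • basisVec i) (fun S => ?_)
    (Eventually.of_forall fun s => hasSum_basisVec (y s))
  exact Finset.aestronglyMeasurable_fun_sum S fun i _ =>
    (h i).aestronglyMeasurable.smul_const _

omit [DecidableEq ι] [Countable ι] in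
lemma aemeasurable_apply {y : ℝ → OneParticle ι} (h : AEStronglyMeasurable y μ) (i : ι) :
    AEMeasurable (fun s => y s i) μ := by
  classical
  have := (innerSL ℂ (basisVec i)).continuous.comp_aestronglyMeasurable h
  simp only [innerSL_apply_apply, inner_basisVec_left] at this
  exact this.aemeasurable

lemma WeaklyMeasurable.apply {V : ℝ → Op ι} (hV : WeaklyMeasurable μ V) {y : ℝ → OneParticle ι}
    (hy : AEStronglyMeasurable y μ) : AEStronglyMeasurable (fun s => V s (y s)) μ :=
  aestronglyMeasurable_of_apply fun i => aemeasurable_of_hasSum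
    (fun j => (hV i j).mul (aemeasurable_apply hy j)) fun s => hasSum_entry_mul (V s) (y s) i

omit [Countable ι] in
lemma weaklyMeasurable_of_apply {V : ℝ → Op ι}
    (h : ∀ x, AEStronglyMeasurable (fun s => V s x) μ) : WeaklyMeasurable μ V :=
  fun i j => aemeasurable_apply (h (basisVec j)) i

omit [Countable ι] in
lemma weaklyMeasurable_of_continuousOn {t : ℝ} {V : ℝ → Op ι}
    (h : ContinuousOn V (Set.Icc 0 t)) :
    WeaklyMeasurable (volume.restrict (Set.Icc 0 t)) V :=
  weaklyMeasurable_of_apply fun _ =>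
    (h.clm_apply continuousOn_const).aestronglyMeasurable measurableSet_Icc

lemma WeaklyMeasurable.inner_aemeasurable {V : ℝ → Op ι} (hV : WeaklyMeasurable μ V)
    (x y : OneParticle ι) : AEMeasurable (fun s => inner ℂ x (V s y)) μ :=
  ((innerSL ℂ x).continuous.comp_aestronglyMeasurable
    (hV.apply (aestronglyMeasurable_const (b := y)))).aemeasurable

end Measurability

/-! ### Trace ideals -/

section Hilbert

variable {H : Type*} [NormedAddCommGroup H] [InnerProductSpace ℂ H] [CompleteSpace H]

lemma absOp_nonneg (T : H →L[ℂ] H) : 0 ≤ absOp T := CFC.sqrt_nonneg _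

lemma absOp_mul_self (T : H →L[ℂ] H) : absOp T * absOp T = star T * T :=
  CFC.sqrt_mul_sqrt_self _ (star_mul_self_nonneg T)

lemma star_absOp (T : H →L[ℂ] H) : star (absOp T) = absOp T :=
  (IsSelfAdjoint.of_nonneg (absOp_nonneg T)).star_eq

lemma exists_sqrt_absOp (T : H →L[ℂ] H) :
    ∃ S : H →L[ℂ] H, star S = S ∧ S * S = absOp T :=
  ⟨CFC.sqrt (absOp T), (IsSelfAdjoint.of_nonneg (CFC.sqrt_nonneg _)).star_eq,
    CFC.sqrt_mul_sqrt_self (absOp T) (absOp_nonneg T)⟩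

end Hilbert

section TraceNorm

variable {ι : Type*} [DecidableEq ι]

omit [DecidableEq ι] in
lemma enorm_sq_eq_tsum {κ : Type*} (x : OneParticle κ) : ‖x‖ₑ ^ 2 = ∑' i, ‖x i‖ₑ ^ 2 := by
  have h := lp.hasSum_norm (p := 2) (by norm_num) x
  simp only [ENNReal.toReal_ofNat, Real.rpow_ofNat] at h
  have h2 : ‖x‖ₑ ^ 2 = ENNReal.ofReal (‖x‖ ^ 2) := by
    rw [ENNReal.ofReal_pow (norm_nonneg _), ofReal_norm]
  have h3 : ∀ y : ℂ, ‖y‖ₑ ^ 2 = ENNReal.ofReal (‖y‖ ^ 2) := fun y => by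
    rw [ENNReal.ofReal_pow (norm_nonneg _), ofReal_norm]
  rw [h2, tsum_congr fun i => h3 (x i), ← h.tsum_eq,
    ENNReal.ofReal_tsum_of_nonneg (fun _ => by positivity) h.summable]

/-- The squared Hilbert-Schmidt norm, which is `∞` if the operator is not Hilbert-Schmidt. -/
def hsSq (T : Op ι) : ℝ≥0∞ := ∑' i, ‖T (basisVec i)‖ₑ ^ 2

lemma hsSq_eq_tsum_entry (T : Op ι) : hsSq T = ∑' i, ∑' j, ‖entry T j i‖ₑ ^ 2 := by
  simp_rw [hsSq, enorm_sq_eq_tsum, entry]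

lemma hsSq_star (T : Op ι) : hsSq (star T) = hsSq T := by
  rw [hsSq_eq_tsum_entry, hsSq_eq_tsum_entry, ENNReal.tsum_comm]
  simp_rw [entry_star]
  simp [enorm_eq_nnnorm]

omit [DecidableEq ι] in
lemma enorm_apply_le (T : Op ι) (x : OneParticle ι) : ‖T x‖ₑ ≤ ‖T‖ₑ * ‖x‖ₑ := by
  rw [← ofReal_norm, ← ofReal_norm, ← ofReal_norm, ← ENNReal.ofReal_mul (norm_nonneg _)]
  exact ENNReal.ofReal_le_ofReal (T.le_opNorm x)

lemma hsSq_mul_le_left (A B : Op ι) : hsSq (A * B) ≤ ‖A‖ₑ ^ 2 * hsSq B := by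
  rw [hsSq, hsSq, ← ENNReal.tsum_mul_left]
  refine ENNReal.tsum_le_tsum fun i => ?_
  rw [← mul_pow]
  exact pow_le_pow_left' (enorm_apply_le A _) 2

omit [DecidableEq ι] in
lemma enorm_star_op (A : Op ι) : ‖star A‖ₑ = ‖A‖ₑ := by
  rw [← ofReal_norm, norm_star_op, ofReal_norm]

lemma hsSq_mul_le_right (A B : Op ι) : hsSq (A * B) ≤ hsSq A * ‖B‖ₑ ^ 2 := by
  rw [← hsSq_star, star_mul, mul_comm]
  refine (hsSq_mul_le_left _ _).trans (le_of_eq ?_)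
  rw [hsSq_star, enorm_star_op]

lemma hsSq_smul (c : ℂ) (A : Op ι) : hsSq (c • A) = ‖c‖ₑ ^ 2 * hsSq A := by
  rw [hsSq, hsSq, ← ENNReal.tsum_mul_left]
  simp_rw [smul_apply, enorm_smul, mul_pow]

omit [DecidableEq ι] in
lemma enorm_inner_le_half (x y : OneParticle ι) :
    ‖inner ℂ x y‖ₑ ≤ 2⁻¹ * (‖x‖ₑ ^ 2 + ‖y‖ₑ ^ 2) := by
  have h : ‖inner ℂ x y‖ ≤ 2⁻¹ * (‖x‖ ^ 2 + ‖y‖ ^ 2) := by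
    have := norm_inner_le_norm (𝕜 := ℂ) x y
    nlinarith [sq_nonneg (‖x‖ - ‖y‖)]
  have h' := ENNReal.ofReal_le_ofReal h
  rw [ENNReal.ofReal_mul (by norm_num), ENNReal.ofReal_add (by positivity) (by positivity),
    ENNReal.ofReal_pow (norm_nonneg _), ENNReal.ofReal_pow (norm_nonneg _), ofReal_norm,
    ofReal_norm, ofReal_norm, ENNReal.ofReal_inv_of_pos (by norm_num)] at h'
  simpa using h'

lemma enorm_add_sq_le {E : Type*} [SeminormedAddCommGroup E] (x y : E) :
    ‖x + y‖ₑ ^ 2 ≤ 2 * (‖x‖ₑ ^ 2 + ‖y‖ₑ ^ 2) := by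
  have h : ‖x + y‖ ^ 2 ≤ 2 * (‖x‖ ^ 2 + ‖y‖ ^ 2) := by
    have := norm_add_le x y
    have h2 := pow_le_pow_left₀ (norm_nonneg _) this 2
    nlinarith [sq_nonneg (‖x‖ - ‖y‖)]
  have h' := ENNReal.ofReal_le_ofReal h
  rw [ENNReal.ofReal_mul (by norm_num), ENNReal.ofReal_add (by positivity) (by positivity),
    ENNReal.ofReal_pow (norm_nonneg _), ENNReal.ofReal_pow (norm_nonneg _),
    ENNReal.ofReal_pow (norm_nonneg _), ofReal_norm, ofReal_norm, ofReal_norm] at h'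
  simpa using h'

lemma hsSq_add_le (A B : Op ι) : hsSq (A + B) ≤ 2 * (hsSq A + hsSq B) := by
  rw [hsSq, hsSq, hsSq, ← ENNReal.tsum_add, ← ENNReal.tsum_mul_left]
  exact ENNReal.tsum_le_tsum fun i => enorm_add_sq_le _ _

/-- The sums whose supremum over contractions `E`, `F` is the trace norm. -/
def traceSum (E F T : Op ι) : ℝ≥0∞ := ∑' i, ‖inner ℂ (F (basisVec i)) (T (E (basisVec i)))‖ₑ

lemma traceSum_mul_le_half {E F : Op ι} (hE : ‖E‖ ≤ 1) (hF : ‖F‖ ≤ 1) (X Y : Op ι) :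
    traceSum E F (X * Y) ≤ 2⁻¹ * (hsSq X + hsSq Y) := by
  have e1 : ∀ A : Op ι, ‖A‖ ≤ 1 → ‖A‖ₑ ^ 2 ≤ 1 := fun A hA => by
    refine pow_le_one' ?_ 2
    rw [← ofReal_norm]
    exact ENNReal.ofReal_le_one.2 hA
  have h1 : hsSq (star X * F) ≤ hsSq X := by
    refine (hsSq_mul_le_right _ _).trans ?_
    rw [hsSq_star]
    exact mul_le_of_le_one_right' (e1 F hF)
  have h2 : hsSq (Y * E) ≤ hsSq Y :=
    (hsSq_mul_le_right _ _).trans (mul_le_of_le_one_right' (e1 E hE))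
  refine le_trans ?_ (mul_le_mul_right (add_le_add h1 h2) _)
  rw [hsSq, hsSq, ← ENNReal.tsum_add, ← ENNReal.tsum_mul_left]
  refine ENNReal.tsum_le_tsum fun i => ?_
  have : inner ℂ (F (basisVec i)) ((X * Y) (E (basisVec i)))
      = inner ℂ ((star X * F) (basisVec i)) ((Y * E) (basisVec i)) := by
    simp only [op_mul_apply, inner_star_left]
  rw [this]
  exact enorm_inner_le_half _ _

omit [DecidableEq ι] in
lemma norm_absOp_apply (T : Op ι) (x : OneParticle ι) : ‖absOp T x‖ = ‖T x‖ := by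
  have h : inner ℂ (absOp T x) (absOp T x) = inner ℂ (T x) (T x) := by
    rw [← inner_star_right (absOp T), star_absOp, ← inner_star_right T]
    exact congrArg (fun A : Op ι => inner ℂ x (A x)) (absOp_mul_self T)
  rw [inner_self_eq_norm_sq_to_K, inner_self_eq_norm_sq_to_K] at h
  have h' : ‖absOp T x‖ ^ 2 = ‖T x‖ ^ 2 := by exact_mod_cast h
  exact (sq_eq_sq₀ (norm_nonneg _) (norm_nonneg _)).1 h'

omit [DecidableEq ι] in
/-- The polar decomposition `T = U |T|`, with `U† T = |T|`. The contraction `U` is the extension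
of `|T| x ↦ T x` to the closure of the range of `|T|`, by zero on its orthogonal complement. -/
lemma exists_polar (T : Op ι) : ∃ U : Op ι, ‖U‖ ≤ 1 ∧ U * absOp T = T ∧ star U * T = absOp T := by
  let S : Submodule ℂ (OneParticle ι) := (LinearMap.range (absOp T).toLinearMap).topologicalClosure
  have hS : IsClosed (S : Set (OneParticle ι)) := Submodule.isClosed_topologicalClosure _
  have : CompleteSpace S := hS.completeSpace_coe
  let e : OneParticle ι →L[ℂ] S := (absOp T).codRestrict S fun x =>
    Submodule.le_topologicalClosure _ ⟨x, rfl⟩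
  have hd : DenseRange e := by
    intro y
    rw [closure_subtype]
    have hy : (y : OneParticle ι) ∈ S := y.2
    have hset : ((↑) '' Set.range e : Set (OneParticle ι))
        = (LinearMap.range (absOp T).toLinearMap : Set (OneParticle ι)) := by
      ext z
      constructor
      · rintro ⟨_, ⟨x, rfl⟩, rfl⟩
        exact ⟨x, rfl⟩
      · rintro ⟨x, rfl⟩
        exact ⟨e x, ⟨x, rfl⟩, rfl⟩
    rw [hset]
    simpa [S, ← SetLike.mem_coe, Submodule.topologicalClosure_coe] using hy
  have hn : ∀ x, ‖T x‖ ≤ 1 * ‖e x‖ := fun x => by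
    rw [one_mul]
    exact (norm_absOp_apply T x).ge
  let V : S →L[ℂ] OneParticle ι := T.toLinearMap.extendOfNorm e.toLinearMap
  have hV : ∀ x, V (e x) = T x := fun x =>
    LinearMap.extendOfNorm_eq (f := T.toLinearMap) (e := e.toLinearMap) hd ⟨1, hn⟩ x
  have hVn : ‖V‖ ≤ 1 := LinearMap.opNorm_extendOfNorm_le (f := T.toLinearMap)
    (e := e.toLinearMap) hd zero_le_one hn
  let U : Op ι := V.comp S.orthogonalProjectionOnto
  have hUn : ‖U‖ ≤ 1 := by
    refine (ContinuousLinearMap.opNorm_comp_le _ _).trans ?_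
    exact mul_le_one₀ hVn (norm_nonneg _) (Submodule.orthogonalProjectionOnto_norm_le S)
  have hUT : ∀ x, U (absOp T x) = T x := fun x => by
    have : S.orthogonalProjectionOnto (absOp T x) = e x :=
      Submodule.orthogonalProjectionOnto_mem_subspace_eq_self (e x)
    change V (S.orthogonalProjectionOnto (absOp T x)) = T x
    rw [this, hV]
  refine ⟨U, hUn, ContinuousLinearMap.ext hUT, ContinuousLinearMap.ext fun x => ?_⟩
  -- `‖U†Tx - |T|x‖² ≤ ‖Tx‖² - 2 ⟨Tx, U|T|x⟩ + ‖|T|x‖² = 0`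
  rw [← sub_eq_zero, ← norm_eq_zero, ← sq_nonpos_iff]
  change ‖star U (T x) - absOp T x‖ ^ 2 ≤ 0
  rw [norm_sub_sq (𝕜 := ℂ), inner_star_left, hUT, inner_self_eq_norm_sq, norm_absOp_apply]
  have h1 : ‖star U (T x)‖ ≤ ‖T x‖ := by
    refine (ContinuousLinearMap.le_opNorm _ _).trans ?_
    rw [norm_star_op]
    exact mul_le_of_le_one_left (norm_nonneg _) hUn
  nlinarith [norm_nonneg (star U (T x)), norm_nonneg (T x)]

lemma traceNorm_eq_hsSq {T S : Op ι} (hs : star S = S) (hS : S * S = absOp T) :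
    traceNorm T = hsSq S := by
  rw [traceNorm, hsSq]
  refine tsum_congr fun i => ?_
  have : entry (absOp T) i i = ((‖S (basisVec i)‖ ^ 2 : ℝ) : ℂ) := by
    rw [entry_eq_inner, ← hS]
    nth_rw 1 [← hs]
    rw [op_mul_apply, inner_star_right, inner_self_eq_norm_sq_to_K]
    simp
  rw [this, Complex.ofReal_re, ENNReal.ofReal_pow (norm_nonneg _), ofReal_norm]

/-- A trace class operator is a product of two Hilbert-Schmidt operators. -/
lemma exists_hs_factor (T : Op ι) :
    ∃ X Y : Op ι, T = X * Y ∧ hsSq X ≤ traceNorm T ∧ hsSq Y = traceNorm T := by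
  obtain ⟨U, hU, hUT, -⟩ := exists_polar T
  obtain ⟨S, hs, hS⟩ := exists_sqrt_absOp T
  refine ⟨U * S, S, ?_, ?_, (traceNorm_eq_hsSq hs hS).symm⟩
  · rw [mul_assoc, hS, hUT]
  · rw [traceNorm_eq_hsSq hs hS]
    refine (hsSq_mul_le_left _ _).trans (mul_le_of_le_one_left' (pow_le_one' ?_ 2))
    rw [← ofReal_norm]
    exact ENNReal.ofReal_le_one.2 hU

lemma traceSum_le_traceNorm {E F : Op ι} (hE : ‖E‖ ≤ 1) (hF : ‖F‖ ≤ 1) (T : Op ι) :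
    traceSum E F T ≤ traceNorm T := by
  obtain ⟨X, Y, rfl, hX, hY⟩ := exists_hs_factor T
  refine (traceSum_mul_le_half hE hF X Y).trans ?_
  refine (mul_le_mul_right (add_le_add hX hY.le) _).trans (le_of_eq ?_)
  rw [← two_mul, ← mul_assoc, ENNReal.inv_mul_cancel (by norm_num) (by norm_num), one_mul]

/-- The variational characterization of the trace norm. -/
lemma traceNorm_le {T : Op ι} {c : ℝ≥0∞}
    (h : ∀ E F : Op ι, ‖E‖ ≤ 1 → ‖F‖ ≤ 1 → traceSum E F T ≤ c) : traceNorm T ≤ c := by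
  obtain ⟨U, hU, -, hUT⟩ := exists_polar T
  refine le_trans (ENNReal.tsum_le_tsum fun i => ?_) (h 1 U norm_one_op_le hU)
  rw [← hUT, entry_eq_inner, op_mul_apply, inner_star_right,
    ← ofReal_norm]
  exact ENNReal.ofReal_le_ofReal (Complex.re_le_norm _)

lemma traceNorm_add_le (A B : Op ι) : traceNorm (A + B) ≤ traceNorm A + traceNorm B := by
  refine traceNorm_le fun E F hE hF => ?_
  refine le_trans ?_ (add_le_add (traceSum_le_traceNorm hE hF A) (traceSum_le_traceNorm hE hF B))
  rw [traceSum, traceSum, traceSum, ← ENNReal.tsum_add]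
  refine ENNReal.tsum_le_tsum fun i => ?_
  rw [add_apply, inner_add_right]
  exact enorm_add_le _ _

lemma traceNorm_smul_le (c : ℂ) (A : Op ι) : traceNorm (c • A) ≤ ‖c‖ₑ * traceNorm A := by
  refine traceNorm_le fun E F hE hF => ?_
  refine le_trans (le_of_eq ?_) (mul_le_mul_right (traceSum_le_traceNorm hE hF A) _)
  rw [traceSum, traceSum, ← ENNReal.tsum_mul_left]
  simp_rw [smul_apply, inner_smul_right, enorm_mul]

lemma traceNorm_star_le (A : Op ι) : traceNorm (star A) ≤ traceNorm A := by
  refine traceNorm_le fun E F hE hF => ?_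
  refine le_trans (le_of_eq ?_) (traceSum_le_traceNorm hF hE A)
  refine tsum_congr fun i => ?_
  rw [inner_star_right, ← inner_conj_symm, RCLike.enorm_conj]

lemma traceNorm_conjOp_le (A : Op ι) : traceNorm (conjOp A) ≤ traceNorm A := by
  refine traceNorm_le fun E F hE hF => ?_
  refine le_trans (le_of_eq ?_) (traceSum_le_traceNorm (E := conjOp E) (F := conjOp F)
    (by rwa [norm_conjOp]) (by rwa [norm_conjOp]) A)
  refine tsum_congr fun i => ?_
  rw [conjOp_apply, conjOp_apply, conjOp_apply, star_basisVec]
  have := inner_star_star (star (F (basisVec i))) (A (star (E (basisVec i))))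
  rw [star_star] at this
  rw [this, RCLike.enorm_conj]

lemma traceNorm_mul_mul_le_of_le_one {A B : Op ι} (hA : ‖A‖ ≤ 1) (hB : ‖B‖ ≤ 1) (T : Op ι) :
    traceNorm (A * T * B) ≤ traceNorm T := by
  refine traceNorm_le fun E F hE hF => ?_
  refine le_trans (le_of_eq ?_) (traceSum_le_traceNorm (E := B * E) (F := star A * F)
    ((norm_mul_le _ _).trans (mul_le_one₀ hB (norm_nonneg _) hE))
    ((norm_mul_le _ _).trans (mul_le_one₀ (by rwa [norm_star_op]) (norm_nonneg _) hF)) T)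
  refine tsum_congr fun i => ?_
  simp only [op_mul_apply, inner_star_left]

omit [DecidableEq ι] in
lemma exists_smul_contraction (A : Op ι) : ∃ A' : Op ι, ‖A'‖ ≤ 1 ∧ A = (‖A‖ : ℂ) • A' := by
  rcases eq_or_ne A 0 with rfl | h
  · exact ⟨0, by simp, by simp⟩
  · have hA : (‖A‖ : ℂ) ≠ 0 := by simpa using h
    refine ⟨(‖A‖ : ℂ)⁻¹ • A, ?_, by rw [smul_inv_smul₀ hA]⟩
    rw [norm_smul, norm_inv, Complex.norm_real, norm_norm, inv_mul_cancel₀ (by simpa using h)]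

/-- The trace class operators are an ideal. -/
lemma traceNorm_mul_le_left (A T : Op ι) : traceNorm (A * T) ≤ ‖A‖ₑ * traceNorm T := by
  obtain ⟨A', hA', hA⟩ := exists_smul_contraction A
  have h1 : ‖(1 : Op ι)‖ ≤ 1 := norm_one_op_le
  have h : A * T = (‖A‖ : ℂ) • (A' * T * 1) := by
    conv_lhs => rw [hA]
    rw [smul_mul_assoc, mul_one]
  rw [h]
  refine (traceNorm_smul_le _ _).trans ?_
  rw [← ofReal_norm, Complex.norm_real, norm_norm, ofReal_norm]
  gcongr
  exact traceNorm_mul_mul_le_of_le_one hA' h1 T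

lemma traceNorm_mul_le_right (T B : Op ι) : traceNorm (T * B) ≤ traceNorm T * ‖B‖ₑ := by
  obtain ⟨B', hB', hB⟩ := exists_smul_contraction B
  have h1 : ‖(1 : Op ι)‖ ≤ 1 := norm_one_op_le
  have h : T * B = (‖B‖ : ℂ) • (1 * T * B') := by
    conv_lhs => rw [hB]
    rw [mul_smul_comm, one_mul]
  rw [h]
  refine (traceNorm_smul_le _ _).trans ?_
  rw [← ofReal_norm, Complex.norm_real, norm_norm, ofReal_norm, mul_comm]
  gcongr
  exact traceNorm_mul_mul_le_of_le_one h1 hB' T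

lemma traceNorm_mul_le_half (X Y : Op ι) : traceNorm (X * Y) ≤ 2⁻¹ * (hsSq X + hsSq Y) :=
  traceNorm_le fun _ _ hE hF => traceSum_mul_le_half hE hF X Y

/-- The diagonal of a trace class operator is absolutely summable. -/
lemma tsum_enorm_entry_le (T : Op ι) : ∑' i, ‖entry T i i‖ₑ ≤ traceNorm T := by
  have h1 : ‖(1 : Op ι)‖ ≤ 1 := norm_one_op_le
  refine le_trans (le_of_eq ?_) (traceSum_le_traceNorm h1 h1 T)
  exact tsum_congr fun i => by rw [entry_eq_inner]; rfl

lemma IsTraceClass.hasSum_entry {T : Op ι} (hT : traceNorm T < ⊤) :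
    HasSum (fun i => entry T i i) (sp T) := by
  have h : ∑' i, ‖entry T i i‖ₑ ≠ ⊤ := ((tsum_enorm_entry_le T).trans_lt hT).ne
  exact (Summable.of_nnnorm (ENNReal.tsum_coe_ne_top_iff_summable.1 h)).hasSum

lemma enorm_sum_entry_le (T : Op ι) (S : Finset ι) :
    ‖∑ i ∈ S, entry T i i‖ₑ ≤ traceNorm T :=
  (enorm_sum_le _ _).trans ((ENNReal.sum_le_tsum S).trans (tsum_enorm_entry_le T))

lemma enorm_sp_le {T : Op ι} (hT : traceNorm T < ⊤) : ‖sp T‖ₑ ≤ traceNorm T :=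
  le_of_tendsto ((IsTraceClass.hasSum_entry hT).enorm)
    (Eventually.of_forall fun S => enorm_sum_entry_le T S)

end TraceNorm

/-! ### Finite sections and integrals of trace class operators -/

section Projections

variable {ι : Type*} [DecidableEq ι]

/-- The matrix unit `|i⟩⟨j|`. -/
def matUnit (i j : ι) : Op ι := (innerSL ℂ (basisVec j)).smulRight (basisVec i)

lemma matUnit_apply (i j : ι) (x : OneParticle ι) : matUnit i j x = x j • basisVec i := by
  rw [matUnit, ContinuousLinearMap.smulRight_apply, innerSL_apply_apply, inner_basisVec_left]

/-- The projection onto the span of the modes in the finite set `S`. -/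
def projOp (S : Finset ι) : Op ι := ∑ i ∈ S, matUnit i i

lemma projOp_apply (S : Finset ι) (x : OneParticle ι) :
    projOp S x = ∑ i ∈ S, x i • basisVec i := by
  rw [projOp, sum_apply]
  exact Finset.sum_congr rfl fun i _ => matUnit_apply i i x

lemma projOp_apply_apply (S : Finset ι) (x : OneParticle ι) (i : ι) :
    projOp S x i = if i ∈ S then x i else 0 := by
  rw [projOp_apply, lp.coeFn_sum, Finset.sum_apply]
  simp only [lp.coeFn_smul, Pi.smul_apply, basisVec_apply, smul_eq_mul, mul_ite, mul_one, mul_zero,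
    Finset.sum_ite_eq]

lemma projOp_basisVec (S : Finset ι) (i : ι) :
    projOp S (basisVec i) = if i ∈ S then basisVec i else 0 := by
  refine lp.ext (funext fun j => ?_)
  rw [projOp_apply_apply]
  by_cases hij : i = j
  · subst hij
    by_cases h : i ∈ S <;> simp [h]
  · have h0 : basisVec i j = 0 := by rw [basisVec_apply, if_neg (Ne.symm hij)]
    rw [h0, ite_self]
    by_cases h : i ∈ S <;> simp only [h, if_true, if_false, h0, lp.coeFn_zero, Pi.zero_apply]

lemma projOp_mul_self (S : Finset ι) : projOp S * projOp S = projOp S :=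
  op_ext_apply fun i => by
    rw [op_mul_apply, projOp_basisVec]
    split_ifs with h
    · rw [projOp_basisVec, if_pos h]
    · simp

lemma star_projOp (S : Finset ι) : star (projOp S) = projOp S := by
  refine op_ext fun i j => ?_
  rw [entry_star, entry, entry, projOp_apply_apply, projOp_apply_apply, basisVec_apply,
    basisVec_apply]
  by_cases h : i = j
  · subst h; split_ifs <;> simp
  · simp [h, Ne.symm h]

omit [DecidableEq ι] in
lemma norm_le_one_of_apply {A : Op ι} (h : ∀ x i, ‖A x i‖ ≤ ‖x i‖) : ‖A‖ ≤ 1 := by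
  refine ContinuousLinearMap.opNorm_le_bound _ zero_le_one fun x => ?_
  rw [one_mul]
  have h2 : ‖A x‖ₑ ^ 2 ≤ ‖x‖ₑ ^ 2 := by
    rw [enorm_sq_eq_tsum, enorm_sq_eq_tsum]
    refine ENNReal.tsum_le_tsum fun i => pow_le_pow_left' ?_ 2
    rw [← ofReal_norm, ← ofReal_norm]
    exact ENNReal.ofReal_le_ofReal (h x i)
  rw [← ofReal_norm, ← ofReal_norm, ← ENNReal.ofReal_pow (norm_nonneg _),
    ← ENNReal.ofReal_pow (norm_nonneg _), ENNReal.ofReal_le_ofReal_iff (by positivity)] at h2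
  exact (sq_le_sq₀ (norm_nonneg _) (norm_nonneg _)).1 h2

lemma norm_projOp_le (S : Finset ι) : ‖projOp S‖ ≤ 1 :=
  norm_le_one_of_apply fun x i => by
    rw [projOp_apply_apply]; split_ifs <;> simp

lemma norm_one_sub_projOp_le (S : Finset ι) : ‖1 - projOp S‖ ≤ 1 :=
  norm_le_one_of_apply fun x i => by
    have : ((1 - projOp S) x) i = x i - projOp S x i := rfl
    rw [this, projOp_apply_apply]; split_ifs <;> simp

lemma tendsto_projOp_apply (x : OneParticle ι) :
    Tendsto (fun S : Finset ι => projOp S x) atTop (𝓝 x) := by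
  simp_rw [projOp_apply]
  exact hasSum_basisVec x

lemma tendsto_hsSq_mul_one_sub_projOp {Y : Op ι} (hY : hsSq Y ≠ ⊤) :
    Tendsto (fun S : Finset ι => hsSq (Y * (1 - projOp S))) atTop (𝓝 0) := by
  refine (ENNReal.tendsto_tsum_compl_atTop_zero hY).congr fun S => ?_
  refine (tsum_subtype {x | x ∉ S} (fun i => ‖Y (basisVec i)‖ₑ ^ 2)).trans ?_
  refine tsum_congr fun i => ?_
  have : (Y * (1 - projOp S)) (basisVec i) = Y (basisVec i - projOp S (basisVec i)) := rfl
  rw [this, projOp_basisVec, Set.indicator_apply]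
  by_cases h : i ∈ S <;> simp [h]

/-- A weighted form of `‖X Y‖₁ ≤ (‖X‖₂² + ‖Y‖₂²) / 2`, which is small as soon as one of the factors
is. -/
lemma traceNorm_mul_le_scaled {c : ℝ} (hc : 0 < c) (X Y : Op ι) :
    traceNorm (X * Y) ≤ ENNReal.ofReal (c ^ 2) * hsSq X + ENNReal.ofReal ((c⁻¹) ^ 2) * hsSq Y := by
  have h : X * Y = ((c : ℂ) • X) * (((c⁻¹ : ℝ) : ℂ) • Y) := by
    rw [smul_mul_smul_comm, ← Complex.ofReal_mul, mul_inv_cancel₀ hc.ne', Complex.ofReal_one,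
      one_smul]
  have e : ∀ r : ℝ, 0 < r → ‖(r : ℂ)‖ₑ ^ 2 = ENNReal.ofReal (r ^ 2) := fun r hr => by
    rw [← ofReal_norm, Complex.norm_real, Real.norm_of_nonneg hr.le, ENNReal.ofReal_pow hr.le]
  rw [h]
  refine (traceNorm_mul_le_half _ _).trans ?_
  rw [hsSq_smul, hsSq_smul, e c hc, e _ (inv_pos.2 hc)]
  exact mul_le_of_le_one_left' (by simp)

/-- `T P → T` in the trace norm, for the projections `P` onto the spans of finitely many modes. -/
lemma tendsto_traceNorm_mul_one_sub_projOp {T : Op ι} (hT : traceNorm T < ⊤) :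
    Tendsto (fun S : Finset ι => traceNorm (T * (1 - projOp S))) atTop (𝓝 0) := by
  obtain ⟨X, Y, hXY, hX, hY⟩ := exists_hs_factor T
  have hX' : hsSq X ≠ ⊤ := (hX.trans_lt hT).ne
  have hY' : hsSq Y ≠ ⊤ := (hY.trans_lt hT).ne
  refine ENNReal.tendsto_nhds_zero.2 fun ε hε => ?_
  have hε2 : 0 < ε / 2 := ENNReal.div_pos hε.ne' (by norm_num)
  -- a scaling which makes the contribution of `X` small
  obtain ⟨c, hc, hcX⟩ : ∃ c : ℝ, 0 < c ∧ ENNReal.ofReal (c ^ 2) * hsSq X ≤ ε / 2 := by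
    have h1 : Tendsto (fun c : ℝ => ENNReal.ofReal (c ^ 2) * hsSq X) (𝓝[>] 0) (𝓝 0) := by
      have h2 : Tendsto (fun c : ℝ => ENNReal.ofReal (c ^ 2)) (𝓝[>] 0) (𝓝 0) := by
        have : Tendsto (fun c : ℝ => ENNReal.ofReal (c ^ 2)) (𝓝 0)
            (𝓝 (ENNReal.ofReal (0 ^ 2))) :=
          (ENNReal.continuous_ofReal.comp (continuous_pow 2)).tendsto 0
        simpa using this.mono_left nhdsWithin_le_nhds
      simpa using ENNReal.Tendsto.mul_const h2 (Or.inr hX')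
    obtain ⟨c, hc, hc'⟩ := ((ENNReal.tendsto_nhds_zero.1 h1 _ hε2).and self_mem_nhdsWithin).exists
    exact ⟨c, hc', hc⟩
  have h3 : Tendsto (fun S : Finset ι => ENNReal.ofReal ((c⁻¹) ^ 2) * hsSq (Y * (1 - projOp S)))
      atTop (𝓝 0) := by
    simpa using ENNReal.Tendsto.const_mul (tendsto_hsSq_mul_one_sub_projOp hY')
      (Or.inr ENNReal.ofReal_ne_top)
  filter_upwards [ENNReal.tendsto_nhds_zero.1 h3 _ hε2] with S hS
  rw [hXY, mul_assoc]
  refine (traceNorm_mul_le_scaled hc _ _).trans ((add_le_add hcX hS).trans ?_)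
  rw [ENNReal.add_halves]

lemma tendsto_traceNorm_one_sub_projOp_mul {T : Op ι} (hT : traceNorm T < ⊤) :
    Tendsto (fun S : Finset ι => traceNorm ((1 - projOp S) * T)) atTop (𝓝 0) := by
  refine tendsto_of_tendsto_of_tendsto_of_le_of_le tendsto_const_nhds
    (tendsto_traceNorm_mul_one_sub_projOp ((traceNorm_star_le T).trans_lt hT))
    (fun _ => zero_le) fun S => ?_
  have : (1 - projOp S) * T = star (star T * (1 - projOp S)) := by
    rw [star_mul, star_star, star_sub, star_one, star_projOp]
  change traceNorm ((1 - projOp S) * T) ≤ _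
  rw [this]
  exact traceNorm_star_le _

lemma enorm_apply_sq_le_hsSq (X : Op ι) (x : OneParticle ι) :
    ‖X x‖ₑ ^ 2 ≤ hsSq X * ‖x‖ₑ ^ 2 := by
  rw [enorm_sq_eq_tsum, ← hsSq_star, hsSq, ← ENNReal.tsum_mul_right]
  refine ENNReal.tsum_le_tsum fun i => ?_
  rw [← mul_pow, ← inner_basisVec_left, ← inner_star_left]
  refine pow_le_pow_left' ?_ 2
  rw [← ofReal_norm, ← ofReal_norm, ← ofReal_norm, ← ENNReal.ofReal_mul (norm_nonneg _)]
  exact ENNReal.ofReal_le_ofReal (norm_inner_le_norm _ _)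

lemma enorm_le_traceNorm (T : Op ι) : ‖T‖ₑ ≤ traceNorm T := by
  rcases eq_or_ne (traceNorm T) ⊤ with h | h
  · rw [h]; exact le_top
  obtain ⟨X, Y, hXY, hX, hY⟩ := exists_hs_factor T
  rw [← ofReal_norm]
  refine ENNReal.ofReal_le_of_le_toReal (ContinuousLinearMap.opNorm_le_bound _
    ENNReal.toReal_nonneg fun x => ?_)
  have h1 : ‖T x‖ₑ ^ 2 ≤ (traceNorm T * ‖x‖ₑ) ^ 2 := by
    conv_lhs => rw [hXY]
    refine (enorm_apply_sq_le_hsSq X (Y x)).trans ?_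
    rw [mul_pow, sq (traceNorm T), mul_assoc]
    refine mul_le_mul' hX ((enorm_apply_sq_le_hsSq Y x).trans ?_)
    rw [hY]
  have h2 : ‖T x‖ₑ ≤ traceNorm T * ‖x‖ₑ := by
    by_contra hlt
    exact absurd h1 (not_le.2 (ENNReal.pow_lt_pow_left two_ne_zero (not_le.1 hlt)))
  have h3 := ENNReal.toReal_mono (ENNReal.mul_ne_top h enorm_ne_top) h2
  rwa [ENNReal.toReal_mul, toReal_enorm, toReal_enorm] at h3

end Projections

section Integrals

variable {ι : Type*} [DecidableEq ι] [Countable ι] {μ : Measure ℝ}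

/-- The trace norm of a weak integral is at most the integral of the trace norm. -/
lemma traceNorm_le_lintegral {W : ℝ → Op ι} {Δ : Op ι} (hW : WeaklyMeasurable μ W)
    (h : ∀ x y, inner ℂ x (Δ y) = ∫ s, inner ℂ x (W s y) ∂μ) :
    traceNorm Δ ≤ ∫⁻ s, traceNorm (W s) ∂μ := by
  refine traceNorm_le fun E F hE hF => ?_
  refine le_trans ?_ (lintegral_mono fun s => traceSum_le_traceNorm hE hF (W s))
  simp_rw [traceSum]
  rw [lintegral_tsum fun i => (hW.inner_aemeasurable _ _).enorm]
  refine ENNReal.tsum_le_tsum fun i => ?_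
  rw [h]
  exact enorm_integral_le_lintegral_enorm _

omit [Countable ι] in
lemma traceNorm_le_iSup_projOp (T : Op ι) :
    traceNorm T ≤ ⨆ S : Finset ι, traceNorm (projOp S * T * projOp S) := by
  refine traceNorm_le fun E F hE hF => ?_
  rw [traceSum, ENNReal.tsum_eq_iSup_sum]
  refine iSup_le fun J => ?_
  have h1 : Tendsto (fun S : Finset ι => ∑ i ∈ J, ‖inner ℂ (F (basisVec i))
      ((projOp S * T * projOp S) (E (basisVec i)))‖ₑ) atTop
      (𝓝 (∑ i ∈ J, ‖inner ℂ (F (basisVec i)) (T (E (basisVec i)))‖ₑ)) := by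
    refine tendsto_finsetSum _ fun i _ => Tendsto.enorm ?_
    have h2 : ∀ S : Finset ι, inner ℂ (F (basisVec i))
        ((projOp S * T * projOp S) (E (basisVec i)))
        = inner ℂ (projOp S (F (basisVec i))) (T (projOp S (E (basisVec i)))) := fun S => by
      conv_rhs => rw [← star_projOp S, inner_star_left, star_projOp]
      rfl
    simp_rw [h2]
    exact (tendsto_projOp_apply _).inner ((T.continuous.tendsto _).comp (tendsto_projOp_apply _))
  refine le_of_tendsto h1 (Eventually.of_forall fun S => ?_)
  exact (ENNReal.sum_le_tsum J).trans ((traceSum_le_traceNorm hE hF _).trans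
    (le_iSup (fun S : Finset ι => traceNorm (projOp S * T * projOp S)) S))

omit [Countable ι] in
lemma traceNorm_eq_iSup_projOp (T : Op ι) :
    traceNorm T = ⨆ S : Finset ι, traceNorm (projOp S * T * projOp S) :=
  le_antisymm (traceNorm_le_iSup_projOp T) (iSup_le fun S =>
    traceNorm_mul_mul_le_of_le_one (norm_projOp_le S) (norm_projOp_le S) T)

omit [Countable ι] in
lemma projOp_mul_mul_projOp (S : Finset ι) (T : Op ι) :
    projOp S * T * projOp S = ∑ p : S × S, entry T p.1 p.2 • matUnit (p.1 : ι) (p.2 : ι) := by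
  ext1 x
  rw [op_mul_apply, op_mul_apply, projOp_apply S x, map_sum, map_sum, sum_apply,
    Fintype.sum_prod_type_right]
  rw [← Finset.sum_coe_sort S]
  refine Finset.sum_congr rfl fun j _ => ?_
  rw [map_smul, map_smul, projOp_apply, Finset.smul_sum, ← Finset.sum_coe_sort S]
  refine Finset.sum_congr rfl fun i _ => ?_
  rw [smul_apply, matUnit_apply, smul_comm]
  rfl

omit [Countable ι] in
lemma traceNorm_matUnit_lt_top (i j : ι) : traceNorm (matUnit i j) < ⊤ := by
  have h : ∀ k l : ι, hsSq (matUnit k l) = 1 := fun k l => by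
    rw [hsSq, tsum_eq_single l]
    · rw [matUnit_apply, basisVec_apply, if_pos rfl, one_smul, ← ofReal_norm, norm_basisVec]
      simp
    · intro m hm
      rw [matUnit_apply, basisVec_apply, if_neg hm.symm]
      simp
  have h2 : matUnit i j = matUnit i j * matUnit j j := by
    ext1 x
    rw [op_mul_apply, matUnit_apply, matUnit_apply, matUnit_apply, lp.coeFn_smul, Pi.smul_apply,
      basisVec_apply, if_pos rfl, smul_eq_mul, mul_one]
  rw [h2]
  refine (traceNorm_mul_le_half _ _).trans_lt ?_
  rw [h, h]
  exact ENNReal.mul_lt_top (by simp) (by simp)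

omit [Countable ι] in
lemma traceNorm_sum_smul_le {κ : Type*} (J : Finset κ) (c : κ → ℂ) (E : κ → Op ι) :
    traceNorm (∑ p ∈ J, c p • E p) ≤ ∑ p ∈ J, ‖c p‖ₑ * traceNorm (E p) := by
  classical
  induction J using Finset.induction_on with
  | empty =>
    rw [Finset.sum_empty, Finset.sum_empty]
    refine (traceNorm_smul_le (0 : ℂ) (0 : Op ι)).trans' (le_of_eq ?_) |>.trans (by simp)
    rw [smul_zero]
  | insert p J hp ih =>
    rw [Finset.sum_insert hp, Finset.sum_insert hp]
    exact (traceNorm_add_le _ _).trans (add_le_add (traceNorm_smul_le _ _) ih)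

omit [Countable ι] in
lemma traceNorm_sub_rev_le (A B : Op ι) : traceNorm A ≤ traceNorm B + traceNorm (A - B) := by
  conv_lhs => rw [← add_sub_cancel B A]
  exact traceNorm_add_le _ _

/-- The trace norm of a weakly measurable family is measurable: it is the supremum of the trace
norms of the finite sections, which depend continuously on finitely many matrix elements. -/
lemma WeaklyMeasurable.traceNorm {V : ℝ → Op ι} (hV : WeaklyMeasurable μ V) :
    AEMeasurable (fun s => traceNorm (V s)) μ := by
  simp_rw [fun s => traceNorm_eq_iSup_projOp (V s)]
  refine AEMeasurable.iSup fun S => ?_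
  simp_rw [projOp_mul_mul_projOp]
  let Φ : (S × S → ℂ) → Op ι := fun M => ∑ p : S × S, M p • matUnit (p.1 : ι) (p.2 : ι)
  have hfin : ∀ M, QuadraticQFT.traceNorm (Φ M) < ⊤ := fun M =>
    (traceNorm_sum_smul_le _ _ _).trans_lt (ENNReal.sum_lt_top.2 fun p _ =>
      ENNReal.mul_lt_top enorm_lt_top (traceNorm_matUnit_lt_top _ _))
  have hΦ : Continuous fun M => QuadraticQFT.traceNorm (Φ M) := by
    refine continuous_iff_continuousAt.2 fun M => ?_
    have hsmall : Tendsto (fun N => ∑ p : S × S, ‖N p - M p‖ₑ *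
        QuadraticQFT.traceNorm (matUnit (p.1 : ι) (p.2 : ι))) (𝓝 M) (𝓝 0) := by
      have : Tendsto (fun N => ∑ p : S × S, ‖N p - M p‖ₑ *
        QuadraticQFT.traceNorm (matUnit (p.1 : ι) (p.2 : ι))) (𝓝 M) (𝓝 (∑ p : S × S, 0)) := by
        refine tendsto_finsetSum _ fun p _ => ?_
        have h1 : Tendsto (fun N : S × S → ℂ => ‖N p - M p‖ₑ) (𝓝 M) (𝓝 0) := by
          have : Continuous fun N : S × S → ℂ => ‖N p - M p‖ₑ := by fun_prop
          simpa using this.tendsto M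
        simpa using ENNReal.Tendsto.mul_const h1 (Or.inr (traceNorm_matUnit_lt_top _ _).ne)
      simpa using this
    have hdiff : ∀ N N' : S × S → ℂ, QuadraticQFT.traceNorm (Φ N - Φ N') ≤ ∑ p : S × S,
        ‖N p - N' p‖ₑ * QuadraticQFT.traceNorm (matUnit (p.1 : ι) (p.2 : ι)) := fun N N' => by
      have : Φ N - Φ N' = ∑ p : S × S, (N p - N' p) • matUnit (p.1 : ι) (p.2 : ι) := by
        simp only [Φ, ← Finset.sum_sub_distrib, sub_smul]
      rw [this]
      exact traceNorm_sum_smul_le _ _ _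
    refine (ENNReal.tendsto_nhds (hfin M).ne).2 fun ε hε => ?_
    filter_upwards [ENNReal.tendsto_nhds_zero.1 hsmall ε hε] with N hN
    constructor
    · refine tsub_le_iff_right.2 ((traceNorm_sub_rev_le (Φ M) (Φ N)).trans ?_)
      gcongr
      refine (hdiff M N).trans (le_trans (le_of_eq ?_) hN)
      exact Finset.sum_congr rfl fun p _ => by rw [enorm_sub_rev]
    · refine (traceNorm_sub_rev_le (Φ N) (Φ M)).trans ?_
      gcongr
      exact (hdiff N M).trans hN
  exact hΦ.measurable.comp_aemeasurable (aemeasurable_pi_lambda _ fun p => hV p.1 p.2)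

end Integrals

/-! ### Liouville's formula for the Fredholm determinant -/

section FiniteDet

variable {n : Type*} [Fintype n] [DecidableEq n]

attribute [local instance] Matrix.normedAddCommGroup Matrix.normedSpace

lemma contDiff_det : ContDiff ℝ 1 (fun M : Matrix n n ℂ => M.det) := by
  simp only [Matrix.det_apply]
  refine ContDiff.sum fun σ _ => ContDiff.const_smul _ (contDiff_prod fun i _ => ?_)
  exact (Matrix.entryLinearMap ℝ ℂ (σ i) i).toContinuousLinearMap.contDiff

/-- The derivative of the determinant at `M` in the direction `X M` is `tr X det M`. -/
lemma fderiv_det_mul (X M : Matrix n n ℂ) :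
    fderiv ℝ (fun M : Matrix n n ℂ => M.det) M (X * M) = X.trace * M.det := by
  have hd : HasFDerivAt (fun M : Matrix n n ℂ => M.det)
      (fderiv ℝ (fun M : Matrix n n ℂ => M.det) M) M :=
    ((contDiff_det (n := n)).differentiable one_ne_zero).differentiableAt.hasFDerivAt
  have hγ : HasDerivAt (fun r : ℝ => M + r • (X * M)) (X * M) 0 := by
    have := ((hasDerivAt_id (0 : ℝ)).smul_const (X * M)).const_add M
    simp only [one_smul, id] at this
    exact this
  have hd' : HasFDerivAt (fun M : Matrix n n ℂ => M.det)
      (fderiv ℝ (fun M : Matrix n n ℂ => M.det) M) (M + (0 : ℝ) • (X * M)) := by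
    rwa [zero_smul, add_zero]
  have h1 := hd'.comp_hasDerivAt (0 : ℝ) hγ
  -- `det (1 + r X) = 1 + r tr X + r² p(r)`
  let p : Polynomial ℂ :=
    (Matrix.det (1 + (Polynomial.X : Polynomial ℂ) • X.map Polynomial.C)).divX.divX
  have hp : ∀ r : ℝ, (M + r • (X * M)).det
      = (1 + X.trace * r + p.eval (r : ℂ) * (r : ℂ) ^ 2) * M.det := fun r => by
    rw [← Matrix.det_one_add_smul (r : ℂ) X, ← Matrix.det_mul]
    congr 1
    rw [add_mul, one_mul, smul_mul_assoc]
    rfl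
  have h2 : HasDerivAt (fun r : ℝ => (1 + X.trace * r + p.eval (r : ℂ) * (r : ℂ) ^ 2) * M.det)
      (X.trace * M.det) 0 := by
    have hq : HasDerivAt (fun z : ℂ => (1 + X.trace * z + p.eval z * z ^ 2) * M.det)
        ((X.trace * 1 + (p.derivative.eval 0 * 0 ^ 2 + p.eval 0 * (2 * 0))) * M.det)
        ((0 : ℝ) : ℂ) := by
      rw [Complex.ofReal_zero]
      exact ((((hasDerivAt_id (0 : ℂ)).const_mul X.trace).const_add 1).add
        ((p.hasDerivAt 0).mul (by simpa using hasDerivAt_pow 2 (0 : ℂ)))).mul_const _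
    simpa using hq.comp_ofReal
  have h3 : HasDerivAt (fun r : ℝ => (M + r • (X * M)).det) (X.trace * M.det) 0 := by
    simp_rw [hp]; exact h2
  exact h1.unique h3

/-- Liouville's formula for matrices: if `Ṁ = X M` and `M 0 = 1`, then `det M = exp ∫ tr X`. -/
lemma det_eq_exp_of_isPrimitive {t : ℝ} (ht : 0 ≤ t) {M X : ℝ → Matrix n n ℂ}
    (hM : ∀ i j, IsPrimitive t (fun s => M s i j) (fun s => (X s * M s) i j))
    (hX : IntervalIntegrable (fun s => (X s).trace) volume 0 t) (h0 : M 0 = 1)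
    {τ : ℝ} (hτ : τ ∈ Set.Icc 0 t) :
    (M τ).det = Complex.exp (∫ s in (0 : ℝ)..τ, (X s).trace) := by
  have hp : IsPrimitive t M (fun s => X s * M s) := by
    have h1 := isPrimitive_sum Finset.univ fun i _ => isPrimitive_sum Finset.univ fun j _ =>
      (hM i j).clm (Matrix.singleLinearMap ℝ i j).toContinuousLinearMap
    exact h1.congr ht (fun s _ => Matrix.matrix_eq_sum_single (M s))
      (fun s _ => Matrix.matrix_eq_sum_single (X s * M s))
  have hdet := (hp.comp_contDiff ht contDiff_det).congr ht (g := fun s => (M s).det)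
    (g' := fun s => (X s).trace * (M s).det) (fun _ _ => rfl)
    (fun s _ => (fderiv_det_mul (X s) (M s)).symm)
  rw [hdet.eq_exp ht hX hτ, h0, Matrix.det_one, one_mul]

end FiniteDet

section Liouville

variable {ι : Type*} [DecidableEq ι]

lemma entry_mul_projOp (A : Op ι) {S : Finset ι} (i : ι) {j : ι} (hj : j ∈ S) :
    entry (A * projOp S) i j = entry A i j := by
  rw [entry, op_mul_apply, projOp_basisVec, if_pos hj, entry]

lemma entry_mul_projOp_mul (A B : Op ι) (S : Finset ι) (i j : ι) :
    entry (A * projOp S * B) i j = ∑ k : S, entry A i k * entry B k j := by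
  rw [entry, op_mul_apply, op_mul_apply, projOp_apply, map_sum, lp.coeFn_sum, Finset.sum_apply,
    ← Finset.sum_coe_sort S]
  refine Finset.sum_congr rfl fun k _ => ?_
  rw [map_smul, lp.coeFn_smul, Pi.smul_apply, smul_eq_mul, mul_comm]
  rfl

/-- The finite section `P T P + (1 - P)`, as an operator on the whole space. -/
def secOp (S : Finset ι) (T : Op ι) : Op ι := projOp S * T * projOp S + (1 - projOp S)

lemma secOp_mul_one_sub (S : Finset ι) (T : Op ι) :
    secOp S T * (1 - projOp S) = 1 - projOp S := by
  have h := projOp_mul_self S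
  rw [secOp, add_mul, mul_assoc, mul_sub (projOp S), mul_one, h, sub_self, mul_zero, zero_add,
    mul_sub, mul_one, sub_mul, one_mul, h, sub_self, sub_zero]

lemma one_sub_mul_secOp (S : Finset ι) (T : Op ι) :
    (1 - projOp S) * secOp S T = 1 - projOp S := by
  have h := projOp_mul_self S
  rw [secOp, mul_add, ← mul_assoc, ← mul_assoc, sub_mul 1, one_mul, h, sub_self, zero_mul,
    zero_mul, zero_add, mul_sub, mul_one, sub_mul, one_mul, h, sub_self, sub_zero]

lemma projOp_mul_mul_eq_secOp_sub (S : Finset ι) (T : Op ι) :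
    projOp S * T * projOp S = secOp S T - (1 - projOp S) := (add_sub_cancel_right _ _).symm

/-- If `Ṫ = V T`, the section `P T P` solves `(P T P)˙ = X P T P`, where `X` is the compression of
`V T P Y` and `Y` is the inverse of the section. -/
lemma section_mul (S : Finset ι) {V T Y : Op ι} (hY : Y * secOp S T = 1) :
    V * T * projOp S * Y * projOp S * T * projOp S = V * T * projOp S := by
  have h1 : Y * (1 - projOp S) = 1 - projOp S := by
    conv_lhs => rw [← secOp_mul_one_sub S T, ← mul_assoc, hY, one_mul]
  have h2 : projOp S * (1 - projOp S) = 0 := by rw [mul_sub, mul_one, projOp_mul_self, sub_self]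
  have : V * T * projOp S * Y * projOp S * T * projOp S
      = V * T * (projOp S * (Y * (projOp S * T * projOp S))) := by simp only [mul_assoc]
  rw [this, projOp_mul_mul_eq_secOp_sub, mul_sub Y, hY, h1, mul_sub (projOp S) 1, h2, sub_zero,
    mul_one]

/-- The generator of the section differs from `V P` by an operator with the small factor
`V (1 - P)`. -/
lemma section_eq (S : Finset ι) {V T Y : Op ι} (hY : secOp S T * Y = 1) :
    V * T * projOp S * Y = V * projOp S + V * (1 - projOp S) * (T * projOp S * Y) := by
  have h1 : (1 - projOp S) * Y = 1 - projOp S := by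
    conv_lhs => rw [← one_sub_mul_secOp S T, mul_assoc, hY, mul_one]
  have h2 : V * projOp S = V * (projOp S * T * projOp S) * Y := by
    rw [projOp_mul_mul_eq_secOp_sub, mul_assoc, sub_mul, hY, h1, sub_sub_cancel]
  rw [h2]
  noncomm_ring

omit [DecidableEq ι] in
lemma IsPrimitive.inner_sub {t : ℝ} {f f' : ℝ → OneParticle ι} (hf : IsPrimitive t f f')
    (x : OneParticle ι) {τ : ℝ} (hτ : τ ∈ Set.Icc 0 t) :
    inner ℂ x (f τ - f 0) = ∫ s in (0 : ℝ)..τ, inner ℂ x (f' s) := by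
  have h0 : (0 : ℝ) ∈ Set.Icc 0 t := ⟨le_rfl, hτ.1.trans hτ.2⟩
  rw [hf.sub_eq h0 hτ]
  exact ((innerSL ℂ x).intervalIntegral_comp_comm (intervalIntegrable_sub hf.integrable h0 hτ)).symm

variable [Countable ι]

lemma traceNorm_le_of_interval {t τ : ℝ} (hτ : τ ∈ Set.Icc 0 t) {W : ℝ → Op ι} {Δ : Op ι}
    (hW : WeaklyMeasurable (volume.restrict (Set.Icc 0 t)) W)
    (h : ∀ x y, inner ℂ x (Δ y) = ∫ s in (0 : ℝ)..τ, inner ℂ x (W s y)) :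
    traceNorm Δ ≤ ∫⁻ s in Set.Icc 0 t, traceNorm (W s) := by
  have hsub : Set.Ioc 0 τ ⊆ Set.Icc 0 t := fun s hs => ⟨hs.1.le, hs.2.trans hτ.2⟩
  refine (traceNorm_le_lintegral (μ := volume.restrict (Set.Ioc 0 τ))
    (fun i j => (hW i j).mono_measure (Measure.restrict_mono hsub le_rfl)) fun x y => ?_).trans
    (lintegral_mono_set hsub)
  rw [h, intervalIntegral.integral_of_le hτ.1]

variable {t : ℝ} {V : ℝ → Op ι}

/-- A weakly measurable family of trace class operators with integrable trace norm. -/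
structure IsTraceL1 (t : ℝ) (V : ℝ → Op ι) : Prop where
  measurable : WeaklyMeasurable (volume.restrict (Set.Icc 0 t)) V
  traceClass : ∀ s ∈ Set.Icc 0 t, traceNorm (V s) < ⊤
  integrable : ∫⁻ s in Set.Icc 0 t, traceNorm (V s) < ⊤

lemma IsTraceL1.intervalIntegrable (ht : 0 ≤ t) (hV : IsTraceL1 t V) :
    IntervalIntegrable (fun s => (traceNorm (V s)).toReal) volume 0 t := by
  rw [intervalIntegrable_iff_integrableOn_Icc_of_le ht]
  exact integrable_toReal_of_lintegral_ne_top hV.measurable.traceNorm hV.integrable.ne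

omit [Countable ι] in
lemma norm_le_toReal_traceNorm {T : Op ι} (hT : traceNorm T < ⊤) :
    ‖T‖ ≤ (traceNorm T).toReal := by
  rw [← toReal_enorm]
  exact ENNReal.toReal_mono hT.ne (enorm_le_traceNorm T)

lemma IsTraceL1.tendsto_tail (hV : IsTraceL1 t V) :
    Tendsto (fun S : Finset ι => ∫⁻ s in Set.Icc 0 t, traceNorm (V s * (1 - projOp S)))
      atTop (𝓝 0) := by
  have := tendsto_lintegral_filter_of_dominated_convergence'
    (μ := volume.restrict (Set.Icc 0 t)) (l := (atTop : Filter (Finset ι)))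
    (F := fun S s => traceNorm (V s * (1 - projOp S))) (f := fun _ => 0)
    (fun s => traceNorm (V s))
    (Eventually.of_forall fun S =>
      (hV.measurable.mul (weaklyMeasurable_const (1 - projOp S))).traceNorm)
    (Eventually.of_forall fun S => Eventually.of_forall fun s => by
      refine (traceNorm_mul_le_right _ _).trans (mul_le_of_le_one_right' ?_)
      rw [← ofReal_norm]
      exact ENNReal.ofReal_le_one.2 (norm_one_sub_projOp_le S))
    hV.integrable.ne
    (by filter_upwards [self_mem_ae_restrict measurableSet_Icc] with s hs using
      tendsto_traceNorm_mul_one_sub_projOp (hV.traceClass s hs))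
  simpa using this

lemma IsTraceL1.tendsto_tail' (hV : IsTraceL1 t V) :
    Tendsto (fun S : Finset ι => ∫⁻ s in Set.Icc 0 t, traceNorm ((1 - projOp S) * V s))
      atTop (𝓝 0) := by
  have := tendsto_lintegral_filter_of_dominated_convergence'
    (μ := volume.restrict (Set.Icc 0 t)) (l := (atTop : Filter (Finset ι)))
    (F := fun S s => traceNorm ((1 - projOp S) * V s)) (f := fun _ => 0)
    (fun s => traceNorm (V s))
    (Eventually.of_forall fun S =>
      ((weaklyMeasurable_const (1 - projOp S)).mul hV.measurable).traceNorm)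
    (Eventually.of_forall fun S => Eventually.of_forall fun s => by
      refine (traceNorm_mul_le_left _ _).trans (mul_le_of_le_one_left' ?_)
      rw [← ofReal_norm]
      exact ENNReal.ofReal_le_one.2 (norm_one_sub_projOp_le S))
    hV.integrable.ne
    (by filter_upwards [self_mem_ae_restrict measurableSet_Icc] with s hs using
      tendsto_traceNorm_one_sub_projOp_mul (hV.traceClass s hs))
  simpa using this

lemma IsTraceL1.mul_continuousOn (hV : IsTraceL1 t V) {T : ℝ → Op ι}
    (hT : ContinuousOn T (Set.Icc 0 t)) : IsTraceL1 t (fun s => V s * T s) := by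
  obtain ⟨b, hb⟩ := isCompact_Icc.exists_bound_of_continuousOn hT
  have hle : ∀ s ∈ Set.Icc 0 t, traceNorm (V s * T s) ≤ traceNorm (V s) * ENNReal.ofReal b := by
    intro s hs
    refine (traceNorm_mul_le_right _ _).trans ?_
    gcongr
    rw [← ofReal_norm]
    exact ENNReal.ofReal_le_ofReal (hb s hs)
  refine ⟨hV.measurable.mul (weaklyMeasurable_of_continuousOn hT), fun s hs => ?_, ?_⟩
  · exact (hle s hs).trans_lt (ENNReal.mul_lt_top (hV.traceClass s hs) ENNReal.ofReal_lt_top)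
  · refine (lintegral_mono_ae (g := fun s => traceNorm (V s) * ENNReal.ofReal b) ?_).trans_lt ?_
    · filter_upwards [self_mem_ae_restrict measurableSet_Icc] with s hs using hle s hs
    · rw [lintegral_mul_const' _ _ ENNReal.ofReal_ne_top]
      exact ENNReal.mul_lt_top hV.integrable ENNReal.ofReal_lt_top

lemma IsTraceL1.continuousOn_mul (hV : IsTraceL1 t V) {T : ℝ → Op ι}
    (hT : ContinuousOn T (Set.Icc 0 t)) : IsTraceL1 t (fun s => T s * V s) := by
  obtain ⟨b, hb⟩ := isCompact_Icc.exists_bound_of_continuousOn hT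
  have hle : ∀ s ∈ Set.Icc 0 t, traceNorm (T s * V s) ≤ ENNReal.ofReal b * traceNorm (V s) := by
    intro s hs
    refine (traceNorm_mul_le_left _ _).trans ?_
    gcongr
    rw [← ofReal_norm]
    exact ENNReal.ofReal_le_ofReal (hb s hs)
  refine ⟨(weaklyMeasurable_of_continuousOn hT).mul hV.measurable, fun s hs => ?_, ?_⟩
  · exact (hle s hs).trans_lt (ENNReal.mul_lt_top ENNReal.ofReal_lt_top (hV.traceClass s hs))
  · refine (lintegral_mono_ae (g := fun s => ENNReal.ofReal b * traceNorm (V s)) ?_).trans_lt ?_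
    · filter_upwards [self_mem_ae_restrict measurableSet_Icc] with s hs using hle s hs
    · rw [lintegral_const_mul' _ _ ENNReal.ofReal_ne_top]
      exact ENNReal.mul_lt_top ENNReal.ofReal_lt_top hV.integrable

lemma IsTraceL1.add (hV : IsTraceL1 t V) {W : ℝ → Op ι} (hW : IsTraceL1 t W) :
    IsTraceL1 t (fun s => V s + W s) := by
  refine ⟨hV.measurable.add hW.measurable, fun s hs => ?_, ?_⟩
  · exact (traceNorm_add_le _ _).trans_lt
      (ENNReal.add_lt_top.2 ⟨hV.traceClass s hs, hW.traceClass s hs⟩)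
  · refine (lintegral_mono fun s => traceNorm_add_le (V s) (W s)).trans_lt ?_
    rw [lintegral_add_left' hV.measurable.traceNorm]
    exact ENNReal.add_lt_top.2 ⟨hV.integrable, hW.integrable⟩

omit [Countable ι] in
lemma IsTraceL1.const_smul (hV : IsTraceL1 t V) (c : ℂ) : IsTraceL1 t (fun s => c • V s) := by
  refine ⟨hV.measurable.const_smul c, fun s hs => ?_, ?_⟩
  · exact (traceNorm_smul_le _ _).trans_lt (ENNReal.mul_lt_top enorm_lt_top (hV.traceClass s hs))
  · refine (lintegral_mono fun s => traceNorm_smul_le c (V s)).trans_lt ?_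
    rw [lintegral_const_mul' _ _ enorm_ne_top]
    exact ENNReal.mul_lt_top enorm_lt_top hV.integrable

omit [Countable ι] in
lemma IsTraceL1.conjOp (hV : IsTraceL1 t V) : IsTraceL1 t (fun s => conjOp (V s)) :=
  ⟨hV.measurable.conjOp, fun s hs => (traceNorm_conjOp_le _).trans_lt (hV.traceClass s hs),
    (lintegral_mono fun s => traceNorm_conjOp_le (V s)).trans_lt hV.integrable⟩

lemma IsTraceL1.intervalIntegrable_sp (ht : 0 ≤ t) (hV : IsTraceL1 t V) :
    IntervalIntegrable (fun s => sp (V s)) volume 0 t := by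
  refine intervalIntegrable_of_norm_le ht (hV.intervalIntegrable ht) ?_ fun s hs => ?_
  · refine AEMeasurable.aestronglyMeasurable ?_
    refine aemeasurable_of_tendsto_metrizable_ae (atTop : Filter (Finset ι))
      (f := fun S s => ∑ i ∈ S, entry (V s) i i)
      (fun _ => Finset.aemeasurable_fun_sum _ fun i _ => hV.measurable i i) ?_
    filter_upwards [self_mem_ae_restrict measurableSet_Icc] with s hs
    exact IsTraceClass.hasSum_entry (hV.traceClass s hs)
  · rw [← toReal_enorm]
    exact ENNReal.toReal_mono (hV.traceClass s hs).ne (enorm_sp_le (hV.traceClass s hs))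

/-- A strong primitive of an integrable family of trace class operators differs from its initial
value by a trace class operator. -/
lemma traceNorm_sub_le_of_isPrimitive {T W : ℝ → Op ι}
    (hW : WeaklyMeasurable (volume.restrict (Set.Icc 0 t)) W)
    (hT : ∀ x, IsPrimitive t (fun τ => T τ x) (fun s => W s x)) {τ : ℝ} (hτ : τ ∈ Set.Icc 0 t) :
    traceNorm (T τ - T 0) ≤ ∫⁻ s in Set.Icc 0 t, traceNorm (W s) :=
  traceNorm_le_of_interval hτ hW fun x y => (hT y).inner_sub x hτ

end Liouville

/-! ### Convergence of the finite section determinants -/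

section Liouville

variable {ι : Type*} [DecidableEq ι] [Countable ι] {t : ℝ} {V T L : ℝ → Op ι}

/-- The finite sections of `T` tend to `T` in the operator norm, uniformly in time. -/
lemma exists_tendsto_sub_secOp (hV : IsTraceL1 t V) (hTc : ContinuousOn T (Set.Icc 0 t))
    (hT : ∀ x, IsPrimitive t (fun τ => T τ x) (fun s => V s (T s x))) (hT0 : T 0 = 1) :
    ∃ δ : Finset ι → ℝ≥0∞, Tendsto δ atTop (𝓝 0) ∧
      ∀ S, ∀ τ ∈ Set.Icc 0 t, ‖T τ - secOp S (T τ)‖ₑ ≤ δ S := by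
  have hW := hV.mul_continuousOn hTc
  refine ⟨fun S => (∫⁻ s in Set.Icc 0 t, traceNorm (V s * T s * (1 - projOp S)))
    + ∫⁻ s in Set.Icc 0 t, traceNorm ((1 - projOp S) * (V s * T s)), ?_, fun S τ hτ => ?_⟩
  · simpa using hW.tendsto_tail.add hW.tendsto_tail'
  have hWm := hW.measurable
  have hP := weaklyMeasurable_const (μ := volume.restrict (Set.Icc 0 t)) (projOp S)
  have hWP := (hP.mul hWm).mul hP
  have h0 : (0 : ℝ) ∈ Set.Icc 0 t := ⟨le_rfl, hτ.1.trans hτ.2⟩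
  refine (enorm_le_traceNorm _).trans ((traceNorm_le_of_interval hτ
    (W := fun s => V s * T s - projOp S * (V s * T s) * projOp S) (hWm.sub hWP)
    fun x y => ?_).trans ?_)
  · have e1 : (T τ - secOp S (T τ)) y
        = (T τ y - T 0 y) - projOp S (T τ (projOp S y) - T 0 (projOp S y)) := by
      have : T τ - secOp S (T τ) = (T τ - 1) - projOp S * (T τ - 1) * projOp S := by
        rw [secOp, mul_sub, mul_one, sub_mul, projOp_mul_self]; abel
      rw [this, hT0]; rfl
    have e2 : ∀ z, inner ℂ x (projOp S z) = inner ℂ (projOp S x) z := fun z => by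
      rw [← inner_star_right, star_projOp]
    rw [e1, inner_sub_right, e2, (hT y).inner_sub x hτ, (hT _).inner_sub _ hτ,
      ← intervalIntegral.integral_sub]
    · refine intervalIntegral.integral_congr fun s _ => ?_
      simp only [sub_apply, op_mul_apply, inner_sub_right, e2]
    · exact intervalIntegrable_sub ((hT y).clm ((innerSL ℂ x).restrictScalars ℝ)).integrable h0 hτ
    · exact intervalIntegrable_sub
        ((hT (projOp S y)).clm ((innerSL ℂ (projOp S x)).restrictScalars ℝ)).integrable h0 hτ
  · refine le_trans ?_ (lintegral_add_left'
      (hWm.mul (weaklyMeasurable_const (1 - projOp S))).traceNorm _).le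
    refine lintegral_mono fun s => ?_
    have : V s * T s - projOp S * (V s * T s) * projOp S
        = V s * T s * (1 - projOp S) + 1 * ((1 - projOp S) * (V s * T s)) * projOp S := by
      noncomm_ring
    change traceNorm (V s * T s - projOp S * (V s * T s) * projOp S) ≤ _
    rw [this]
    exact (traceNorm_add_le _ _).trans (add_le_add le_rfl
      (traceNorm_mul_mul_le_of_le_one norm_one_op_le (norm_projOp_le S) _))

omit [DecidableEq ι] [Countable ι] in
/-- Neumann series: a small perturbation of an invertible operator is invertible. -/
lemma isUnit_of_norm_sub_le {T' A L' : Op ι} {c : ℝ} (hTL : T' * L' = 1) (hLT : L' * T' = 1)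
    (hc : ‖L'‖ ≤ c) (hδ : ‖T' - A‖ * c ≤ 1 / 2) :
    IsUnit A ∧ ‖Ring.inverse A‖ ≤ 2 * c := by
  have hsmall : ‖(T' - A) * L'‖ ≤ 1 / 2 :=
    (norm_mul_le _ _).trans ((mul_le_mul_of_nonneg_left hc (norm_nonneg _)).trans hδ)
  have hu : IsUnit (1 - (T' - A) * L') := isUnit_one_sub_of_norm_lt_one (by linarith)
  have hA : A = (1 - (T' - A) * L') * T' := by
    rw [sub_mul, one_mul, mul_assoc, hLT, mul_one, sub_sub_cancel]
  have hT' : IsUnit T' := ⟨⟨T', L', hTL, hLT⟩, rfl⟩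
  have hAu : IsUnit A := by rw [hA]; exact hu.mul hT'
  refine ⟨hAu, ?_⟩
  set Y := Ring.inverse A with hY
  have hAY : A * Y = 1 := Ring.mul_inverse_cancel A hAu
  have hYe : Y = L' + L' * (T' - A) * Y := by
    have : L' * (T' - A) * Y = L' * T' * Y - L' * (A * Y) := by noncomm_ring
    rw [this, hAY, hLT, one_mul, mul_one]; abel
  have h1 : ‖Y‖ ≤ c + c * ‖T' - A‖ * ‖Y‖ := by
    conv_lhs => rw [hYe]
    refine (norm_add_le _ _).trans (add_le_add hc ((norm_mul_le _ _).trans ?_))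
    refine mul_le_mul_of_nonneg_right ((norm_mul_le _ _).trans ?_) (norm_nonneg _)
    exact mul_le_mul_of_nonneg_right hc (norm_nonneg _)
  nlinarith [norm_nonneg Y]

/-- The determinant of the finite section `P T P`, by Liouville's formula for matrices. -/
lemma det_section_eq_exp (ht : 0 ≤ t) (hV : IsTraceL1 t V) (hTc : ContinuousOn T (Set.Icc 0 t))
    (hT : ∀ x, IsPrimitive t (fun τ => T τ x) (fun s => V s (T s x))) (hT0 : T 0 = 1)
    {S : Finset ι} (hS : ∀ τ ∈ Set.Icc 0 t, IsUnit (secOp S (T τ))) :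
    IntervalIntegrable (fun s =>
      ∑ i ∈ S, entry (V s * T s * projOp S * Ring.inverse (secOp S (T s))) i i) volume 0 t ∧
    ∀ τ ∈ Set.Icc 0 t, Matrix.det (fun i j : S => entry (T τ) i j)
      = Complex.exp (∫ s in (0 : ℝ)..τ,
        ∑ i ∈ S, entry (V s * T s * projOp S * Ring.inverse (secOp S (T s))) i i) := by
  have hPc : ContinuousOn (fun _ : ℝ => projOp S) (Set.Icc 0 t) := continuousOn_const
  have hsec : ContinuousOn (fun s => secOp S (T s)) (Set.Icc 0 t) :=
    ((hPc.mul hTc).mul hPc).add continuousOn_const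
  have hYc : ContinuousOn (fun s => Ring.inverse (secOp S (T s))) (Set.Icc 0 t) := fun s hs => by
    obtain ⟨u, hu⟩ := hS s hs
    have h1 := NormedRing.inverse_continuousAt u
    rw [hu] at h1
    exact h1.comp_continuousWithinAt (f := fun s => secOp S (T s)) (hsec s hs)
  have hZ : IsTraceL1 t (fun s => V s * T s * projOp S * Ring.inverse (secOp S (T s))) :=
    ((hV.mul_continuousOn hTc).mul_continuousOn hPc).mul_continuousOn hYc
  have hint : IntervalIntegrable (fun s =>
      ∑ i ∈ S, entry (V s * T s * projOp S * Ring.inverse (secOp S (T s))) i i) volume 0 t := by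
    refine intervalIntegrable_of_norm_le ht (hZ.intervalIntegrable ht)
      (Finset.aemeasurable_fun_sum S fun i _ => hZ.measurable i i).aestronglyMeasurable
      fun s hs => ?_
    rw [← toReal_enorm]
    exact ENNReal.toReal_mono (hZ.traceClass s hs).ne (enorm_sum_entry_le _ S)
  refine ⟨hint, fun τ hτ => ?_⟩
  let M : ℝ → Matrix S S ℂ := fun s => Matrix.of fun i j : S => entry (T s) i j
  let X : ℝ → Matrix S S ℂ := fun s => Matrix.of fun i j : S =>
    entry (V s * T s * projOp S * Ring.inverse (secOp S (T s))) i j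
  have htr : ∀ s, (X s).trace
      = ∑ i ∈ S, entry (V s * T s * projOp S * Ring.inverse (secOp S (T s))) i i := fun s => by
    rw [← Finset.sum_coe_sort S]; rfl
  have hM : ∀ i j, IsPrimitive t (fun s => M s i j) (fun s => (X s * M s) i j) := fun i j => by
    have h1 := (hT (basisVec (j : ι))).clm
      ((innerSL ℂ (basisVec (i : ι))).restrictScalars ℝ)
    refine h1.congr ht (fun s _ => ?_) (fun s hs => ?_)
    · exact entry_eq_inner (T s) i j
    · rw [Matrix.mul_apply]
      have e := section_mul S (V := V s) (T := T s) (Ring.inverse_mul_cancel _ (hS s hs))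
      have e2 := congrArg (fun A : Op ι => entry A i j) e
      simp only [entry_mul_projOp _ _ j.2] at e2
      rw [entry_mul_projOp_mul] at e2
      refine e2.trans ?_
      rw [entry_eq_inner]; rfl
  have hM0 : M 0 = 1 := by
    ext i j
    change entry (T 0) i j = _
    rw [hT0, entry_one, Matrix.one_apply]
    simp only [Subtype.ext_iff]
  have := det_eq_exp_of_isPrimitive ht hM (by simp_rw [htr]; exact hint) hM0 hτ
  simp_rw [htr] at this
  exact this

omit [Countable ι] in
/-- The trace of the generator of the section is close to the trace of `V'`. -/
lemma enorm_sum_section_sub_sp_le {V' T' Y : Op ι} (hV' : traceNorm V' < ⊤) {S : Finset ι}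
    (hY : secOp S T' * Y = 1) :
    ‖(∑ i ∈ S, entry (V' * T' * projOp S * Y) i i) - sp V'‖ₑ
      ≤ traceNorm (V' * (1 - projOp S)) * (‖T' * projOp S * Y‖ₑ + 1) := by
  have htail : traceNorm (V' * (1 - projOp S)) < ⊤ :=
    (traceNorm_mul_le_right _ _).trans_lt (ENNReal.mul_lt_top hV' enorm_lt_top)
  have h1 : ∑ i ∈ S, entry (V' * T' * projOp S * Y) i i = ∑ i ∈ S, entry V' i i
      + ∑ i ∈ S, entry (V' * (1 - projOp S) * (T' * projOp S * Y)) i i := by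
    rw [← Finset.sum_add_distrib]
    refine Finset.sum_congr rfl fun i hi => ?_
    rw [section_eq S hY, entry_add, entry_mul_projOp _ _ hi]
  have h2 : sp V' = ∑ i ∈ S, entry V' i i + sp (V' * (1 - projOp S)) := by
    have a := IsTraceClass.hasSum_entry hV'
    have b := IsTraceClass.hasSum_entry htail
    have c : HasSum (fun i => if i ∈ S then entry V' i i else 0) (∑ i ∈ S, entry V' i i) := by
      have := hasSum_sum_of_ne_finset_zero (f := fun i => if i ∈ S then entry V' i i else 0)
        (s := S) (L := SummationFilter.unconditional ι) (fun i hi => if_neg hi)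
      rwa [Finset.sum_congr rfl fun i hi => if_pos hi] at this
    refine a.unique ((c.add b).congr_fun fun i => ?_)
    have e : entry (V' * (1 - projOp S)) i i = entry V' i i - entry (V' * projOp S) i i := by
      rw [mul_sub, mul_one, entry_sub]
    rw [e]
    by_cases hi : i ∈ S
    · rw [if_pos hi, entry_mul_projOp _ _ hi, sub_self, add_zero]
    · rw [if_neg hi, entry, entry, op_mul_apply, projOp_basisVec, if_neg hi, map_zero]
      simp
  rw [h1, h2, add_sub_add_left_eq_sub, mul_add, mul_one]
  refine (enorm_sub_le).trans (add_le_add ?_ (enorm_sp_le htail))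
  exact (enorm_sum_entry_le _ S).trans (traceNorm_mul_le_right _ _)

/-- Liouville's formula for the finite section limit of the determinant. -/
theorem tendsto_det_section (ht : 0 ≤ t) (hV : IsTraceL1 t V) (hTc : ContinuousOn T (Set.Icc 0 t))
    (hLc : ContinuousOn L (Set.Icc 0 t))
    (hT : ∀ x, IsPrimitive t (fun τ => T τ x) (fun s => V s (T s x))) (hT0 : T 0 = 1)
    (hTL : ∀ τ ∈ Set.Icc 0 t, T τ * L τ = 1) (hLT : ∀ τ ∈ Set.Icc 0 t, L τ * T τ = 1)
    {τ : ℝ} (hτ : τ ∈ Set.Icc 0 t) :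
    Tendsto (fun S : Finset ι => Matrix.det (fun i j : S => entry (T τ) i j)) atTop
      (𝓝 (Complex.exp (∫ s in (0 : ℝ)..τ, sp (V s)))) := by
  have h0 : (0 : ℝ) ∈ Set.Icc 0 t := ⟨le_rfl, ht⟩
  obtain ⟨b, hb⟩ := isCompact_Icc.exists_bound_of_continuousOn hTc
  obtain ⟨c, hc⟩ := isCompact_Icc.exists_bound_of_continuousOn hLc
  have hb0 : 0 ≤ b := (norm_nonneg _).trans (hb 0 h0)
  have hc0 : 0 ≤ c := (norm_nonneg _).trans (hc 0 h0)
  obtain ⟨δ, hδ, hδ'⟩ := exists_tendsto_sub_secOp hV hTc hT hT0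
  have hsmall : ∀ᶠ S : Finset ι in atTop, δ S * ENNReal.ofReal c ≤ ENNReal.ofReal (1 / 2) := by
    have := ENNReal.Tendsto.mul_const hδ (Or.inr (ENNReal.ofReal_ne_top (r := c)))
    rw [zero_mul] at this
    exact ENNReal.tendsto_nhds_zero.1 this _ (ENNReal.ofReal_pos.2 (by norm_num))
  have hunit : ∀ᶠ S : Finset ι in atTop, ∀ s ∈ Set.Icc 0 t, IsUnit (secOp S (T s)) ∧
      ‖Ring.inverse (secOp S (T s))‖ ≤ 2 * c := by
    filter_upwards [hsmall] with S hS s hs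
    refine isUnit_of_norm_sub_le (hTL s hs) (hLT s hs) (hc s hs) ?_
    have h1 : ‖T s - secOp S (T s)‖ₑ * ENNReal.ofReal c ≤ ENNReal.ofReal (1 / 2) :=
      (mul_le_mul_left (hδ' S s hs) _).trans hS
    rw [← ofReal_norm, ← ENNReal.ofReal_mul (norm_nonneg _)] at h1
    exact (ENNReal.ofReal_le_ofReal_iff (by norm_num)).1 h1
  refine Tendsto.congr' (f₁ := fun S : Finset ι => Complex.exp (∫ s in (0 : ℝ)..τ,
      ∑ i ∈ S, entry (V s * T s * projOp S * Ring.inverse (secOp S (T s))) i i)) ?_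
    ((Complex.continuous_exp.tendsto _).comp ?_)
  · filter_upwards [hunit] with S hS
    exact ((det_section_eq_exp ht hV hTc hT hT0 (fun s hs => (hS s hs).1)).2 τ hτ).symm
  · rw [tendsto_iff_edist_tendsto_0]
    have hlim := ENNReal.Tendsto.mul_const hV.tendsto_tail
      (Or.inr (ENNReal.ofReal_ne_top (r := b * (2 * c) + 1)))
    rw [zero_mul] at hlim
    refine tendsto_of_tendsto_of_tendsto_of_le_of_le' tendsto_const_nhds hlim
      (Eventually.of_forall fun _ => zero_le) ?_
    filter_upwards [hunit] with S hS
    have hi := (det_section_eq_exp ht hV hTc hT hT0 (fun s hs => (hS s hs).1)).1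
    rw [edist_eq_enorm_sub, ← intervalIntegral.integral_sub (intervalIntegrable_sub hi h0 hτ)
      (intervalIntegrable_sub (hV.intervalIntegrable_sp ht) h0 hτ),
      intervalIntegral.integral_of_le hτ.1, ← lintegral_mul_const' _ _ ENNReal.ofReal_ne_top]
    refine (enorm_integral_le_lintegral_enorm _).trans ?_
    have hsub : Set.Ioc 0 τ ⊆ Set.Icc 0 t := fun s hs => ⟨hs.1.le, hs.2.trans hτ.2⟩
    refine (lintegral_mono_set hsub).trans (lintegral_mono_ae ?_)
    filter_upwards [self_mem_ae_restrict measurableSet_Icc] with s hs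
    refine (enorm_sum_section_sub_sp_le (hV.traceClass s hs)
      (Ring.mul_inverse_cancel _ (hS s hs).1)).trans ?_
    gcongr
    rw [ENNReal.ofReal_add (by positivity) zero_le_one, ENNReal.ofReal_one]
    gcongr
    rw [← ofReal_norm]
    refine ENNReal.ofReal_le_ofReal ((norm_mul_le _ _).trans (mul_le_mul ((norm_mul_le _ _).trans
      (mul_le_of_le_one_right (norm_nonneg _) (norm_projOp_le S) |>.trans (hb s hs)))
      (hS s hs).2 (norm_nonneg _) hb0))

/-- Liouville's formula: if `Ṫ = V T`, `T 0 = 1`, with `V` trace class, and `T` is invertible, then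
`det T = exp ∫ Sp V`. -/
theorem fredholmDet_eq_exp (ht : 0 ≤ t) (hV : IsTraceL1 t V) (hTc : ContinuousOn T (Set.Icc 0 t))
    (hLc : ContinuousOn L (Set.Icc 0 t))
    (hT : ∀ x, IsPrimitive t (fun τ => T τ x) (fun s => V s (T s x))) (hT0 : T 0 = 1)
    (hTL : ∀ τ ∈ Set.Icc 0 t, T τ * L τ = 1) (hLT : ∀ τ ∈ Set.Icc 0 t, L τ * T τ = 1)
    {τ : ℝ} (hτ : τ ∈ Set.Icc 0 t) :
    fredholmDet (T τ) = Complex.exp (∫ s in (0 : ℝ)..τ, sp (V s)) :=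
  (tendsto_det_section ht hV hTc hLc hT hT0 hTL hLT hτ).limUnder_eq

lemma isTraceClass_sub_one (hV : IsTraceL1 t V) (hTc : ContinuousOn T (Set.Icc 0 t))
    (hT : ∀ x, IsPrimitive t (fun τ => T τ x) (fun s => V s (T s x))) (hT0 : T 0 = 1)
    {τ : ℝ} (hτ : τ ∈ Set.Icc 0 t) : IsTraceClass (T τ - 1) := by
  have hW := hV.mul_continuousOn hTc
  have := traceNorm_sub_le_of_isPrimitive hW.measurable hT hτ
  rw [hT0] at this
  exact this.trans_lt hW.integrable

end Liouville

/-! ### The unitary time-ordered exponential of a trace class path -/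

section Unitary

lemma IsPrimitive.inner_prod {E : Type*} [NormedAddCommGroup E] [InnerProductSpace ℂ E]
    [CompleteSpace E] {t : ℝ} (ht : 0 ≤ t) {f f' g g' : ℝ → E} (hf : IsPrimitive t f f')
    (hg : IsPrimitive t g g') :
    IsPrimitive t (fun s => inner ℂ (f s) (g s))
      (fun s => inner ℂ (f s) (g' s) + inner ℂ (f' s) (g s)) := by
  have hB : IsBoundedBilinearMap ℝ fun p : E × E => inner ℂ p.1 p.2 := isBoundedBilinearMap_inner
  exact hf.bilin ht hg hB.toContinuousLinearMap

variable {ι : Type*} [DecidableEq ι] {t : ℝ} {C C' R R' : ℝ → Op ι}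

lemma IsTraceClassPath.isTraceL1 (hC : IsTraceClassPath t C) : IsTraceL1 t C :=
  ⟨hC.measurable, hC.traceClass, hC.integrable⟩

omit [DecidableEq ι] in
lemma continuousOn_star {T : ℝ → Op ι} {s : Set ℝ} (h : ContinuousOn T s) :
    ContinuousOn (fun τ => star (T τ)) s :=
  ContinuousLinearMap.adjoint.continuous.comp_continuousOn h

omit [DecidableEq ι] in
lemma continuousOn_conjOp {T : ℝ → Op ι} {s : Set ℝ} (h : ContinuousOn T s) :
    ContinuousOn (fun τ => conjOp (T τ)) s := continuous_conjOp.comp_continuousOn h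

variable [Countable ι]

lemma IsTraceL1.isL1Generator (ht : 0 ≤ t) (hC : IsTraceL1 t C) :
    IsL1Generator t C (fun s => (traceNorm (C s)).toReal) :=
  ⟨hC.intervalIntegrable ht, fun s hs => norm_le_toReal_traceNorm (hC.traceClass s hs),
    fun _ hy => hC.measurable.apply hy⟩

lemma IsTexp.continuousOn_of_path (ht : 0 ≤ t) (hC : IsTraceClassPath t C) (hR : IsTexp t C R) :
    ContinuousOn R (Set.Icc 0 t) :=
  hR.continuousOn ht (hC.isTraceL1.isL1Generator ht)

omit [Countable ι] in
/-- The matrix elements of `R† R'` for two self-adjoint generators. -/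
lemma isPrimitive_inner_texp (ht : 0 ≤ t) (hC : IsTraceClassPath t C) (hR : IsTexp t C R)
    (hR' : IsTexp t C' R') (x y : OneParticle ι) :
    IsPrimitive t (fun s => inner ℂ x ((star (R s) * R' s) y))
      (fun s => inner ℂ x ((-Complex.I • (star (R s) * (C' s - C s) * R' s)) y)) := by
  refine ((hR.isPrimitive ht x).inner_prod ht (hR'.isPrimitive ht y)).congr ht (fun s _ => ?_)
    (fun s hs => ?_)
  · rw [op_mul_apply, inner_star_right]
  · have h1 : inner ℂ (C s (R s x)) (R' s y) = inner ℂ (R s x) (C s (R' s y)) := by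
      rw [← inner_star_right, (hC.selfAdjoint s hs).star_eq]
    simp only [smul_apply, op_mul_apply, inner_smul_right, inner_smul_left, inner_star_right,
      sub_apply, inner_sub_right, h1, map_neg, Complex.conj_I]
    ring

omit [Countable ι] in
lemma IsTexp.star_mul_self (ht : 0 ≤ t) (hC : IsTraceClassPath t C) (hR : IsTexp t C R) {τ : ℝ}
    (hτ : τ ∈ Set.Icc 0 t) : star (R τ) * R τ = 1 := by
  refine op_ext_inner fun x y => ?_
  rw [(isPrimitive_inner_texp ht hC hR hR x y).const_of_zero (fun s _ => by simp) hτ, hR.zero ht,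
    star_one, mul_one]

lemma IsTexp.mul_star_self (ht : 0 ≤ t) (hC : IsTraceClassPath t C) (hR : IsTexp t C R) {τ : ℝ}
    (hτ : τ ∈ Set.Icc 0 t) : R τ * star (R τ) = 1 := by
  have hc := hR.continuousOn_of_path ht hC
  exact mul_eq_one_of_continuousOn ht hc (continuousOn_star hc)
    (fun τ hτ => hR.star_mul_self ht hC hτ) (by rw [hR.zero ht, star_one, mul_one]) τ hτ

omit [Countable ι] in
lemma IsTexp.norm_le_one (ht : 0 ≤ t) (hC : IsTraceClassPath t C) (hR : IsTexp t C R) {τ : ℝ}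
    (hτ : τ ∈ Set.Icc 0 t) : ‖R τ‖ ≤ 1 := by
  refine ContinuousLinearMap.opNorm_le_bound _ zero_le_one fun x => le_of_eq ?_
  have h : inner ℂ (R τ x) (R τ x) = inner ℂ x x := by
    rw [← inner_star_right, ← op_mul_apply, hR.star_mul_self ht hC hτ]; rfl
  rw [inner_self_eq_norm_sq_to_K, inner_self_eq_norm_sq_to_K] at h
  have h' : ‖R τ x‖ ^ 2 = ‖x‖ ^ 2 := by exact_mod_cast h
  rw [one_mul]
  exact (sq_eq_sq₀ (norm_nonneg _) (norm_nonneg _)).1 h'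

omit [DecidableEq ι] [Countable ι] in
lemma enorm_le_one_of_norm_le_one {A : Op ι} (h : ‖A‖ ≤ 1) : ‖A‖ₑ ≤ 1 := by
  rw [← ofReal_norm]
  exact ENNReal.ofReal_le_one.2 h

/-- The time-ordered exponential is Lipschitz in the generator, for the trace norms. -/
lemma traceNorm_texp_sub_le (ht : 0 ≤ t) (hC : IsTraceClassPath t C) (hR : IsTexp t C R)
    (hC' : IsTraceClassPath t C') (hR' : IsTexp t C' R') {τ : ℝ} (hτ : τ ∈ Set.Icc 0 t) :
    traceNorm (R' τ - R τ) ≤ ∫⁻ s in Set.Icc 0 t, traceNorm (C' s - C s) := by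
  have hRc := hR.continuousOn_of_path ht hC
  have hRc' := hR'.continuousOn_of_path ht hC'
  have hWm : WeaklyMeasurable (volume.restrict (Set.Icc 0 t))
      (fun s => -Complex.I • (star (R s) * (C' s - C s) * R' s)) :=
    ((((weaklyMeasurable_of_continuousOn hRc).star.mul
      (WeaklyMeasurable.sub hC'.measurable hC.measurable)).mul
      (weaklyMeasurable_of_continuousOn hRc')).const_smul _)
  have h1 : traceNorm (star (R τ) * R' τ - 1)
      ≤ ∫⁻ s in Set.Icc 0 t, traceNorm (-Complex.I • (star (R s) * (C' s - C s) * R' s)) := by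
    refine traceNorm_le_of_interval hτ hWm fun x y => ?_
    have := (isPrimitive_inner_texp ht hC hR hR' x y).eq τ hτ
    rw [hR.zero ht, hR'.zero ht, star_one, mul_one] at this
    rw [sub_apply, inner_sub_right, this, add_sub_cancel_left]
  have h2 : R' τ - R τ = R τ * (star (R τ) * R' τ - 1) := by
    rw [mul_sub, ← mul_assoc, hR.mul_star_self ht hC hτ, one_mul, mul_one]
  rw [h2]
  refine (traceNorm_mul_le_left _ _).trans ((mul_le_of_le_one_left'
    (enorm_le_one_of_norm_le_one (hR.norm_le_one ht hC hτ))).trans (h1.trans ?_))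
  refine lintegral_mono_ae ?_
  filter_upwards [self_mem_ae_restrict measurableSet_Icc] with s hs
  refine (traceNorm_smul_le _ _).trans ?_
  rw [enorm_neg, ← ofReal_norm, Complex.norm_I, ENNReal.ofReal_one, one_mul]
  exact traceNorm_mul_mul_le_of_le_one (by rw [norm_star_op]; exact hR.norm_le_one ht hC hs)
    (hR'.norm_le_one ht hC' hs) _

lemma IsTexp.isTraceClass_sub_one (ht : 0 ≤ t) (hC : IsTraceClassPath t C) (hR : IsTexp t C R)
    {τ : ℝ} (hτ : τ ∈ Set.Icc 0 t) : IsTraceClass (R τ - 1) :=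
  QuadraticQFT.isTraceClass_sub_one (hC.isTraceL1.const_smul (-Complex.I))
    (hR.continuousOn_of_path ht hC) (hR.isPrimitive ht) (hR.zero ht) hτ

omit [Countable ι] in
lemma sp_smul (c : ℂ) (A : Op ι) : sp (c • A) = c * sp A := by
  simp_rw [sp, entry_smul, tsum_mul_left]

lemma IsTexp.fredholmDet_eq (ht : 0 ≤ t) (hC : IsTraceClassPath t C) (hR : IsTexp t C R) {τ : ℝ}
    (hτ : τ ∈ Set.Icc 0 t) :
    fredholmDet (R τ) = Complex.exp (-Complex.I * ∫ s in (0 : ℝ)..τ, sp (C s)) := by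
  have hRc := hR.continuousOn_of_path ht hC
  rw [fredholmDet_eq_exp ht (hC.isTraceL1.const_smul (-Complex.I)) hRc (continuousOn_star hRc)
    (hR.isPrimitive ht) (hR.zero ht) (fun τ hτ => hR.mul_star_self ht hC hτ)
    (fun τ hτ => hR.star_mul_self ht hC hτ) hτ]
  simp_rw [sp_smul]
  rw [intervalIntegral.integral_const_mul]

end Unitary

/-! ### The canonical dynamics -/

section HilbertUnits

variable {H : Type*} [NormedAddCommGroup H] [InnerProductSpace ℂ H] [CompleteSpace H]

/-- An element with a left and a right multiple that are units is a unit. -/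
lemma isUnit_of_mul_isUnit {𝓐 : Type*} [Ring 𝓐] {a b c : 𝓐} (h1 : IsUnit (b * a))
    (h2 : IsUnit (a * c)) : IsUnit a := by
  obtain ⟨u, hu⟩ := h1
  obtain ⟨v, hv⟩ := h2
  have e1 : (↑u⁻¹ * b) * a = 1 := by rw [mul_assoc, ← hu, Units.inv_mul]
  have e2 : a * (c * ↑v⁻¹) = 1 := by rw [← mul_assoc, ← hv, Units.mul_inv]
  have e3 := left_inv_eq_right_inv e1 e2
  exact ⟨⟨a, c * ↑v⁻¹, e2, by rw [← e3, e1]⟩, rfl⟩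

lemma isUnit_one_add_star_mul_self (B : H →L[ℂ] H) : IsUnit (1 + star B * B) := by
  refine CStarAlgebra.isUnit_of_le (1 : H →L[ℂ] H) ?_
  exact le_add_of_nonneg_right (star_mul_self_nonneg B)

/-- An operator `T` is invertible if `T† T` and `T T†` are of the form `1 + B† B`. -/
lemma isUnit_of_star_mul_self_eq {T B B' : H →L[ℂ] H} (h1 : star T * T = 1 + star B * B)
    (h2 : T * star T = 1 + star B' * B') : IsUnit T :=
  isUnit_of_mul_isUnit (h1 ▸ isUnit_one_add_star_mul_self B)
    (h2 ▸ isUnit_one_add_star_mul_self B')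

end HilbertUnits

section Blocks

variable {ι : Type*}

lemma canonGen_apply (C A : Op ι) (z : OneParticle ι × OneParticle ι) :
    canonGen C A z = (C z.1 + A z.2, -(conjOp A z.1) - conjOp C z.2) := rfl

/-- The operator on `H × H` with the given blocks. -/
def blockOp (P Q U W : Op ι) :
    (OneParticle ι × OneParticle ι) →L[ℂ] (OneParticle ι × OneParticle ι) :=
  (ContinuousLinearMap.inl ℂ _ _).comp (P.comp (ContinuousLinearMap.fst ℂ _ _)) +
  (ContinuousLinearMap.inl ℂ _ _).comp (Q.comp (ContinuousLinearMap.snd ℂ _ _)) +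
  (ContinuousLinearMap.inr ℂ _ _).comp (U.comp (ContinuousLinearMap.fst ℂ _ _)) +
  (ContinuousLinearMap.inr ℂ _ _).comp (W.comp (ContinuousLinearMap.snd ℂ _ _))

lemma blockOp_apply (P Q U W : Op ι) (z : OneParticle ι × OneParticle ι) :
    blockOp P Q U W z = (P z.1 + Q z.2, U z.1 + W z.2) := by
  refine Prod.ext ?_ ?_ <;> simp [blockOp]

lemma continuousOn_blockOp {P Q U W : ℝ → Op ι} {s : Set ℝ} (hP : ContinuousOn P s)
    (hQ : ContinuousOn Q s) (hU : ContinuousOn U s) (hW : ContinuousOn W s) :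
    ContinuousOn (fun τ => blockOp (P τ) (Q τ) (U τ) (W τ)) s :=
  (((continuousOn_const.clm_comp (hP.clm_comp continuousOn_const)).add
    (continuousOn_const.clm_comp (hQ.clm_comp continuousOn_const))).add
    (continuousOn_const.clm_comp (hU.clm_comp continuousOn_const))).add
    (continuousOn_const.clm_comp (hW.clm_comp continuousOn_const))

variable (D : (OneParticle ι × OneParticle ι) →L[ℂ] (OneParticle ι × OneParticle ι))

/-- The upper right block. -/
def psiBlock : Op ι :=
  (ContinuousLinearMap.fst ℂ _ _).comp (D.comp (ContinuousLinearMap.inr ℂ _ _))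

/-- The lower left block. -/
def lowerLeft : Op ι :=
  (ContinuousLinearMap.snd ℂ _ _).comp (D.comp (ContinuousLinearMap.inl ℂ _ _))

/-- The lower right block. -/
def lowerRight : Op ι :=
  (ContinuousLinearMap.snd ℂ _ _).comp (D.comp (ContinuousLinearMap.inr ℂ _ _))

lemma phiBlock_apply (x : OneParticle ι) : phiBlock D x = (D (x, 0)).1 := rfl
lemma psiBlock_apply (x : OneParticle ι) : psiBlock D x = (D (0, x)).1 := rfl
lemma lowerLeft_apply (x : OneParticle ι) : lowerLeft D x = (D (x, 0)).2 := rfl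
lemma lowerRight_apply (x : OneParticle ι) : lowerRight D x = (D (0, x)).2 := rfl

variable {D : ℝ → (OneParticle ι × OneParticle ι) →L[ℂ] (OneParticle ι × OneParticle ι)}
  {s : Set ℝ}

lemma continuousOn_phiBlock (h : ContinuousOn D s) : ContinuousOn (fun τ => phiBlock (D τ)) s :=
  continuousOn_const.clm_comp (h.clm_comp continuousOn_const)

lemma continuousOn_psiBlock (h : ContinuousOn D s) : ContinuousOn (fun τ => psiBlock (D τ)) s :=
  continuousOn_const.clm_comp (h.clm_comp continuousOn_const)

lemma continuousOn_lowerLeft (h : ContinuousOn D s) :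
    ContinuousOn (fun τ => lowerLeft (D τ)) s :=
  continuousOn_const.clm_comp (h.clm_comp continuousOn_const)

lemma continuousOn_lowerRight (h : ContinuousOn D s) :
    ContinuousOn (fun τ => lowerRight (D τ)) s :=
  continuousOn_const.clm_comp (h.clm_comp continuousOn_const)

end Blocks

section Dynamics

variable {ι : Type*} [DecidableEq ι] [Countable ι] {t a : ℝ} {C A : ℝ → Op ι} {ε : ℤˣ}
  {D : ℝ → (OneParticle ι × OneParticle ι) →L[ℂ] (OneParticle ι × OneParticle ι)}

lemma units_int_mul_self (ε : ℤˣ) : ((ε : ℤ) : ℂ) * ((ε : ℤ) : ℂ) = 1 := by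
  rcases Int.units_eq_one_or ε with rfl | rfl <;> simp

lemma isL1Generator_canonGen (ht : 0 ≤ t) (hC : IsTraceClassPath t C)
    (hAm : WeaklyMeasurable (volume.restrict (Set.Icc 0 t)) A)
    (hAb : ∀ τ ∈ Set.Icc 0 t, ‖A τ‖ ≤ a) :
    IsL1Generator t (fun s => canonGen (C s) (A s)) (fun s => (traceNorm (C s)).toReal + a) := by
  refine ⟨(hC.isTraceL1.intervalIntegrable ht).add intervalIntegrable_const, fun s hs => ?_,
    fun y hy => ?_⟩
  · have hCs := norm_le_toReal_traceNorm (hC.traceClass s hs)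
    have hAs := hAb s hs
    have hnn : 0 ≤ (traceNorm (C s)).toReal + a :=
      add_nonneg ENNReal.toReal_nonneg ((norm_nonneg _).trans hAs)
    have hle : ∀ (T S : Op ι), ‖T‖ + ‖S‖ ≤ (traceNorm (C s)).toReal + a →
        ∀ z : OneParticle ι × OneParticle ι, ‖T z.1‖ + ‖S z.2‖
          ≤ ((traceNorm (C s)).toReal + a) * ‖z‖ := by
      intro T S h z
      calc ‖T z.1‖ + ‖S z.2‖ ≤ ‖T‖ * ‖z‖ + ‖S‖ * ‖z‖ := add_le_add
            ((T.le_opNorm _).trans (mul_le_mul_of_nonneg_left (norm_fst_le z) (norm_nonneg _)))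
            ((S.le_opNorm _).trans (mul_le_mul_of_nonneg_left (norm_snd_le z) (norm_nonneg _)))
        _ = (‖T‖ + ‖S‖) * ‖z‖ := by ring
        _ ≤ _ := mul_le_mul_of_nonneg_right h (norm_nonneg _)
    refine ContinuousLinearMap.opNorm_le_bound _ hnn fun z => ?_
    rw [canonGen_apply, Prod.norm_mk]
    refine max_le ((norm_add_le _ _).trans (hle _ _ (add_le_add hCs hAs) z)) ?_
    refine (norm_sub_le _ _).trans ?_
    rw [norm_neg]
    refine hle _ _ ?_ z
    rw [norm_conjOp, norm_conjOp, add_comm]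
    exact add_le_add hCs hAs
  · have h1 := hy.fst
    have h2 := hy.snd
    have hCm : WeaklyMeasurable (volume.restrict (Set.Icc 0 t)) C := hC.measurable
    exact ((hCm.apply h1).add (hAm.apply h2)).prodMk
      (((hAm.conjOp.apply h1).neg).sub (hCm.conjOp.apply h2))

omit [DecidableEq ι] [Countable ι] in
lemma IsTexp.isPrimitive_fst (ht : 0 ≤ t) (hD : IsTexp t (fun s => canonGen (C s) (A s)) D)
    (z : OneParticle ι × OneParticle ι) : IsPrimitive t (fun s => (D s z).1)
      (fun s => -Complex.I • (C s (D s z).1 + A s (D s z).2)) :=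
  (hD.isPrimitive ht z).clm (ContinuousLinearMap.fst ℝ (OneParticle ι) (OneParticle ι))

omit [DecidableEq ι] [Countable ι] in
lemma IsTexp.isPrimitive_snd (ht : 0 ≤ t) (hD : IsTexp t (fun s => canonGen (C s) (A s)) D)
    (z : OneParticle ι × OneParticle ι) : IsPrimitive t (fun s => (D s z).2)
      (fun s => Complex.I • (conjOp (A s) (D s z).1 + conjOp (C s) (D s z).2)) := by
  have h := (hD.isPrimitive ht z).clm
    (ContinuousLinearMap.snd ℝ (OneParticle ι) (OneParticle ι))
  refine h.congr ht (fun _ _ => rfl) fun s _ => ?_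
  change _ = -Complex.I • (-(conjOp (A s) (D s z).1) - conjOp (C s) (D s z).2)
  rw [neg_smul, ← smul_neg, neg_sub', neg_neg, sub_neg_eq_add]

omit [DecidableEq ι] [Countable ι] in
/-- The generator anticommutes with the exchange of the two components followed by complex
conjugation. -/
lemma canonGen_star_swap (C A : Op ι) (z : OneParticle ι × OneParticle ι) :
    -Complex.I • canonGen C A (star z.2, star z.1)
      = (star (Complex.I • (conjOp A z.1 + conjOp C z.2)),
        star (-Complex.I • (C z.1 + A z.2))) := by
  rw [canonGen_apply]
  have e1 : ∀ x y : OneParticle ι,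
      star (Complex.I • (x + y)) = -Complex.I • (star y + star x) := by
    intro x y
    rw [star_smul, star_add, add_comm, Complex.star_def, Complex.conj_I]
  have e2 : ∀ x y : OneParticle ι,
      star (-Complex.I • (x + y)) = -Complex.I • (-star y - star x) := by
    intro x y
    rw [star_smul, star_add, star_neg, Complex.star_def, Complex.conj_I, neg_neg, neg_smul,
      ← smul_neg, neg_sub', neg_neg, sub_neg_eq_add, add_comm]
  rw [e1, e2, conjOp_apply, conjOp_apply, conjOp_apply, conjOp_apply]
  simp only [star_star]
  rfl

/-- The lower right block of the canonical dynamics is `Φ̄`, by uniqueness and the symmetry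
`canonGen_star_swap` of the generator. -/
lemma IsTexp.canon_swap (ht : 0 ≤ t) (hC : IsTraceClassPath t C)
    (hAm : WeaklyMeasurable (volume.restrict (Set.Icc 0 t)) A)
    (hAb : ∀ τ ∈ Set.Icc 0 t, ‖A τ‖ ≤ a)
    (hD : IsTexp t (fun s => canonGen (C s) (A s)) D) {τ : ℝ} (hτ : τ ∈ Set.Icc 0 t) :
    conjOp (phiBlock (D τ)) = lowerRight (D τ) := by
  refine ContinuousLinearMap.ext fun y => ?_
  have hg := isL1Generator_canonGen ht hC hAm hAb
  have h1 := (hD.isPrimitive_fst ht (star y, 0)).clm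
    ((starL' ℝ : OneParticle ι ≃L[ℝ] OneParticle ι) : OneParticle ι →L[ℝ] OneParticle ι)
  have h2 := (hD.isPrimitive_snd ht (star y, 0)).clm
    ((starL' ℝ : OneParticle ι ≃L[ℝ] OneParticle ι) : OneParticle ι →L[ℝ] OneParticle ι)
  have h3 := h2.prodMk ht h1
  have h4 := h3.congr ht (g := fun s => (star (D s (star y, 0)).2, star (D s (star y, 0)).1))
    (g' := fun s => -Complex.I • canonGen (C s) (A s)
      (star (D s (star y, 0)).2, star (D s (star y, 0)).1)) (fun s _ => rfl)
      (fun s _ => canonGen_star_swap (C s) (A s) (D s (star y, 0)))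
  have h5 := hg.solution_unique ht h4 (hD.isPrimitive ht (0, y))
    (by rw [hD.zero_apply ht, hD.zero_apply ht, star_star, star_zero]) hτ
  rw [conjOp_apply, phiBlock_apply, lowerRight_apply]
  exact congrArg Prod.snd h5

omit [Countable ι] in
/-- The canonical dynamics preserves the form `⟨·, σ ·⟩` with `σ = diag (1, -ε)`. -/
lemma IsTexp.canon_form (ht : 0 ≤ t) (hC : IsTraceClassPath t C)
    (hAs : ∀ τ ∈ Set.Icc 0 t, star (A τ) = ((ε : ℤ) : ℂ) • conjOp (A τ))
    (hD : IsTexp t (fun s => canonGen (C s) (A s)) D) {τ : ℝ} (hτ : τ ∈ Set.Icc 0 t)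
    (z w : OneParticle ι × OneParticle ι) :
    inner ℂ (D τ z).1 (D τ w).1 - ((ε : ℤ) : ℂ) * inner ℂ (D τ z).2 (D τ w).2
      = inner ℂ z.1 w.1 - ((ε : ℤ) : ℂ) * inner ℂ z.2 w.2 := by
  have h1 := (hD.isPrimitive_fst ht z).inner_prod ht (hD.isPrimitive_fst ht w)
  have h2 := ((hD.isPrimitive_snd ht z).inner_prod ht (hD.isPrimitive_snd ht w)).clm
    ((ContinuousLinearMap.mul ℝ ℂ) (-((ε : ℤ) : ℂ)))
  have h3 := (h1.add h2).const_of_zero (fun s hs => ?_) hτ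
  · simp only [ContinuousLinearMap.mul_apply', neg_mul, ← sub_eq_add_neg, hD.zero_apply ht] at h3
    exact h3
  · have hee := units_int_mul_self ε
    have hCs : ∀ x y, inner ℂ (C s x) y = inner ℂ x (C s y) := fun x y => by
      rw [← inner_star_right, (hC.selfAdjoint s hs).star_eq]
    have hCs' : ∀ x y, inner ℂ (conjOp (C s) x) y = inner ℂ x (conjOp (C s) y) := fun x y => by
      rw [← inner_star_right, ← conjOp_star, (hC.selfAdjoint s hs).star_eq]
    have hA1 : ∀ x y, inner ℂ (A s x) y = ((ε : ℤ) : ℂ) * inner ℂ x (conjOp (A s) y) :=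
      fun x y => by
        rw [← inner_star_right, hAs s hs, smul_apply, inner_smul_right]
    have hA2 : ∀ x y, inner ℂ (conjOp (A s) x) y = ((ε : ℤ) : ℂ) * inner ℂ x (A s y) :=
      fun x y => by
        rw [← inner_star_right, ← conjOp_star, hAs s hs, conjOp_smul, conjOp_conjOp, map_intCast,
          smul_apply, inner_smul_right]
    simp only [ContinuousLinearMap.mul_apply']
    simp only [inner_smul_left, inner_smul_right, inner_add_left, inner_add_right, hCs, hCs', hA1,
      hA2, map_neg, Complex.conj_I]
    linear_combination (Complex.I * inner ℂ (D s z).1 (A s (D s w).2)) * hee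

/-- The inverse of `D` for the form `⟨·, σ ·⟩`: the operator `σ D† σ`. -/
def canonInv (ε : ℤˣ)
    (D : (OneParticle ι × OneParticle ι) →L[ℂ] (OneParticle ι × OneParticle ι)) :
    (OneParticle ι × OneParticle ι) →L[ℂ] (OneParticle ι × OneParticle ι) :=
  blockOp (star (phiBlock D)) (-((ε : ℤ) : ℂ) • star (lowerLeft D))
      (-((ε : ℤ) : ℂ) • star (psiBlock D)) (star (lowerRight D))

omit [DecidableEq ι] [Countable ι] in
lemma canonInv_apply (ε : ℤˣ)
    (D : (OneParticle ι × OneParticle ι) →L[ℂ] (OneParticle ι × OneParticle ι))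
    (w : OneParticle ι × OneParticle ι) :
    canonInv ε D w = (star (phiBlock D) w.1 + -((ε : ℤ) : ℂ) • star (lowerLeft D) w.2,
      -((ε : ℤ) : ℂ) • star (psiBlock D) w.1 + star (lowerRight D) w.2) :=
  blockOp_apply _ _ _ _ _

omit [DecidableEq ι] [Countable ι] in
lemma continuousOn_canonInv (ε : ℤˣ) {s : Set ℝ} (hDc : ContinuousOn D s) :
    ContinuousOn (fun τ => canonInv ε (D τ)) s := by
  have hsm : ∀ {T : ℝ → Op ι} (c : ℂ), ContinuousOn T s → ContinuousOn (fun τ => c • T τ) s :=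
    fun c h => h.const_smul c
  have h1 := continuousOn_star (continuousOn_phiBlock hDc)
  have h2 := hsm (-((ε : ℤ) : ℂ)) (continuousOn_star (continuousOn_lowerLeft hDc))
  have h3 := hsm (-((ε : ℤ) : ℂ)) (continuousOn_star (continuousOn_psiBlock hDc))
  have h4 := continuousOn_star (continuousOn_lowerRight hDc)
  exact continuousOn_blockOp h1 h2 h3 h4

omit [DecidableEq ι] [Countable ι] in
lemma prod_op_mul_apply
    (S T : (OneParticle ι × OneParticle ι) →L[ℂ] (OneParticle ι × OneParticle ι))
    (w : OneParticle ι × OneParticle ι) : (S * T) w = S (T w) := rfl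

omit [Countable ι] in
lemma IsTexp.canon_left_inverse (ht : 0 ≤ t) (hC : IsTraceClassPath t C)
    (hAs : ∀ τ ∈ Set.Icc 0 t, star (A τ) = ((ε : ℤ) : ℂ) • conjOp (A τ))
    (hD : IsTexp t (fun s => canonGen (C s) (A s)) D) {τ : ℝ} (hτ : τ ∈ Set.Icc 0 t) :
    canonInv ε (D τ) * D τ = 1 := by
  have hee := units_int_mul_self ε
  refine ContinuousLinearMap.ext fun w => ?_
  rw [prod_op_mul_apply, canonInv_apply]
  refine Prod.ext (ext_inner_left ℂ fun x => ?_) (ext_inner_left ℂ fun x => ?_)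
  · have := hD.canon_form ht hC hAs hτ (x, 0) w
    rw [inner_zero_left, mul_zero, sub_zero] at this
    change inner ℂ x (_ + _) = inner ℂ x w.1
    rw [inner_add_right, inner_smul_right, inner_star_right, inner_star_right, phiBlock_apply,
      lowerLeft_apply, ← this]
    ring
  · have := hD.canon_form ht hC hAs hτ (0, x) w
    rw [inner_zero_left, zero_sub] at this
    change inner ℂ x (_ + _) = inner ℂ x w.2
    rw [inner_add_right, inner_smul_right, inner_star_right, inner_star_right, psiBlock_apply,
      lowerRight_apply]
    linear_combination (-((ε : ℤ) : ℂ)) * this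
      + (inner ℂ x w.2 - inner ℂ (D τ (0, x)).2 (D τ w).2) * hee

omit [Countable ι] in
lemma IsTexp.canon_right_inverse (ht : 0 ≤ t) (hC : IsTraceClassPath t C)
    (hAs : ∀ τ ∈ Set.Icc 0 t, star (A τ) = ((ε : ℤ) : ℂ) • conjOp (A τ))
    (hDc : ContinuousOn D (Set.Icc 0 t))
    (hD : IsTexp t (fun s => canonGen (C s) (A s)) D) {τ : ℝ} (hτ : τ ∈ Set.Icc 0 t) :
    D τ * canonInv ε (D τ) = 1 := by
  have h := hD.canon_left_inverse ht hC hAs ⟨le_rfl, ht⟩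
  refine mul_eq_one_of_continuousOn ht hDc (continuousOn_canonInv ε hDc)
    (fun τ hτ => hD.canon_left_inverse ht hC hAs hτ) ?_ τ hτ
  rw [hD.zero ht] at h ⊢
  rw [one_mul, ← mul_one (canonInv ε 1)]
  exact h

omit [Countable ι] in
/-- For bosons, the lower right block is invertible, since `Φ̄† Φ̄ = 1 + Ψ† Ψ`, and similarly for
the product in the other order. -/
lemma IsTexp.isUnit_lowerRight_of_boson (ht : 0 ≤ t) (hC : IsTraceClassPath t C)
    (hAs : ∀ τ ∈ Set.Icc 0 t, star (A τ) = (((1 : ℤˣ) : ℤ) : ℂ) • conjOp (A τ))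
    (hDc : ContinuousOn D (Set.Icc 0 t))
    (hD : IsTexp t (fun s => canonGen (C s) (A s)) D) {τ : ℝ} (hτ : τ ∈ Set.Icc 0 t) :
    IsUnit (lowerRight (D τ)) := by
  refine isUnit_of_star_mul_self_eq (B := psiBlock (D τ)) (B' := star (lowerLeft (D τ)))
    (op_ext_inner fun x y => ?_) (ContinuousLinearMap.ext fun y => ?_)
  · have h := hD.canon_form ht hC hAs hτ (0, x) (0, y)
    simp only [Units.val_one, Int.cast_one, one_mul, inner_zero_left, zero_sub] at h
    simp only [op_mul_apply, inner_star_right, add_apply, inner_add_right, lowerRight_apply,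
      psiBlock_apply]
    change _ = inner ℂ x y + _
    linear_combination -h
  · have h := congrArg (fun T => (T ((0 : OneParticle ι), y)).2)
      (hD.canon_right_inverse ht hC hAs hDc hτ)
    have h' : (D τ (canonInv 1 (D τ) (0, y))).2 = y := h
    rw [canonInv_apply, map_zero, map_zero, smul_zero, zero_add, zero_add, Units.val_one,
      Int.cast_one, neg_one_smul] at h'
    have e : D τ (-(star (lowerLeft (D τ)) y), star (lowerRight (D τ)) y)
        = D τ (0, star (lowerRight (D τ)) y) - D τ (star (lowerLeft (D τ)) y, 0) := by
      rw [← map_sub]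
      congr 1
      exact Prod.ext (zero_sub _).symm (sub_zero _).symm
    rw [e, Prod.snd_sub] at h'
    rw [star_star]
    change (D τ (0, star (lowerRight (D τ)) y)).2
      = y + (D τ (star (lowerLeft (D τ)) y, 0)).2
    exact sub_eq_iff_eq_add.1 h'

end Dynamics

/-! ### Trace class estimates in the interaction picture -/

section Interaction

variable {ι : Type*} [DecidableEq ι] [Countable ι] {t : ℝ}

omit [DecidableEq ι] [Countable ι] in
/-- A weak primitive with an integrable derivative is a primitive. -/
lemma isPrimitive_of_inner {f f' : ℝ → OneParticle ι} (hf' : IntervalIntegrable f' volume 0 t)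
    (h : ∀ x, IsPrimitive t (fun s => inner ℂ x (f s)) (fun s => inner ℂ x (f' s))) :
    IsPrimitive t f f' := by
  refine ⟨hf', fun τ hτ => ext_inner_left ℂ fun x => ?_⟩
  have h0 : (0 : ℝ) ∈ Set.Icc 0 t := ⟨le_rfl, hτ.1.trans hτ.2⟩
  rw [(h x).eq τ hτ, inner_add_right]
  congr 1
  exact (innerSL ℂ x).intervalIntegral_comp_comm (intervalIntegrable_sub hf' h0 hτ)

omit [DecidableEq ι] [Countable ι] in
lemma enorm_interval_le {E : Type*} [NormedAddCommGroup E] [NormedSpace ℝ E] {f f' : ℝ → E}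
    (hf : IsPrimitive t f f') (h0 : f 0 = 0) {τ : ℝ} (hτ : τ ∈ Set.Icc 0 t) :
    ‖f τ‖ₑ ≤ ∫⁻ s in Set.Icc 0 t, ‖f' s‖ₑ := by
  rw [hf.eq τ hτ, h0, zero_add, intervalIntegral.integral_of_le hτ.1]
  refine (enorm_integral_le_lintegral_enorm _).trans ?_
  exact lintegral_mono_set fun s hs => ⟨hs.1.le, hs.2.trans hτ.2⟩

/-- The Hilbert-Schmidt norm of a primitive `F` of `B` is controlled by the trace norm of
`B† F`: the derivative of `‖F e‖²` is `2 Re ⟨e, B† F e⟩`. -/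
lemma hsSq_le_of_isPrimitive (ht : 0 ≤ t) {F B : ℝ → Op ι}
    (hF : ∀ x, IsPrimitive t (fun τ => F τ x) (fun s => B s x)) (hF0 : F 0 = 0)
    (hG : WeaklyMeasurable (volume.restrict (Set.Icc 0 t)) (fun s => star (B s) * F s))
    {τ : ℝ} (hτ : τ ∈ Set.Icc 0 t) :
    hsSq (F τ) ≤ 2 * ∫⁻ s in Set.Icc 0 t, traceNorm (star (B s) * F s) := by
  have h1 : ∀ i, ‖F τ (basisVec i)‖ₑ ^ 2
      ≤ 2 * ∫⁻ s in Set.Icc 0 t, ‖entry (star (B s) * F s) i i‖ₑ := by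
    intro i
    have h := enorm_interval_le ((hF (basisVec i)).inner_prod ht (hF (basisVec i)))
      (by rw [hF0]; simp) hτ
    have e1 : ‖inner ℂ (F τ (basisVec i)) (F τ (basisVec i))‖ₑ = ‖F τ (basisVec i)‖ₑ ^ 2 := by
      rw [inner_self_eq_norm_sq_to_K, enorm_pow]
      congr 1
      rw [← ofReal_norm, ← ofReal_norm]
      simp
    have e2 : ∀ s, inner ℂ (B s (basisVec i)) (F s (basisVec i))
        = entry (star (B s) * F s) i i := fun s => by
      rw [entry_eq_inner, op_mul_apply, inner_star_right]
    rw [e1] at h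
    refine h.trans ?_
    rw [← lintegral_const_mul'' _ (hG i i).enorm]
    refine lintegral_mono fun s => (enorm_add_le _ _).trans ?_
    rw [two_mul, ← e2]
    refine add_le_add (le_of_eq ?_) le_rfl
    rw [← ofReal_norm, ← ofReal_norm, norm_inner_symm]
  rw [hsSq]
  refine (ENNReal.tsum_le_tsum h1).trans ?_
  rw [ENNReal.tsum_mul_left, ← lintegral_tsum fun i => (hG i i).enorm]
  gcongr
  exact tsum_enorm_entry_le _

/-- The Cauchy-Schwarz inequality on `[0, t]`. -/
lemma sq_lintegral_le {f : ℝ → ℝ≥0∞}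
    (hf : AEMeasurable f (volume.restrict (Set.Icc 0 t))) :
    (∫⁻ s in Set.Icc 0 t, f s) ^ 2 ≤ ENNReal.ofReal t * ∫⁻ s in Set.Icc 0 t, f s ^ 2 := by
  have h := ENNReal.lintegral_mul_le_Lp_mul_Lq (volume.restrict (Set.Icc 0 t))
    (Real.HolderConjugate.two_two) hf (aemeasurable_const (b := (1 : ℝ≥0∞)))
  have h2 := ENNReal.pow_le_pow_left (n := 2) h
  simp only [Pi.mul_apply, mul_one, ENNReal.one_rpow, lintegral_const, Measure.restrict_apply_univ,
    Real.volume_Icc, sub_zero, one_mul] at h2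
  refine h2.trans (le_of_eq ?_)
  rw [mul_pow, ← ENNReal.rpow_natCast, ← ENNReal.rpow_natCast, ← ENNReal.rpow_mul,
    ← ENNReal.rpow_mul, mul_comm]
  norm_num

/-- The Hilbert-Schmidt norm of a primitive that vanishes initially, by the Cauchy-Schwarz
inequality in time. -/
lemma hsSq_le_lintegral (ht : 0 ≤ t) {X W : ℝ → Op ι}
    (hX : ∀ x, IsPrimitive t (fun τ => X τ x) (fun s => W s x)) (hX0 : X 0 = 0)
    {τ : ℝ} (hτ : τ ∈ Set.Icc 0 t) :
    hsSq (X τ) ≤ ENNReal.ofReal t * ∫⁻ s in Set.Icc 0 t, hsSq (W s) := by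
  have hm : ∀ x, AEStronglyMeasurable (fun s => W s x) (volume.restrict (Set.Icc 0 t)) :=
    fun x => aestronglyMeasurable_Icc_of_intervalIntegrable ht (hX x).integrable
  have h1 : ∀ i, ‖X τ (basisVec i)‖ₑ ^ 2
      ≤ ENNReal.ofReal t * ∫⁻ s in Set.Icc 0 t, ‖W s (basisVec i)‖ₑ ^ 2 := fun i =>
    (ENNReal.pow_le_pow_left (enorm_interval_le (hX (basisVec i)) (by rw [hX0]; rfl) hτ)).trans
      (sq_lintegral_le (hm _).enorm)
  rw [hsSq]
  refine (ENNReal.tsum_le_tsum h1).trans ?_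
  rw [ENNReal.tsum_mul_left, ← lintegral_tsum fun i => (hm _).enorm.pow_const 2]
  rfl

omit [Countable ι] in
lemma IsTraceL1.congr {V W : ℝ → Op ι} (hV : IsTraceL1 t V)
    (h : ∀ s ∈ Set.Icc 0 t, W s = V s) : IsTraceL1 t W := by
  refine ⟨fun i j => (hV.measurable i j).congr ?_, fun s hs => (h s hs).symm ▸ hV.traceClass s hs,
    ?_⟩
  · filter_upwards [self_mem_ae_restrict measurableSet_Icc] with s hs
    rw [h s hs]
  · rw [setLIntegral_congr_fun measurableSet_Icc fun s hs => by rw [h s hs]]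
    exact hV.integrable

omit [Countable ι] in
lemma isTraceL1_of_le {V : ℝ → Op ι} {c : ℝ≥0∞} (hc : c < ⊤)
    (hm : WeaklyMeasurable (volume.restrict (Set.Icc 0 t)) V)
    (h : ∀ s ∈ Set.Icc 0 t, traceNorm (V s) ≤ c) : IsTraceL1 t V := by
  refine ⟨hm, fun s hs => (h s hs).trans_lt hc, ?_⟩
  refine (setLIntegral_mono_ae aemeasurable_const (.of_forall h)).trans_lt ?_
  rw [lintegral_const, Measure.restrict_apply_univ, Real.volume_Icc]
  exact ENNReal.mul_lt_top hc ENNReal.ofReal_lt_top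

omit [DecidableEq ι] [Countable ι] in
lemma enorm_op_mul_le (S T : Op ι) : ‖S * T‖ₑ ≤ ‖S‖ₑ * ‖T‖ₑ := by
  rw [enorm_eq_nnnorm, enorm_eq_nnnorm, enorm_eq_nnnorm, ← ENNReal.coe_mul]
  exact ENNReal.coe_le_coe.2 (nnnorm_mul_le S T)

omit [DecidableEq ι] [Countable ι] in
lemma exists_enorm_le_of_continuousOn {T : ℝ → Op ι} (h : ContinuousOn T (Set.Icc 0 t)) :
    ∃ c : ℝ≥0∞, c < ⊤ ∧ ∀ s ∈ Set.Icc 0 t, ‖T s‖ₑ ≤ c := by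
  obtain ⟨b, hb⟩ := isCompact_Icc.exists_bound_of_continuousOn h
  refine ⟨ENNReal.ofReal b, ENNReal.ofReal_lt_top, fun s hs => ?_⟩
  rw [← ofReal_norm]
  exact ENNReal.ofReal_le_ofReal (hb s hs)

/-- In the interaction picture, with `B = Ḟ`, the off-diagonal block `P` of the propagator satisfies
`Ṗ = c B† Q` and the diagonal block `Q̇ = c' B P`. Integration by parts gives
`P = c F† Q + X` with `Ẋ = - c c' F† B P`. As `F` and hence `P` are Hilbert-Schmidt, `X` is trace
class, and `B P = c B F† Q + B X`. -/
lemma isTraceL1_mul_of_interaction (ht : 0 ≤ t) {F B P Q : ℝ → Op ι} {b : ℝ} {c c' : ℂ}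
    (hBm : WeaklyMeasurable (volume.restrict (Set.Icc 0 t)) B)
    (hBb : ∀ s ∈ Set.Icc 0 t, ‖B s‖ ≤ b)
    (hF : ∀ x, IsPrimitive t (fun τ => F τ x) (fun s => B s x)) (hF0 : F 0 = 0)
    (hPc : ContinuousOn P (Set.Icc 0 t)) (hQc : ContinuousOn Q (Set.Icc 0 t)) (hP0 : P 0 = 0)
    (hP : ∀ x y, IsPrimitive t (fun s => inner ℂ x (P s y)) (fun s => c * inner ℂ (B s x) (Q s y)))
    (hQ : ∀ x y, IsPrimitive t (fun s => inner ℂ x (Q s y))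
      (fun s => inner ℂ x (c' • B s (P s y))))
    (hG : IsTraceL1 t (fun s => star (B s) * F s))
    (hG' : IsTraceL1 t (fun s => B s * star (F s))) :
    IsTraceL1 t (fun s => B s * P s) := by
  have hFc : ContinuousOn F (Set.Icc 0 t) :=
    continuousOn_of_isPrimitive (g := fun _ => b) intervalIntegrable_const hF fun x s hs =>
      ((B s).le_opNorm x).trans (mul_le_mul_of_nonneg_right (hBb s hs) (norm_nonneg _))
  have hFsc := continuousOn_star hFc
  have hII : ∀ (T : ℝ → Op ι) (d : ℝ), WeaklyMeasurable (volume.restrict (Set.Icc 0 t)) T →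
      (∀ s ∈ Set.Icc 0 t, ‖T s‖ ≤ d) → ∀ y, IntervalIntegrable (fun s => T s y) volume 0 t :=
    fun T d hT hTd y => intervalIntegrable_of_norm_le ht (b := fun _ => d * ‖y‖)
      intervalIntegrable_const (hT.apply aestronglyMeasurable_const) fun s hs =>
      ((T s).le_opNorm y).trans (mul_le_mul_of_nonneg_right (hTd s hs) (norm_nonneg _))
  have hPm := weaklyMeasurable_of_continuousOn hPc
  have hQm := weaklyMeasurable_of_continuousOn hQc
  have hFm := weaklyMeasurable_of_continuousOn hFc
  obtain ⟨p, hp⟩ := isCompact_Icc.exists_bound_of_continuousOn hPc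
  obtain ⟨f, hf⟩ := isCompact_Icc.exists_bound_of_continuousOn hFsc
  have hBP : ∀ s ∈ Set.Icc 0 t, ‖B s * P s‖ ≤ b * p := fun s hs =>
    (norm_mul_le _ _).trans (mul_le_mul (hBb s hs) (hp s hs) (norm_nonneg _)
      ((norm_nonneg _).trans (hBb s hs)))
  have hFBP : ∀ s ∈ Set.Icc 0 t, ‖star (F s) * (B s * P s)‖ ≤ f * (b * p) := fun s hs =>
    (norm_mul_le _ _).trans (mul_le_mul (hf s hs) (hBP s hs) (norm_nonneg _)
      ((norm_nonneg _).trans (hf s hs)))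
  -- strong form of the equation for `Q`
  have hQs : ∀ y, IsPrimitive t (fun s => Q s y) (fun s => c' • B s (P s y)) := fun y =>
    isPrimitive_of_inner ((hII _ _ (hBm.mul hPm) hBP y).smul c') fun x => hQ x y
  -- integration by parts
  have hXw : ∀ x y, IsPrimitive t (fun s => inner ℂ x ((P s - c • (star (F s) * Q s)) y))
      (fun s => inner ℂ x ((-(c * c') • (star (F s) * (B s * P s))) y)) := by
    intro x y
    have h := (hP x y).add (((hF x).inner_prod ht (hQs y)).clm ((ContinuousLinearMap.mul ℝ ℂ) (-c)))
    refine h.congr ht (fun s _ => ?_) fun s _ => ?_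
    · change inner ℂ x (P s y - c • star (F s) (Q s y)) = _ + -c * inner ℂ (F s x) (Q s y)
      rw [inner_sub_right, inner_smul_right, inner_star_right]
      ring
    · change inner ℂ x (-(c * c') • star (F s) (B s (P s y)))
        = _ + -c * (inner ℂ (F s x) (c' • B s (P s y)) + inner ℂ (B s x) (Q s y))
      rw [inner_smul_right, inner_smul_right, inner_star_right]
      ring
  set X : ℝ → Op ι := fun s => P s - c • (star (F s) * Q s) with hXdef
  set W : ℝ → Op ι := fun s => -(c * c') • (star (F s) * (B s * P s)) with hWdef
  have hWm : WeaklyMeasurable (volume.restrict (Set.Icc 0 t)) W :=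
    (hFm.star.mul (hBm.mul hPm)).const_smul _
  have hXm : WeaklyMeasurable (volume.restrict (Set.Icc 0 t)) X :=
    hPm.sub ((hFm.star.mul hQm).const_smul _)
  have hWI : ∀ y, IntervalIntegrable (fun s => W s y) volume 0 t := fun y =>
    (hII _ _ (hFm.star.mul (hBm.mul hPm)) hFBP y).smul (-(c * c'))
  have hXs : ∀ y, IsPrimitive t (fun s => X s y) (fun s => W s y) := fun y =>
    isPrimitive_of_inner (hWI y) fun x => hXw x y
  have hX0 : X 0 = 0 := by simp [hXdef, hP0, hF0]
  -- Hilbert-Schmidt bounds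
  obtain ⟨b₁, hb₁, hBb₁⟩ : ∃ b₁ : ℝ≥0∞, b₁ < ⊤ ∧ ∀ s ∈ Set.Icc 0 t, ‖B s‖ₑ ≤ b₁ :=
    ⟨ENNReal.ofReal b, ENNReal.ofReal_lt_top, fun s hs => by
      rw [← ofReal_norm]; exact ENNReal.ofReal_le_ofReal (hBb s hs)⟩
  obtain ⟨p₁, hp₁, hPb₁⟩ := exists_enorm_le_of_continuousOn hPc
  obtain ⟨q₁, hq₁, hQb₁⟩ := exists_enorm_le_of_continuousOn hQc
  have hFhs := fun s (hs : s ∈ Set.Icc 0 t) => hsSq_le_of_isPrimitive ht hF hF0 hG.measurable hs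
  set M : ℝ≥0∞ := 2 * ∫⁻ s in Set.Icc 0 t, traceNorm (star (B s) * F s) with hM
  have hMtop : M < ⊤ := ENNReal.mul_lt_top ENNReal.ofNat_lt_top hG.integrable
  have hWhs : ∀ s ∈ Set.Icc 0 t, hsSq (W s) ≤ ‖c * c'‖ₑ ^ 2 * (M * (b₁ * p₁) ^ 2) := by
    intro s hs
    rw [hWdef]
    refine (hsSq_smul _ _).le.trans ?_
    rw [enorm_neg]
    gcongr
    refine (hsSq_mul_le_right _ _).trans ?_
    rw [hsSq_star]
    gcongr
    · exact hFhs s hs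
    · refine (enorm_op_mul_le _ _).trans ?_
      gcongr
      exacts [hBb₁ s hs, hPb₁ s hs]
  set N : ℝ≥0∞ := ‖c * c'‖ₑ ^ 2 * (M * (b₁ * p₁) ^ 2) with hN
  have hNtop : N < ⊤ := by
    have : (‖c * c'‖ₑ : ℝ≥0∞) < ⊤ := enorm_lt_top
    finiteness
  have hXhs : ∀ s ∈ Set.Icc 0 t, hsSq (X s) ≤ ENNReal.ofReal t * (N * ENNReal.ofReal t) := by
    intro s hs
    refine (hsSq_le_lintegral ht hXs hX0 hs).trans ?_
    gcongr
    refine (setLIntegral_mono_ae aemeasurable_const (.of_forall hWhs)).trans ?_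
    rw [lintegral_const, Measure.restrict_apply_univ, Real.volume_Icc, sub_zero]
  have hPeq : ∀ s, P s = c • (star (F s) * Q s) + X s := fun s =>
    (add_sub_cancel _ _).symm
  have hPhs : ∀ s ∈ Set.Icc 0 t, hsSq (P s)
      ≤ 2 * (‖c‖ₑ ^ 2 * (M * q₁ ^ 2) + ENNReal.ofReal t * (N * ENNReal.ofReal t)) := by
    intro s hs
    rw [hPeq s]
    refine (hsSq_add_le _ _).trans ?_
    gcongr
    · refine (hsSq_smul _ _).le.trans ?_
      gcongr
      refine (hsSq_mul_le_right _ _).trans ?_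
      rw [hsSq_star]
      gcongr
      exacts [hFhs s hs, hQb₁ s hs]
    · exact hXhs s hs
  set N' : ℝ≥0∞ :=
    2 * (‖c‖ₑ ^ 2 * (M * q₁ ^ 2) + ENNReal.ofReal t * (N * ENNReal.ofReal t)) with hN'
  have hNtop' : N' < ⊤ := by
    have : (‖c‖ₑ : ℝ≥0∞) < ⊤ := enorm_lt_top
    finiteness
  -- trace norm bounds
  have hWtn : IsTraceL1 t W := by
    have h1 : IsTraceL1 t (fun s => star (F s) * (B s * P s)) := by
      refine isTraceL1_of_le (c := 2⁻¹ * (M + b₁ ^ 2 * N')) ?_ (hFm.star.mul (hBm.mul hPm)) ?_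
      · finiteness
      · intro s hs
        refine (traceNorm_mul_le_half _ _).trans ?_
        gcongr
        · rw [hsSq_star]; exact hFhs s hs
        · refine (hsSq_mul_le_left _ _).trans ?_
          gcongr
          exacts [hBb₁ s hs, hPhs s hs]
    exact h1.const_smul _
  have hBX : IsTraceL1 t (fun s => B s * X s) := by
    refine isTraceL1_of_le (c := b₁ * ∫⁻ s in Set.Icc 0 t, traceNorm (W s))
      (ENNReal.mul_lt_top hb₁ hWtn.integrable) (hBm.mul hXm) fun s hs => ?_
    refine (traceNorm_mul_le_left _ _).trans ?_
    gcongr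
    · exact hBb₁ s hs
    · have := traceNorm_sub_le_of_isPrimitive hWtn.measurable hXs hs
      rwa [hX0, sub_zero] at this
  refine (((hG'.mul_continuousOn hQc).const_smul c).add hBX).congr fun s _ => ?_
  rw [hPeq s, mul_add, mul_smul_comm, mul_assoc]

end Interaction

/-! ### The determinant of the diagonal block -/

section Determinant

variable {ι : Type*} [DecidableEq ι] {t : ℝ} {C A : ℝ → Op ι} {ε : ℤˣ} {d : ℝ → ℝ}
  {D : ℝ → (OneParticle ι × OneParticle ι) →L[ℂ] (OneParticle ι × OneParticle ι)} {R : ℝ → Op ι}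

lemma conj_units_int (ε : ℤˣ) : conj ((ε : ℤ) : ℂ) = ((ε : ℤ) : ℂ) := map_intCast _ _

lemma EvolutionConditions.star_eq (hE : EvolutionConditions ε t A d R) {τ : ℝ}
    (hτ : τ ∈ Set.Icc 0 t) : star (A τ) = ((ε : ℤ) : ℂ) • conjOp (A τ) :=
  op_ext fun i j => by
    rw [entry_star, entry_smul, entry_conjOp, hE.transpose τ hτ i j, map_mul, conj_units_int]

lemma EvolutionConditions.exists_norm_le (hE : EvolutionConditions ε t A d R) :
    ∃ a : ℝ, ∀ τ ∈ Set.Icc 0 t, ‖A τ‖ ≤ a :=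
  let ⟨a, ha⟩ := hE.bounded
  ⟨a, fun τ hτ => (ha τ hτ).le⟩

lemma conj_intervalIntegral (f : ℝ → ℂ) (a b : ℝ) :
    conj (∫ s in a..b, f s) = ∫ s in a..b, conj (f s) := by
  simp only [intervalIntegral, map_sub, integral_conj]

omit [DecidableEq ι] in
lemma IsTexp.isPrimitive_conjOp (ht : 0 ≤ t) (hR : IsTexp t C R) (x : OneParticle ι) :
    IsPrimitive t (fun s => conjOp (R s) x)
      (fun s => Complex.I • conjOp (C s) (conjOp (R s) x)) := by
  have h := (hR.isPrimitive ht (star x)).clm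
    ((starL' ℝ : OneParticle ι ≃L[ℝ] OneParticle ι) : OneParticle ι →L[ℝ] OneParticle ι)
  refine h.congr ht (fun s _ => rfl) fun s _ => ?_
  change _ = star (-Complex.I • C s (R s (star x)))
  rw [conjOp_apply, conjOp_apply, star_star, star_smul, star_neg, Complex.star_def,
    Complex.conj_I, neg_neg]

variable [Countable ι]

/-- `Ā Ψ` is trace class, with integrable trace norm: in the interaction picture
`P = R† Ψ`, `Q = R̄† Φ̄` and `B = R̄† Ā R = Ḟ`, one has `Ā Ψ = R̄ B P`. The transpose
symmetries of `A`, `B` and `F` express `B† F` and `B F†` through `G` and `Ḡ`. -/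
lemma isTraceL1_conjOp_mul_psiBlock (ht : 0 ≤ t) (hC : IsTraceClassPath t C) (hR : IsTexp t C R)
    (hE : EvolutionConditions ε t A d R)
    (hD : IsTexp t (fun s => canonGen (C s) (A s)) D) :
    IsTraceL1 t (fun s => conjOp (A s) * psiBlock (D s)) := by
  obtain ⟨a, ha⟩ := hE.exists_norm_le
  have hAm : WeaklyMeasurable (volume.restrict (Set.Icc 0 t)) A := hE.measurable
  have hee := units_int_mul_self ε
  have hDc := hD.continuousOn ht (isL1Generator_canonGen ht hC hAm ha)
  have hRc := hR.continuousOn_of_path ht hC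
  have hRsc := continuousOn_star hRc
  obtain ⟨F, hF, -, -, hGtc, hGint⟩ := hE.exists_F
  have hRm := weaklyMeasurable_of_continuousOn hRc
  set B : ℝ → Op ι := fun s => conjOp (star (R s)) * conjOp (A s) * R s with hB
  have hBm : WeaklyMeasurable (volume.restrict (Set.Icc 0 t)) B :=
    (hRm.star.conjOp.mul hAm.conjOp).mul hRm
  have hRn : ∀ s ∈ Set.Icc 0 t, ‖R s‖ ≤ 1 := fun s hs => hR.norm_le_one ht hC hs
  have hBb : ∀ s ∈ Set.Icc 0 t, ‖B s‖ ≤ a := by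
    intro s hs
    have h1 : ‖conjOp (star (R s)) * conjOp (A s)‖ ≤ 1 * a :=
      (norm_mul_le _ _).trans (mul_le_mul (by rw [norm_conjOp, norm_star_op]; exact hRn s hs)
        (by rw [norm_conjOp]; exact ha s hs) (norm_nonneg _) zero_le_one)
    have h2 := (norm_mul_le (conjOp (star (R s)) * conjOp (A s)) (R s)).trans
      (mul_le_mul h1 (hRn s hs) (norm_nonneg _) ((norm_nonneg _).trans h1))
    simpa using h2
  have hBI : ∀ x, IntervalIntegrable (fun s => B s x) volume 0 t := fun x =>
    intervalIntegrable_of_norm_le ht (b := fun _ => a * ‖x‖) intervalIntegrable_const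
      (hBm.apply aestronglyMeasurable_const) fun s hs =>
      ((B s).le_opNorm x).trans (mul_le_mul_of_nonneg_right (hBb s hs) (norm_nonneg _))
  have h0 : (0 : ℝ) ∈ Set.Icc 0 t := ⟨le_rfl, ht⟩
  have hF0 : F 0 = 0 := ContinuousLinearMap.ext fun x => by
    rw [hF 0 h0, intervalIntegral.integral_same]; rfl
  have hFp : ∀ x, IsPrimitive t (fun τ => F τ x) (fun s => B s x) := fun x =>
    ⟨hBI x, fun τ hτ => by rw [hF τ hτ, hF 0 h0, intervalIntegral.integral_same, zero_add]⟩
  -- the symmetries of `B` and `F`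
  have hstarB : ∀ s ∈ Set.Icc 0 t,
      star (B s) = ((ε : ℤ) : ℂ) • (star (R s) * A s * conjOp (R s)) := by
    intro s hs
    simp only [hB]
    rw [star_mul, star_mul, ← conjOp_star, ← conjOp_star, star_star, hE.star_eq hs, conjOp_smul,
      conjOp_conjOp, conj_units_int, smul_mul_assoc, mul_smul_comm, mul_assoc]
  have hconjB : ∀ s, conjOp (B s) = star (R s) * A s * conjOp (R s) := fun s => by
    simp only [hB]
    rw [conjOp_mul, conjOp_mul, conjOp_conjOp, conjOp_conjOp]
  have hstarB' : ∀ s ∈ Set.Icc 0 t, star (B s) = ((ε : ℤ) : ℂ) • conjOp (B s) := fun s hs => by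
    rw [hstarB s hs, hconjB]
  have hstarF : ∀ τ ∈ Set.Icc 0 t, star (F τ) = ((ε : ℤ) : ℂ) • conjOp (F τ) := by
    intro τ hτ
    refine op_ext fun i j => ?_
    rw [entry_star, entry_smul, entry_conjOp]
    have e : ∀ i j, entry (F τ) i j = ∫ s in (0 : ℝ)..τ, entry (B s) i j := fun i j => by
      have := (hFp (basisVec j)).inner_sub (basisVec i) hτ
      rw [hF0] at this
      simpa only [entry_eq_inner, zero_apply, sub_zero] using this
    rw [e, e, conj_intervalIntegral, conj_intervalIntegral,
      ← intervalIntegral.integral_const_mul]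
    refine intervalIntegral.integral_congr fun s hs => ?_
    rw [Set.uIcc_of_le hτ.1] at hs
    have hst := congrArg (fun T => entry T i j) (hstarB' s ⟨hs.1, hs.2.trans hτ.2⟩)
    simp only [entry_star, entry_smul, entry_conjOp] at hst
    exact hst
  have hFc : ContinuousOn F (Set.Icc 0 t) :=
    continuousOn_of_isPrimitive (g := fun _ => a) intervalIntegrable_const hFp fun x s hs =>
      ((B s).le_opNorm x).trans (mul_le_mul_of_nonneg_right (hBb s hs) (norm_nonneg _))
  have hG0 : IsTraceL1 t (fun s => star (R s) * A s * conjOp (R s) * F s) :=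
    ⟨((hRm.star.mul hAm).mul hRm.conjOp).mul (weaklyMeasurable_of_continuousOn hFc), hGtc, hGint⟩
  have hG : IsTraceL1 t (fun s => star (B s) * F s) :=
    (hG0.const_smul ((ε : ℤ) : ℂ)).congr fun s hs => by rw [hstarB s hs, smul_mul_assoc]
  have hG' : IsTraceL1 t (fun s => B s * star (F s)) :=
    (hG0.conjOp.const_smul ((ε : ℤ) : ℂ)).congr fun s hs => by
      rw [hstarF s hs, conjOp_mul, ← hconjB, conjOp_conjOp, mul_smul_comm]
  -- the blocks in the interaction picture
  have hRR : ∀ s ∈ Set.Icc 0 t, R s * star (R s) = 1 := fun s hs => hR.mul_star_self ht hC hs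
  have hRRc : ∀ s ∈ Set.Icc 0 t, conjOp (R s) * conjOp (star (R s)) = 1 := fun s hs => by
    rw [← conjOp_mul, hRR s hs, conjOp_one]
  have hCsa : ∀ s ∈ Set.Icc 0 t, ∀ x y, inner ℂ (C s x) y = inner ℂ x (C s y) :=
    fun s hs x y => by rw [← inner_star_right, (hC.selfAdjoint s hs).star_eq]
  have hCsa' : ∀ s ∈ Set.Icc 0 t, ∀ x y,
      inner ℂ (conjOp (C s) x) y = inner ℂ x (conjOp (C s) y) := fun s hs x y => by
    rw [← inner_star_right, ← conjOp_star, (hC.selfAdjoint s hs).star_eq]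
  set P : ℝ → Op ι := fun s => star (R s) * psiBlock (D s) with hPdef
  set Q : ℝ → Op ι := fun s => conjOp (star (R s)) * lowerRight (D s) with hQdef
  have hRP : ∀ s ∈ Set.Icc 0 t, ∀ y, R s (P s y) = psiBlock (D s) y := fun s hs y => by
    rw [← op_mul_apply, hPdef, ← mul_assoc, hRR s hs, one_mul]
  have hRQ : ∀ s ∈ Set.Icc 0 t, ∀ y, conjOp (R s) (Q s y) = lowerRight (D s) y :=
    fun s hs y => by rw [← op_mul_apply, hQdef, ← mul_assoc, hRRc s hs, one_mul]
  have hPc : ContinuousOn P (Set.Icc 0 t) := hRsc.mul (continuousOn_psiBlock hDc)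
  have hQc : ContinuousOn Q (Set.Icc 0 t) :=
    (continuousOn_conjOp hRsc).mul (continuousOn_lowerRight hDc)
  have hP0 : P 0 = 0 := ContinuousLinearMap.ext fun y => by
    rw [hPdef, op_mul_apply, psiBlock_apply, hD.zero_apply ht, map_zero]; rfl
  have hP : ∀ x y, IsPrimitive t (fun s => inner ℂ x (P s y))
      (fun s => -Complex.I * ((ε : ℤ) : ℂ) * inner ℂ (B s x) (Q s y)) := by
    intro x y
    refine ((hR.isPrimitive ht x).inner_prod ht (hD.isPrimitive_fst ht (0, y))).congr ht
      (fun s _ => ?_) fun s hs => ?_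
    · rw [hPdef, op_mul_apply, inner_star_right, psiBlock_apply]
    · rw [← psiBlock_apply, ← lowerRight_apply, ← hRQ s hs, ← inner_star_right, hstarB s hs,
        smul_apply, inner_smul_right, op_mul_apply, op_mul_apply, inner_star_right,
        inner_smul_right, inner_smul_left, inner_add_right, hCsa s hs, map_neg, Complex.conj_I]
      linear_combination (-Complex.I * inner ℂ (R s x) (A s (conjOp (R s) (Q s y)))) * hee
  have hQ : ∀ x y, IsPrimitive t (fun s => inner ℂ x (Q s y))
      (fun s => inner ℂ x (Complex.I • B s (P s y))) := by
    intro x y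
    refine ((hR.isPrimitive_conjOp ht x).inner_prod ht (hD.isPrimitive_snd ht (0, y))).congr ht
      (fun s _ => ?_) fun s hs => ?_
    · rw [hQdef, op_mul_apply, conjOp_star, inner_star_right, lowerRight_apply]
    · rw [← psiBlock_apply, ← lowerRight_apply, ← hRP s hs, hB, op_mul_apply, op_mul_apply,
        inner_smul_right, conjOp_star, inner_star_right,
        inner_smul_right, inner_smul_left, inner_add_right, hCsa' s hs, Complex.conj_I]
      ring
  have key := isTraceL1_mul_of_interaction ht hBm hBb hFp hF0 hPc hQc hP0 hP hQ hG hG'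
  refine (key.continuousOn_mul (continuousOn_conjOp hRc)).congr fun s hs => ?_
  have e : conjOp (R s) * (B s * P s) = conjOp (R s) * conjOp (star (R s)) * conjOp (A s)
      * (R s * star (R s)) * psiBlock (D s) := by simp only [hB, hPdef, mul_assoc]
  rw [e, hRRc s hs, hRR s hs, one_mul, mul_one]

/-- `Φ̄` is invertible: automatically for bosons, by hypothesis for fermions. -/
lemma IsTexp.isUnit_lowerRight (ht : 0 ≤ t) (hC : IsTraceClassPath t C)
    (hE : EvolutionConditions ε t A d R) (hD : IsTexp t (fun s => canonGen (C s) (A s)) D)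
    (hΦ : ε = -1 → ∀ τ ∈ Set.Icc 0 t, IsUnit (phiBlock (D τ))) {τ : ℝ} (hτ : τ ∈ Set.Icc 0 t) :
    IsUnit (lowerRight (D τ)) := by
  obtain ⟨a, ha⟩ := hE.exists_norm_le
  have hAm : WeaklyMeasurable (volume.restrict (Set.Icc 0 t)) A := hE.measurable
  have hDc := hD.continuousOn ht (isL1Generator_canonGen ht hC hAm ha)
  rcases Int.units_eq_one_or ε with rfl | rfl
  · exact hD.isUnit_lowerRight_of_boson ht hC (fun s hs => hE.star_eq hs) hDc hτ
  · rw [← hD.canon_swap ht hC hAm ha hτ]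
    obtain ⟨u, hu⟩ := hΦ rfl τ hτ
    rw [← hu]
    exact ⟨⟨conjOp u, conjOp ↑u⁻¹, by rw [← conjOp_mul, Units.mul_inv, conjOp_one],
      by rw [← conjOp_mul, Units.inv_mul, conjOp_one]⟩, rfl⟩

omit [DecidableEq ι] [Countable ι] in
lemma continuousOn_inverse {T : ℝ → Op ι} {s : Set ℝ} (hT : ContinuousOn T s)
    (h : ∀ τ ∈ s, IsUnit (T τ)) : ContinuousOn (fun τ => Ring.inverse (T τ)) s := fun τ hτ => by
  obtain ⟨u, hu⟩ := h τ hτ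
  have h1 := NormedRing.inverse_continuousAt u
  rw [hu] at h1
  exact h1.comp_continuousWithinAt (hT τ hτ)

/-- The logarithmic derivative `i (C̄ + Ā Ψ Φ̄⁻¹)` of the block `Φ̄`. -/
def blockGen (C A : Op ι)
    (D : (OneParticle ι × OneParticle ι) →L[ℂ] (OneParticle ι × OneParticle ι)) : Op ι :=
  Complex.I • (conjOp C + conjOp A * (psiBlock D * Ring.inverse (lowerRight D)))

omit [DecidableEq ι] [Countable ι] in
/-- `Φ̄` solves a linear equation with a trace class generator. -/
lemma IsTexp.isPrimitive_lowerRight (ht : 0 ≤ t)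
    (hD : IsTexp t (fun s => canonGen (C s) (A s)) D)
    (hu : ∀ τ ∈ Set.Icc 0 t, IsUnit (lowerRight (D τ))) (y : OneParticle ι) :
    IsPrimitive t (fun s => lowerRight (D s) y)
      (fun s => blockGen (C s) (A s) (D s) (lowerRight (D s) y)) := by
  refine (hD.isPrimitive_snd ht (0, y)).congr ht (fun s _ => rfl) fun s hs => ?_
  rw [← psiBlock_apply, ← lowerRight_apply, ← op_mul_apply, blockGen, smul_mul_assoc, add_mul,
    mul_assoc, mul_assoc, Ring.inverse_mul_cancel _ (hu s hs), mul_one, smul_apply, add_apply,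
    op_mul_apply, op_mul_apply, add_comm]

lemma isTraceL1_conjOp_mul_inverse (ht : 0 ≤ t) (hC : IsTraceClassPath t C) (hR : IsTexp t C R)
    (hE : EvolutionConditions ε t A d R) (hD : IsTexp t (fun s => canonGen (C s) (A s)) D)
    (hu : ∀ τ ∈ Set.Icc 0 t, IsUnit (lowerRight (D τ))) :
    IsTraceL1 t
      (fun s => conjOp (A s) * (psiBlock (D s) * Ring.inverse (lowerRight (D s)))) := by
  obtain ⟨a, ha⟩ := hE.exists_norm_le
  have hDc := hD.continuousOn ht (isL1Generator_canonGen ht hC hE.measurable ha)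
  simpa only [mul_assoc] using (isTraceL1_conjOp_mul_psiBlock ht hC hR hE hD).mul_continuousOn
    (continuousOn_inverse (continuousOn_lowerRight hDc) hu)

lemma isTraceL1_blockGen (ht : 0 ≤ t) (hC : IsTraceClassPath t C) (hR : IsTexp t C R)
    (hE : EvolutionConditions ε t A d R) (hD : IsTexp t (fun s => canonGen (C s) (A s)) D)
    (hu : ∀ τ ∈ Set.Icc 0 t, IsUnit (lowerRight (D τ))) :
    IsTraceL1 t (fun s => blockGen (C s) (A s) (D s)) :=
  (hC.isTraceL1.conjOp.add (isTraceL1_conjOp_mul_inverse ht hC hR hE hD hu)).const_smul Complex.I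

omit [DecidableEq ι] [Countable ι] in
lemma IsTexp.lowerRight_zero (ht : 0 ≤ t) (hD : IsTexp t (fun s => canonGen (C s) (A s)) D) :
    lowerRight (D 0) = 1 :=
  ContinuousLinearMap.ext fun y => by rw [lowerRight_apply, hD.zero_apply ht]; rfl

lemma IsTexp.isTraceClass_lowerRight_sub_one (ht : 0 ≤ t) (hC : IsTraceClassPath t C)
    (hR : IsTexp t C R) (hE : EvolutionConditions ε t A d R)
    (hD : IsTexp t (fun s => canonGen (C s) (A s)) D)
    (hu : ∀ τ ∈ Set.Icc 0 t, IsUnit (lowerRight (D τ))) {τ : ℝ} (hτ : τ ∈ Set.Icc 0 t) :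
    IsTraceClass (lowerRight (D τ) - 1) := by
  obtain ⟨a, ha⟩ := hE.exists_norm_le
  have hDc := hD.continuousOn ht (isL1Generator_canonGen ht hC hE.measurable ha)
  exact QuadraticQFT.isTraceClass_sub_one (isTraceL1_blockGen ht hC hR hE hD hu)
    (continuousOn_lowerRight hDc) (hD.isPrimitive_lowerRight ht hu) (hD.lowerRight_zero ht) hτ

lemma IsTexp.fredholmDet_lowerRight (ht : 0 ≤ t) (hC : IsTraceClassPath t C)
    (hR : IsTexp t C R) (hE : EvolutionConditions ε t A d R)
    (hD : IsTexp t (fun s => canonGen (C s) (A s)) D)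
    (hu : ∀ τ ∈ Set.Icc 0 t, IsUnit (lowerRight (D τ))) {τ : ℝ} (hτ : τ ∈ Set.Icc 0 t) :
    fredholmDet (lowerRight (D τ))
      = Complex.exp (∫ s in (0 : ℝ)..τ, sp (blockGen (C s) (A s) (D s))) := by
  obtain ⟨a, ha⟩ := hE.exists_norm_le
  have hDc := hD.continuousOn ht (isL1Generator_canonGen ht hC hE.measurable ha)
  have hc := continuousOn_lowerRight hDc
  exact fredholmDet_eq_exp ht (isTraceL1_blockGen ht hC hR hE hD hu) hc
    (continuousOn_inverse hc hu) (hD.isPrimitive_lowerRight ht hu) (hD.lowerRight_zero ht)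
    (fun τ hτ => Ring.mul_inverse_cancel _ (hu τ hτ))
    (fun τ hτ => Ring.inverse_mul_cancel _ (hu τ hτ)) hτ

end Determinant

/-! ### Creation and annihilation operators -/

section Occupation

variable {ε : ℤˣ} {ι : Type*}

/-- The occupation numbers to which a particle in the mode `α` can be added. -/
def Raisable (ε : ℤˣ) {ι : Type*} (α : ι) :=
  {n : Occ ε ι // ε = -1 → ∀ β, (n.1 + Finsupp.single α 1 : ι →₀ ℕ) β ≤ 1}

/-- One more particle in the mode `α`. -/
def Raisable.raise {α : ι} (n : Raisable ε α) : Occ ε ι := ⟨n.1.1 + Finsupp.single α 1, n.2⟩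

/-- The number of particles. -/
def Occ.deg (n : Occ ε ι) : ℕ := n.1.sum fun _ j => j

lemma Raisable.raise_injective {α : ι} :
    Function.Injective (Raisable.raise : Raisable ε α → Occ ε ι) := fun _ _ h =>
  Subtype.ext (Subtype.ext (add_right_cancel (congrArg Subtype.val h)))

lemma Raisable.raise_self {α : ι} (n : Raisable ε α) : n.raise.1 α = n.1.1 α + 1 := by
  simp [Raisable.raise]

lemma Raisable.deg_raise {α : ι} (n : Raisable ε α) : n.raise.deg = n.1.deg + 1 := by
  rw [Occ.deg, Occ.deg, Raisable.raise, Finsupp.sum_add_index' (fun _ => rfl) (fun _ _ _ => rfl),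
    Finsupp.sum_single_index rfl]

lemma exists_raise {α : ι} {n : Occ ε ι} (h : n.1 α ≠ 0) :
    ∃ m : Raisable ε α, m.raise = n ∧ m.1.1 = n.1 - Finsupp.single α 1 := by
  have e : n.1 - Finsupp.single α 1 + Finsupp.single α 1 = n.1 :=
    tsub_add_cancel_of_le (Finsupp.single_le_iff.2 (Nat.one_le_iff_ne_zero.2 h))
  exact ⟨⟨⟨n.1 - Finsupp.single α 1, fun h' β => (Nat.sub_le _ _).trans (n.2 h' β)⟩,
    fun h' β => by rw [e]; exact n.2 h' β⟩, Subtype.ext e, rfl⟩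

lemma Occ.tsum_apply (n : Occ ε ι) : ∑' α, (n.1 α : ℝ≥0∞) = n.deg := by
  rw [tsum_eq_sum (s := n.1.support) fun α hα => by simpa using hα, Occ.deg, Finsupp.sum]
  push_cast
  rfl

variable [LinearOrder ι]

lemma norm_modeSign (α : ι) (n : Occ ε ι) : ‖modeSign α n‖ = 1 := by
  rw [modeSign, norm_pow]
  rcases Int.units_eq_one_or ε with rfl | rfl <;> simp

lemma conj_modeSign (α : ι) (n : Occ ε ι) : conj (modeSign α n) = modeSign α n := by
  rw [modeSign, map_pow, conj_units_int]

lemma modeSign_raise {α : ι} (n : Raisable ε α) : modeSign α n.raise = modeSign α n.1 := by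
  have h : ∀ β, β < α → n.raise.1 β = n.1.1 β := fun β hβ => by
    simp [Raisable.raise, hβ.ne']
  have hs : n.raise.1.support.filter (· < α) = n.1.1.support.filter (· < α) := by
    ext β
    simp only [Finset.mem_filter, Finsupp.mem_support_iff]
    exact ⟨fun hβ => ⟨h β hβ.2 ▸ hβ.1, hβ.2⟩, fun hβ => ⟨(h β hβ.2).symm ▸ hβ.1, hβ.2⟩⟩
  rw [modeSign, modeSign, hs]
  congr 1
  exact Finset.sum_congr rfl fun β hβ => h β (Finset.mem_filter.1 hβ).2

lemma annih_raisable {α : ι} (χ : Occ ε ι → ℂ) (n : Raisable ε α) :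
    annih α χ n.1 = modeSign α n.1 * (Real.sqrt (n.1.1 α + 1) : ℂ) * χ n.raise := by
  rw [annih, dif_pos n.2]
  rfl

lemma annih_support {α : ι} {χ : Occ ε ι → ℂ} {n : Occ ε ι} (h : annih α χ n ≠ 0) :
    ∃ m : Raisable ε α, m.1 = n := by
  by_contra! hn
  refine h ?_
  rw [annih, dif_neg fun h' => hn ⟨n, h'⟩ rfl]

lemma create_raise {α : ι} (χ : Occ ε ι → ℂ) (n : Raisable ε α) :
    create α χ n.raise = modeSign α n.1 * (Real.sqrt (n.1.1 α + 1) : ℂ) * χ n.1 := by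
  have hα := n.raise_self
  rw [create, if_neg (by omega), modeSign_raise, hα]
  have e : (⟨n.raise.1 - Finsupp.single α 1,
      fun h β => (Nat.sub_le _ _).trans (n.raise.2 h β)⟩ : Occ ε ι) = n.1 :=
    Subtype.ext (add_tsub_cancel_right _ _)
  rw [e]
  push_cast
  rfl

lemma create_support {α : ι} {χ : Occ ε ι → ℂ} {n : Occ ε ι} (h : create α χ n ≠ 0) :
    ∃ m : Raisable ε α, m.raise = n := by
  have hα : n.1 α ≠ 0 := fun h' => h (by rw [create, if_pos h'])
  obtain ⟨m, hm, -⟩ := exists_raise hα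
  exact ⟨m, hm⟩

/-- `a†_α` is the formal adjoint of `a_α`. -/
lemma tsum_conj_mul_create (α : ι) (χ y : Occ ε ι → ℂ) :
    ∑' n, conj (y n) * create α χ n = conj (∑' n, conj (χ n) * annih α y n) := by
  have h1 : ∑' n, conj (y n) * create α χ n
      = ∑' n : Raisable ε α, conj (y n.raise) * create α χ n.raise := by
    refine (Raisable.raise_injective.tsum_eq (f := fun n => conj (y n) * create α χ n) ?_).symm
    intro n hn
    exact create_support (right_ne_zero_of_mul hn)
  have h2 : ∑' n, conj (χ n) * annih α y n
      = ∑' n : Raisable ε α, conj (χ n.1) * annih α y n.1 := by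
    refine (Subtype.val_injective.tsum_eq (f := fun n => conj (χ n) * annih α y n) ?_).symm
    intro n hn
    obtain ⟨m, hm⟩ := annih_support (right_ne_zero_of_mul hn)
    exact ⟨m, hm⟩
  rw [h1, h2, Complex.conj_tsum]
  refine tsum_congr fun n => ?_
  rw [create_raise, annih_raisable, map_mul, map_mul, map_mul, conj_modeSign, Complex.conj_conj,
    Complex.conj_ofReal]
  ring

lemma enorm_modeSign_mul_sq (α : ι) (n : Occ ε ι) (z : ℂ) :
    ‖modeSign α n * (Real.sqrt (n.1 α + 1) : ℂ) * z‖ₑ ^ 2 = (n.1 α + 1 : ℕ) * ‖z‖ₑ ^ 2 := by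
  have h : ‖modeSign α n * (Real.sqrt (n.1 α + 1) : ℂ) * z‖ ^ 2
      = ((n.1 α + 1 : ℕ) : ℝ) * ‖z‖ ^ 2 := by
    rw [norm_mul, norm_mul, norm_modeSign, one_mul, mul_pow, Complex.norm_real, Real.norm_eq_abs,
      sq_abs, Real.sq_sqrt (by positivity)]
    push_cast
    rfl
  rw [← ofReal_norm, ← ofReal_norm, ← ENNReal.ofReal_pow (norm_nonneg _), h,
    ENNReal.ofReal_mul (Nat.cast_nonneg _), ENNReal.ofReal_natCast,
    ENNReal.ofReal_pow (norm_nonneg _)]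

/-- The mean number of particles. -/
def meanNumber (χ : Occ ε ι → ℂ) : ℝ≥0∞ := ∑' n : Occ ε ι, (n.deg : ℝ≥0∞) * ‖χ n‖ₑ ^ 2

lemma tsum_enorm_annih_sq_le (α : ι) (χ : Occ ε ι → ℂ) :
    ∑' n, ‖annih α χ n‖ₑ ^ 2 ≤ ∑' n : Occ ε ι, (n.1 α : ℝ≥0∞) * ‖χ n‖ₑ ^ 2 := by
  have h2 : ∑' n, ‖annih α χ n‖ₑ ^ 2 = ∑' n : Raisable ε α, ‖annih α χ n.1‖ₑ ^ 2 := by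
    refine (Subtype.val_injective.tsum_eq (f := fun n => ‖annih α χ n‖ₑ ^ 2) ?_).symm
    intro n hn
    obtain ⟨m, hm⟩ := annih_support (α := α) (χ := χ) (n := n) fun h => hn (by simp [h])
    exact ⟨m, hm⟩
  rw [h2]
  refine le_trans (le_of_eq ?_) (ENNReal.tsum_comp_le_tsum_of_injective
    (Raisable.raise_injective (ε := ε) (α := α)) (fun n : Occ ε ι => (n.1 α : ℝ≥0∞) * ‖χ n‖ₑ ^ 2))
  refine tsum_congr fun n => ?_
  rw [annih_raisable, enorm_modeSign_mul_sq, Raisable.raise_self]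

lemma tsum_tsum_enorm_annih_sq_le (χ : Occ ε ι → ℂ) :
    ∑' α, ∑' n, ‖annih α χ n‖ₑ ^ 2 ≤ meanNumber χ := by
  refine (ENNReal.tsum_le_tsum fun α => tsum_enorm_annih_sq_le α χ).trans (le_of_eq ?_)
  rw [ENNReal.tsum_comm, meanNumber]
  refine tsum_congr fun n => ?_
  rw [ENNReal.tsum_mul_right, Occ.tsum_apply]

/-- The Cauchy-Schwarz inequality for sums in `[0, ∞]`. -/
lemma sq_tsum_le {κ : Type*} {w a b : κ → ℝ≥0∞} (h : ∀ n, w n ^ 2 ≤ a n * b n) :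
    (∑' n, w n) ^ 2 ≤ (∑' n, a n) * ∑' n, b n := by
  let _ : MeasurableSpace κ := ⊤
  have hm : ∀ f : κ → ℝ≥0∞, AEMeasurable f Measure.count := fun f =>
    measurable_from_top.aemeasurable
  have h1 := ENNReal.lintegral_mul_le_Lp_mul_Lq Measure.count Real.HolderConjugate.two_two
    (hm fun n => a n ^ (1 / 2 : ℝ)) (hm fun n => b n ^ (1 / 2 : ℝ))
  have e : ∀ x : ℝ≥0∞, (x ^ (1 / 2 : ℝ)) ^ (2 : ℝ) = x := fun x => by
    rw [← ENNReal.rpow_mul]; norm_num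
  have e' : ∀ x : ℝ≥0∞, (x ^ (1 / 2 : ℝ)) ^ 2 = x := fun x => by
    rw [← ENNReal.rpow_natCast]; exact e x
  simp only [Pi.mul_apply, lintegral_count, e] at h1
  have h2 : ∀ n, w n ≤ a n ^ (1 / 2 : ℝ) * b n ^ (1 / 2 : ℝ) := fun n => by
    rw [← ENNReal.mul_rpow_of_nonneg _ _ (by norm_num), ← ENNReal.rpow_le_rpow_iff (z := 2)
      (by norm_num), e]
    exact_mod_cast h n
  calc (∑' n, w n) ^ 2 ≤ _ := ENNReal.pow_le_pow_left ((ENNReal.tsum_le_tsum h2).trans h1)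
    _ = _ := by rw [mul_pow, e', e']

omit [LinearOrder ι] in
/-- A kernel whose absolute value is bounded in `ℓ²` defines a bounded operator. -/
lemma exists_clm_of_kernel {κ : Type*} {k : ι → κ → ℂ} {c : ℝ≥0∞} (hc : c < ⊤)
    (h : ∀ y : OneParticle κ, ∑' α, (∑' n, ‖k α n‖ₑ * ‖y n‖ₑ) ^ 2 ≤ c * ‖y‖ₑ ^ 2) :
    ∃ L : OneParticle κ →L[ℂ] OneParticle ι,
      (∀ y α, HasSum (fun n => k α n * y n) (L y α)) ∧ ∀ y, ‖L y‖ₑ ^ 2 ≤ c * ‖y‖ₑ ^ 2 := by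
  have hfin : ∀ y : OneParticle κ, c * ‖y‖ₑ ^ 2 < ⊤ := fun y =>
    ENNReal.mul_lt_top hc (ENNReal.pow_lt_top enorm_lt_top)
  have hsum : ∀ (y : OneParticle κ) α, Summable fun n => k α n * y n := by
    intro y α
    have h1 := (ENNReal.le_tsum α).trans_lt ((h y).trans_lt (hfin y))
    have h2 : ∑' n, ‖k α n‖ₑ * ‖y n‖ₑ ≠ ⊤ := by
      rintro h3
      rw [h3] at h1
      exact absurd h1 (by simp)
    refine Summable.of_enorm ?_
    simpa only [enorm_mul] using h2
  have hle : ∀ (y : OneParticle κ) α, ‖∑' n, k α n * y n‖ₑ ≤ ∑' n, ‖k α n‖ₑ * ‖y n‖ₑ := by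
    intro y α
    refine (enorm_tsum_le_tsum_enorm).trans (le_of_eq (tsum_congr fun n => enorm_mul _ _))
  have hsq : ∀ y : OneParticle κ, ∑' α, ‖∑' n, k α n * y n‖ₑ ^ 2 ≤ c * ‖y‖ₑ ^ 2 := fun y =>
    (ENNReal.tsum_le_tsum fun α => ENNReal.pow_le_pow_left (hle y α)).trans (h y)
  have hmem : ∀ y : OneParticle κ, Memℓp (fun α => ∑' n, k α n * y n) 2 := by
    intro y
    refine memℓp_gen ?_
    have h1 := ENNReal.summable_toReal (((hsq y).trans_lt (hfin y)).ne)
    refine h1.congr fun α => ?_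
    rw [ENNReal.toReal_pow, toReal_enorm]
    norm_num
  let L₀ : OneParticle κ →ₗ[ℂ] OneParticle ι :=
    { toFun := fun y => ⟨fun α => ∑' n, k α n * y n, hmem y⟩
      map_add' := fun y z => lp.ext (funext fun α => by
        change ∑' n, k α n * (y n + z n) = ∑' n, k α n * y n + ∑' n, k α n * z n
        rw [← (hsum y α).tsum_add (hsum z α)]
        exact tsum_congr fun n => mul_add _ _ _)
      map_smul' := fun r y => lp.ext (funext fun α => by
        change ∑' n, k α n * (r * y n) = r * ∑' n, k α n * y n
        rw [← tsum_mul_left]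
        exact tsum_congr fun n => mul_left_comm _ _ _) }
  have hL : ∀ y, ‖L₀ y‖ₑ ^ 2 ≤ c * ‖y‖ₑ ^ 2 := fun y => by
    rw [enorm_sq_eq_tsum]
    exact hsq y
  refine ⟨L₀.mkContinuous (Real.sqrt c.toReal) fun y => ?_, fun y α => (hsum y α).hasSum, hL⟩
  have h1 := ENNReal.toReal_mono (hfin y).ne (hL y)
  rw [ENNReal.toReal_mul, ENNReal.toReal_pow, ENNReal.toReal_pow, toReal_enorm, toReal_enorm] at h1
  refine le_of_sq_le_sq ?_ (by positivity)
  rwa [mul_pow, Real.sq_sqrt ENNReal.toReal_nonneg]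

lemma annih_kernel_le (χ : Occ ε ι → ℂ) (y : Fock ε ι) :
    ∑' α, (∑' n, ‖annih α χ n‖ₑ * ‖y n‖ₑ) ^ 2 ≤ meanNumber χ * ‖y‖ₑ ^ 2 := by
  have h : ∀ α, (∑' n, ‖annih α χ n‖ₑ * ‖y n‖ₑ) ^ 2
      ≤ (∑' n, ‖annih α χ n‖ₑ ^ 2) * ‖y‖ₑ ^ 2 := fun α => by
    rw [enorm_sq_eq_tsum]
    exact sq_tsum_le fun n => (mul_pow _ _ _).le
  refine (ENNReal.tsum_le_tsum h).trans ?_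
  rw [ENNReal.tsum_mul_right]
  gcongr
  exact tsum_tsum_enorm_annih_sq_le χ

/-- Although `a†_α χ` is not square summable over the modes `α`, its matrix elements with a fixed
vector `y` are: the weights `n_α / |n|`, whose sum over the modes is `1`, are put on `y`. -/
lemma create_kernel_le (χ y : Fock ε ι) :
    ∑' α, (∑' n, ‖create α χ n‖ₑ * ‖y n‖ₑ) ^ 2 ≤ (meanNumber χ + ‖χ‖ₑ ^ 2) * ‖y‖ₑ ^ 2 := by
  have h : ∀ α, (∑' n, ‖create α χ n‖ₑ * ‖y n‖ₑ) ^ 2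
      ≤ (meanNumber χ + ‖χ‖ₑ ^ 2)
        * ∑' n : Occ ε ι, (n.1 α : ℝ≥0∞) * ((n.deg : ℝ≥0∞)⁻¹ * ‖y n‖ₑ ^ 2) := by
    intro α
    have h1 : ∑' n, ‖create α χ n‖ₑ * ‖y n‖ₑ
        = ∑' n : Raisable ε α, ‖create α χ n.raise‖ₑ * ‖y n.raise‖ₑ := by
      refine (Raisable.raise_injective.tsum_eq
        (f := fun n => ‖create α χ n‖ₑ * ‖y n‖ₑ) ?_).symm
      intro n hn
      exact create_support (α := α) (χ := χ) fun h => hn (by simp [h])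
    rw [h1]
    refine (sq_tsum_le (a := fun n : Raisable ε α => ((n.1.deg + 1 : ℕ) : ℝ≥0∞) * ‖χ n.1‖ₑ ^ 2)
      (b := fun n : Raisable ε α => (n.raise.1 α : ℝ≥0∞) *
        ((n.raise.deg : ℝ≥0∞)⁻¹ * ‖y n.raise‖ₑ ^ 2)) fun n => le_of_eq ?_).trans ?_
    · rw [mul_pow, create_raise, enorm_modeSign_mul_sq, Raisable.raise_self, Raisable.deg_raise]
      have e : ((n.1.deg + 1 : ℕ) : ℝ≥0∞) * ((n.1.deg + 1 : ℕ) : ℝ≥0∞)⁻¹ = 1 :=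
        ENNReal.mul_inv_cancel (by simp) (ENNReal.natCast_ne_top _)
      calc _ = ((n.1.1 α + 1 : ℕ) : ℝ≥0∞) * ‖χ n.1‖ₑ ^ 2 * ‖y n.raise‖ₑ ^ 2
            * (((n.1.deg + 1 : ℕ) : ℝ≥0∞) * ((n.1.deg + 1 : ℕ) : ℝ≥0∞)⁻¹) := by rw [e, mul_one]
        _ = _ := by ring
    · gcongr
      · refine (ENNReal.tsum_comp_le_tsum_of_injective Subtype.val_injective
          (fun n : Occ ε ι => ((n.deg + 1 : ℕ) : ℝ≥0∞) * ‖χ n‖ₑ ^ 2)).trans (le_of_eq ?_)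
        rw [meanNumber, enorm_sq_eq_tsum, ← ENNReal.tsum_add]
        refine tsum_congr fun n => ?_
        push_cast
        ring
      · exact ENNReal.tsum_comp_le_tsum_of_injective Raisable.raise_injective
          (fun n : Occ ε ι => (n.1 α : ℝ≥0∞) * ((n.deg : ℝ≥0∞)⁻¹ * ‖y n‖ₑ ^ 2))
  refine (ENNReal.tsum_le_tsum h).trans ?_
  rw [ENNReal.tsum_mul_left, ENNReal.tsum_comm]
  gcongr
  rw [enorm_sq_eq_tsum]
  refine ENNReal.tsum_le_tsum fun n => ?_
  rw [ENNReal.tsum_mul_right, Occ.tsum_apply, ← mul_assoc]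
  exact mul_le_of_le_one_left' (ENNReal.mul_inv_le_one _)

end Occupation

/-! ### The evolution of the vacuum -/

section Ket

variable {ε : ℤˣ} {ι : Type*}

open Classical in
lemma ket_apply (m n : Occ ε ι) : (ket m : Fock ε ι) n = if n = m then 1 else 0 := by
  rw [ket, lp.single_apply, Pi.single_apply]

lemma ket_eq_basisVec [DecidableEq (Occ ε ι)] (m : Occ ε ι) : (ket m : Fock ε ι) = basisVec m :=
  lp.ext (funext fun n => by rw [ket_apply, basisVec_apply]; congr)

lemma norm_ket (m : Occ ε ι) : ‖(ket m : Fock ε ι)‖ = 1 := by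
  classical
  rw [ket_eq_basisVec, norm_basisVec]

lemma inner_ket_left (m : Occ ε ι) (χ : Fock ε ι) : inner ℂ (ket m) χ = χ m := by
  classical
  rw [ket_eq_basisVec, inner_basisVec_left]

lemma norm_apply_of_star_mul_self {κ : Type*} {T : Op κ} (h : star T * T = 1)
    (x : OneParticle κ) : ‖T x‖ = ‖x‖ := by
  have h1 : inner ℂ (T x) (T x) = inner ℂ x x := by
    rw [← inner_star_right, ← op_mul_apply, h]; rfl
  rw [inner_self_eq_norm_sq_to_K, inner_self_eq_norm_sq_to_K] at h1
  have h2 : ‖T x‖ ^ 2 = ‖x‖ ^ 2 := by exact_mod_cast h1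
  exact (pow_left_inj₀ (norm_nonneg _) (norm_nonneg _) two_ne_zero).1 h2

/-- The vacuum occupation numbers, to which a particle can be added in any mode. -/
def Raisable.zero (ε : ℤˣ) (γ : ι) : Raisable ε γ :=
  ⟨Occ.zero ε ι, fun _ β => by
    classical
    change (0 + Finsupp.single γ 1 : ι →₀ ℕ) β ≤ 1
    rw [zero_add, Finsupp.single_apply]
    split_ifs <;> simp⟩

lemma Raisable.zero_raise (γ : ι) : (Raisable.zero ε γ).raise.1 = Finsupp.single γ 1 :=
  zero_add _

variable [LinearOrder ι]

lemma modeSign_zero (α : ι) : modeSign α (Occ.zero ε ι) = 1 := by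
  rw [modeSign, Occ.zero]
  simp

lemma annih_zero (α : ι) (χ : Occ ε ι → ℂ) :
    annih α χ (Occ.zero ε ι) = χ (Raisable.zero ε α).raise := by
  have h := annih_raisable χ (Raisable.zero ε α)
  change annih α χ (Occ.zero ε ι) = modeSign α (Occ.zero ε ι) *
    (Real.sqrt (((0 : ℕ) : ℝ) + 1) : ℂ) * _ at h
  rw [h, modeSign_zero]
  simp

lemma create_zero_raise (β γ : ι) (χ : Occ ε ι → ℂ) :
    create β χ (Raisable.zero ε γ).raise = if β = γ then χ (Occ.zero ε ι) else 0 := by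
  split_ifs with h
  · subst h
    rw [create_raise]
    change modeSign β (Occ.zero ε ι) * (Real.sqrt (((0 : ℕ) : ℝ) + 1) : ℂ) * _ = _
    rw [modeSign_zero]
    simp [Raisable.zero]
  · rw [create, if_pos]
    rw [Raisable.zero_raise, Finsupp.single_apply, if_neg (Ne.symm h)]

lemma annih_ket_zero (α : ι) (n : Occ ε ι) : annih α (ket (Occ.zero ε ι) : Fock ε ι) n = 0 := by
  by_contra h
  obtain ⟨m, rfl⟩ := annih_support h
  rw [annih_raisable, ket_apply, if_neg, mul_zero] at h
  · exact h rfl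
  · intro h'
    have := m.raise_self
    rw [h'] at this
    exact absurd this (Nat.succ_ne_zero _).symm

/-- The vacuum component of `H χ`, for a state `χ` whose two particle component is the vacuum
component times the pair amplitude `Z`. -/
lemma hamiltonian_zero {C A Z : Op ι} {d : ℝ} {χ : Occ ε ι → ℂ}
    (hZ : ∀ α γ, annih α χ (Raisable.zero ε γ).raise = χ (Occ.zero ε ι) * entry Z α γ) :
    hamiltonian C A d χ (Occ.zero ε ι)
      = (1 / 2 * sp (star A * Z) + d) * χ (Occ.zero ε ι) := by
  have hc : ∀ (α : ι) (ψ : Occ ε ι → ℂ), create α ψ (Occ.zero ε ι) = 0 := fun α ψ => by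
    rw [create, if_pos]; rfl
  have ha : ∀ α, ∑' β, entry (star A) α β * annih α (annih β χ) (Occ.zero ε ι)
      = χ (Occ.zero ε ι) * entry (star A * Z) α α := fun α => by
    rw [← (hasSum_entry_mul_entry (star A) Z α α).tsum_eq, ← tsum_mul_left]
    refine tsum_congr fun β => ?_
    rw [annih_zero, hZ]
    ring
  rw [hamiltonian, tsum_congr ha, tsum_mul_left]
  simp only [hc, mul_zero, tsum_zero, zero_add, add_zero]
  rw [sp]
  ring

end Ket

section Evolution

variable {ε : ℤˣ} {ι : Type*} [LinearOrder ι] {t a : ℝ} {C A : ℝ → Op ι} {d : ℝ → ℝ}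
  {U : ℝ → Fock ε ι →L[ℂ] Fock ε ι}
  {D : ℝ → (OneParticle ι × OneParticle ι) →L[ℂ] (OneParticle ι × OneParticle ι)}

lemma IsEvolution.zero_ket (ht : 0 ≤ t) (hU : IsEvolution t C A d U) (m : Occ ε ι) :
    U 0 (ket m) = ket m :=
  lp.ext (funext fun n => by
    have := (hU.schrodinger n m 0 ⟨le_rfl, ht⟩).2
    rwa [intervalIntegral.integral_same, mul_zero, sub_zero] at this)

/-- The matrices of `a†_α(s)` and `a_α(s)` are adjoint to each other. -/
lemma heisCreate_eq (s : ℝ) (α : ι) (k m : Occ ε ι) :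
    heisCreate U s α k m = conj (heisAnnih U s α m k) :=
  tsum_conj_mul_create _ _ _

/-- The matrix elements of the annihilation and creation operators between an arbitrary vector
`ȳ` and `U_s |m⟩` are square summable over the modes, uniformly in `s`. -/
lemma IsEvolution.exists_clm (hU : IsEvolution t C A d U) (m : Occ ε ι) :
    ∃ c : ℝ≥0∞, c < ⊤ ∧ ∀ s ∈ Set.Icc 0 t, ∃ La Lc : Fock ε ι →L[ℂ] OneParticle ι,
      (∀ y α, HasSum (fun n => annih α (U s (ket m)) n * y n) (La y α)) ∧
      (∀ y α, HasSum (fun n => create α (U s (ket m)) n * y n) (Lc y α)) ∧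
      (∀ y, ‖La y‖ₑ ^ 2 ≤ c * ‖y‖ₑ ^ 2) ∧ (∀ y, ‖Lc y‖ₑ ^ 2 ≤ c * ‖y‖ₑ ^ 2) := by
  obtain ⟨K, hK⟩ := hU.number m
  refine ⟨ENNReal.ofReal K + 1, by finiteness, fun s hs => ?_⟩
  have hN : meanNumber (U s (ket m)) ≤ ENNReal.ofReal K := hK s hs
  have h1 : ‖U s (ket m)‖ₑ ^ 2 = 1 := by
    have h := norm_apply_of_star_mul_self (T := U s) (Unitary.star_mul_self_of_mem
      (hU.unitary s hs)) (ket m)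
    rw [← ofReal_norm, h, norm_ket]
    simp
  obtain ⟨La, hLa, hLa'⟩ := exists_clm_of_kernel (κ := Occ ε ι)
    (k := fun α n => annih α (U s (ket m)) n) (c := ENNReal.ofReal K + 1) (by finiteness)
    fun y => (annih_kernel_le _ y).trans
      (by gcongr; exact hN.trans le_self_add)
  obtain ⟨Lc, hLc, hLc'⟩ := exists_clm_of_kernel (κ := Occ ε ι)
    (k := fun α n => create α (U s (ket m)) n) (c := ENNReal.ofReal K + 1) (by finiteness)
    fun y => (create_kernel_le _ y).trans (by rw [h1]; gcongr)
  exact ⟨La, Lc, hLa, hLc, hLa', hLc'⟩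

/-- The vectors of the matrix elements `⟨k| a_α(s) |m⟩` and `⟨k| a†_α(s) |m⟩`. -/
lemma IsEvolution.exists_modes (hU : IsEvolution t C A d U) (k m : Occ ε ι) :
    ∃ (x y : ℝ → OneParticle ι) (b : ℝ), ∀ s ∈ Set.Icc 0 t,
      (∀ α, x s α = heisAnnih U s α k m) ∧ (∀ α, y s α = heisCreate U s α k m) ∧
      ‖x s‖ ≤ b ∧ ‖y s‖ ≤ b := by
  obtain ⟨c, hc, h⟩ := hU.exists_clm m
  have hb : ∀ {x : OneParticle ι}, ‖x‖ₑ ^ 2 ≤ c → ‖x‖ ≤ Real.sqrt c.toReal := fun {x} hx => by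
    refine Real.le_sqrt_of_sq_le ?_
    have := ENNReal.toReal_mono hc.ne hx
    rwa [ENNReal.toReal_pow, toReal_enorm] at this
  have h2 : ∀ s, ∃ x y : OneParticle ι, s ∈ Set.Icc 0 t →
      (∀ α, x α = heisAnnih U s α k m) ∧ (∀ α, y α = heisCreate U s α k m) ∧
      ‖x‖ ≤ Real.sqrt c.toReal ∧ ‖y‖ ≤ Real.sqrt c.toReal := by
    intro s
    by_cases hs : s ∈ Set.Icc 0 t
    · obtain ⟨La, Lc, hLa, hLc, hLa', hLc'⟩ := h s hs
      have h1 : ‖star (U s (ket k))‖ₑ ^ 2 = 1 := by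
        have h := norm_apply_of_star_mul_self (T := U s) (Unitary.star_mul_self_of_mem
          (hU.unitary s hs)) (ket k)
        rw [← ofReal_norm, norm_star, h, norm_ket]
        simp
      refine ⟨La (star (U s (ket k))), Lc (star (U s (ket k))), fun _ => ⟨fun α => ?_, fun α => ?_,
        hb ((hLa' _).trans (by rw [h1, mul_one])), hb ((hLc' _).trans (by rw [h1, mul_one]))⟩⟩
      · rw [← (hLa _ α).tsum_eq]
        exact tsum_congr fun n => mul_comm _ _
      · rw [← (hLc _ α).tsum_eq]
        exact tsum_congr fun n => mul_comm _ _
    · exact ⟨0, 0, fun h => absurd h hs⟩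
  choose x y hxy using h2
  exact ⟨x, y, _, hxy⟩

lemma isPrimitive_of_apply {f f' : ℝ → OneParticle ι} (hf' : IntervalIntegrable f' volume 0 t)
    (h : ∀ i, IsPrimitive t (fun s => f s i) (fun s => f' s i)) : IsPrimitive t f f' := by
  refine ⟨hf', fun τ hτ => lp.ext (funext fun i => ?_)⟩
  have h0 : (0 : ℝ) ∈ Set.Icc 0 t := ⟨le_rfl, hτ.1.trans hτ.2⟩
  have e := (innerSL ℂ (basisVec i)).intervalIntegral_comp_comm (intervalIntegrable_sub hf' h0 hτ)
  simp only [innerSL_apply_apply, inner_basisVec_left] at e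
  rw [(h i).eq τ hτ, e]
  rfl

lemma IsEvolution.isPrimitive_heisAnnih (ht : 0 ≤ t) (hU : IsEvolution t C A d U) (α : ι)
    (k m : Occ ε ι) : IsPrimitive t (fun s => heisAnnih U s α k m)
      (fun s => -Complex.I * ∑' β, (entry (C s) α β * heisAnnih U s β k m
        + entry (A s) α β * heisCreate U s β k m)) := by
  refine ⟨(hU.heisenberg α k m t ⟨ht, le_rfl⟩).1.const_mul _, fun τ hτ => ?_⟩
  rw [(hU.heisenberg α k m τ hτ).2, intervalIntegral.integral_const_mul]
  ring

variable [Countable ι]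

/-- The Heisenberg equation, as an equation in the one-particle space. -/
lemma IsEvolution.isPrimitive_modes (ht : 0 ≤ t) (hC : IsTraceClassPath t C)
    (hAm : WeaklyMeasurable (volume.restrict (Set.Icc 0 t)) A)
    (hAb : ∀ τ ∈ Set.Icc 0 t, ‖A τ‖ ≤ a) (hU : IsEvolution t C A d U) {k m : Occ ε ι}
    {x y : ℝ → OneParticle ι} {b : ℝ}
    (h : ∀ s ∈ Set.Icc 0 t, (∀ α, x s α = heisAnnih U s α k m) ∧
      (∀ α, y s α = heisCreate U s α k m) ∧ ‖x s‖ ≤ b ∧ ‖y s‖ ≤ b) :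
    IsPrimitive t x (fun s => -Complex.I • (C s (x s) + A s (y s))) := by
  have hxc : ∀ α, ContinuousOn (fun s => x s α) (Set.Icc 0 t) := fun α =>
    (hU.isPrimitive_heisAnnih ht α k m).continuousOn.congr fun s hs => (h s hs).1 α
  have hyc : ∀ α, ContinuousOn (fun s => y s α) (Set.Icc 0 t) := fun α =>
    (Complex.continuous_conj.comp_continuousOn
      (hU.isPrimitive_heisAnnih ht α m k).continuousOn).congr fun s hs => by
        change y s α = conj (heisAnnih U s α m k)
        rw [(h s hs).2.1 α, heisCreate_eq]
  have hm : ∀ {z : ℝ → OneParticle ι}, (∀ α, ContinuousOn (fun s => z s α) (Set.Icc 0 t)) →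
      AEStronglyMeasurable z (volume.restrict (Set.Icc 0 t)) := fun hz =>
    aestronglyMeasurable_of_apply fun α =>
      ((hz α).aestronglyMeasurable measurableSet_Icc).aemeasurable
  have hCm : WeaklyMeasurable (volume.restrict (Set.Icc 0 t)) C := hC.measurable
  have hint : IntervalIntegrable (fun s => -Complex.I • (C s (x s) + A s (y s))) volume 0 t := by
    refine intervalIntegrable_of_norm_le ht (b := fun s => ((traceNorm (C s)).toReal + a) * b)
      (((hC.isTraceL1.intervalIntegrable ht).add intervalIntegrable_const).mul_const _)
      (((hCm.apply (hm hxc)).add (hAm.apply (hm hyc))).const_smul (-Complex.I)) fun s hs => ?_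
    obtain ⟨-, -, hxb, hyb⟩ := h s hs
    rw [norm_smul, norm_neg, Complex.norm_I, one_mul, add_mul]
    refine (norm_add_le _ _).trans (add_le_add ?_ ?_)
    · exact ((C s).le_opNorm _).trans (mul_le_mul (norm_le_toReal_traceNorm (hC.traceClass s hs))
        hxb (norm_nonneg _) ENNReal.toReal_nonneg)
    · exact ((A s).le_opNorm _).trans (mul_le_mul (hAb s hs) hyb (norm_nonneg _)
        ((norm_nonneg _).trans (hAb s hs)))
  refine isPrimitive_of_apply hint fun α => ?_
  refine (hU.isPrimitive_heisAnnih ht α k m).congr ht (fun s hs => (h s hs).1 α) fun s hs => ?_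
  change -Complex.I * (C s (x s) α + A s (y s) α) = _
  rw [← ((hasSum_entry_mul (C s) (x s) α).add (hasSum_entry_mul (A s) (y s) α)).tsum_eq]
  congr 1
  exact tsum_congr fun β => by rw [(h s hs).1, (h s hs).2.1]

/-- As `a_α` annihilates the vacuum, the matrix elements of `a(s)` and `a†(s)` in the evolved
vacuum are related by the pair amplitude `Ψ Φ̄⁻¹`. -/
lemma IsEvolution.modes_eq (ht : 0 ≤ t) (hC : IsTraceClassPath t C)
    (hAm : WeaklyMeasurable (volume.restrict (Set.Icc 0 t)) A)
    (hAb : ∀ τ ∈ Set.Icc 0 t, ‖A τ‖ ≤ a) (hU : IsEvolution t C A d U)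
    (hD : IsTexp t (fun s => canonGen (C s) (A s)) D) {τ : ℝ} (hτ : τ ∈ Set.Icc 0 t)
    (hu : IsUnit (lowerRight (D τ))) {k : Occ ε ι} {x y : OneParticle ι}
    (hx : ∀ α, x α = heisAnnih U τ α k (Occ.zero ε ι))
    (hy : ∀ α, y α = heisCreate U τ α k (Occ.zero ε ι)) :
    x = (psiBlock (D τ) * Ring.inverse (lowerRight (D τ))) y := by
  obtain ⟨p, q, b, h1⟩ := hU.exists_modes k (Occ.zero ε ι)
  obtain ⟨p', q', b', h2⟩ := hU.exists_modes (Occ.zero ε ι) k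
  have hp := hU.isPrimitive_modes ht hC hAm hAb h1
  have hp' := (hU.isPrimitive_modes ht hC hAm hAb h2).clm
    ((starL' ℝ : OneParticle ι ≃L[ℝ] OneParticle ι) : OneParticle ι →L[ℝ] OneParticle ι)
  have e1 : ∀ s ∈ Set.Icc 0 t, star (p' s) = q s := fun s hs => lp.ext (funext fun α => by
    change conj (p' s α) = q s α
    rw [(h2 s hs).1, (h1 s hs).2.1, heisCreate_eq])
  have e2 : ∀ s ∈ Set.Icc 0 t, star (q' s) = p s := fun s hs => lp.ext (funext fun α => by
    change conj (q' s α) = p s α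
    rw [(h2 s hs).2.1, (h1 s hs).1, heisCreate_eq, Complex.conj_conj])
  -- the matrix elements of `(a, a†)` solve the equation of the canonical dynamics
  have h3 : IsPrimitive t (fun s => (p s, q s))
      (fun s => -Complex.I • canonGen (C s) (A s) (p s, q s)) := by
    refine (hp.prodMk ht hp').congr ht (fun s hs => Prod.ext rfl (e1 s hs).symm) fun s hs => ?_
    refine Prod.ext rfl ?_
    have := congrArg Prod.snd (canonGen_star_swap (C s) (A s) (p' s, q' s))
    rw [e1 s hs, e2 s hs] at this
    exact this
  have hp0 : p 0 = 0 := lp.ext (funext fun α => by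
    rw [(h1 0 ⟨le_rfl, ht⟩).1, heisAnnih, hU.zero_ket ht (Occ.zero ε ι)]
    simp only [annih_ket_zero, mul_zero, tsum_zero]
    rfl)
  have h4 := (isL1Generator_canonGen ht hC hAm hAb).solution_unique ht h3
    (hD.isPrimitive ht (0, q 0)) (by rw [hD.zero_apply ht, hp0]) hτ
  have hx' : x = psiBlock (D τ) (q 0) := by
    rw [psiBlock_apply, ← h4]
    exact lp.ext (funext fun α => by rw [hx, (h1 τ hτ).1])
  have hy' : y = lowerRight (D τ) (q 0) := by
    rw [lowerRight_apply, ← h4]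
    exact lp.ext (funext fun α => by rw [hy, (h1 τ hτ).2.1])
  rw [hx', hy', ← op_mul_apply, mul_assoc, Ring.inverse_mul_cancel _ hu, mul_one]

/-- As the vectors `U |k⟩` span the Fock space, the relation between the matrix elements of `a`
and `a†` in `χ = U |vac⟩` extends to `a_α χ = ∑ Z_{αβ} a†_β χ`; the one particle component of
this equation is the assertion. -/
lemma IsEvolution.annih_eq (ht : 0 ≤ t) (hC : IsTraceClassPath t C)
    (hAm : WeaklyMeasurable (volume.restrict (Set.Icc 0 t)) A)
    (hAb : ∀ τ ∈ Set.Icc 0 t, ‖A τ‖ ≤ a) (hU : IsEvolution t C A d U)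
    (hD : IsTexp t (fun s => canonGen (C s) (A s)) D) {τ : ℝ} (hτ : τ ∈ Set.Icc 0 t)
    (hu : IsUnit (lowerRight (D τ))) (α γ : ι) :
    annih α (U τ (vac ε ι)) (Raisable.zero ε γ).raise = (U τ (vac ε ι)) (Occ.zero ε ι)
      * entry (psiBlock (D τ) * Ring.inverse (lowerRight (D τ))) α γ := by
  classical
  set Z := psiBlock (D τ) * Ring.inverse (lowerRight (D τ)) with hZ
  obtain ⟨c, -, h⟩ := hU.exists_clm (Occ.zero ε ι)
  obtain ⟨La, Lc, hLa, hLc, -, -⟩ := h τ hτ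
  have h1 : ∀ k : Occ ε ι, La (star (U τ (ket k))) = Z (Lc (star (U τ (ket k)))) := fun k => by
    refine hU.modes_eq ht hC hAm hAb hD hτ hu (k := k) (fun α => ?_) fun α => ?_
    · rw [← (hLa _ α).tsum_eq]
      exact tsum_congr fun n => mul_comm _ _
    · rw [← (hLc _ α).tsum_eq]
      exact tsum_congr fun n => mul_comm _ _
  have h2 : ∀ y : Fock ε ι, La (conjOp (U τ) y) = Z (Lc (conjOp (U τ) y)) := by
    intro y
    have hs := hasSum_basisVec (ι := Occ ε ι) y
    have ha := (La.comp (conjOp (U τ))).hasSum hs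
    have hc := ((Z.comp Lc).comp (conjOp (U τ))).hasSum hs
    refine ha.unique (hc.congr_fun fun n => ?_)
    simp only [map_smul]
    congr 1
    have := h1 n
    rw [ket_eq_basisVec, ← star_basisVec] at this
    exact this
  have h3 : ∀ y : Fock ε ι, La y = Z (Lc y) := fun y => by
    have e : conjOp (U τ) (conjOp (star (U τ)) y) = y := by
      rw [← op_mul_apply, ← conjOp_mul, Unitary.mul_star_self_of_mem (hU.unitary τ hτ),
        conjOp_one]
      rfl
    rw [← e, h2]
  have hket : ∀ (f : Occ ε ι → ℂ) (m : Occ ε ι) (z : ℂ),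
      HasSum (fun n => f n * (ket m : Fock ε ι) n) z → z = f m := fun f m z hz => by
    refine hz.unique ?_
    have := hasSum_single (f := fun n => f n * (ket m : Fock ε ι) n) m fun n hn => by
      rw [ket_apply, if_neg hn, mul_zero]
    simpa [ket_apply] using this
  have h4 := congrArg (fun v : OneParticle ι => v α) (h3 (ket (Raisable.zero ε γ).raise))
  simp only at h4
  rw [hket _ _ _ (hLa _ α)] at h4
  have h5 : Lc (ket (Raisable.zero ε γ).raise) = (U τ (vac ε ι)) (Occ.zero ε ι) • basisVec γ :=
    lp.ext (funext fun β => by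
      rw [hket _ _ _ (hLc _ β), create_zero_raise]
      change _ = (U τ (vac ε ι)) (Occ.zero ε ι) * basisVec γ β
      rw [basisVec_apply, mul_ite, mul_one, mul_zero]
      rfl)
  rw [h5, map_smul] at h4
  exact h4

/-- The vacuum amplitude `u` solves `u̇ = -i (½ Sp (A† Ψ Φ̄⁻¹) + d) u`. -/
lemma IsEvolution.vacuum_amplitude (ht : 0 ≤ t) (hC : IsTraceClassPath t C)
    (hAm : WeaklyMeasurable (volume.restrict (Set.Icc 0 t)) A)
    (hAb : ∀ τ ∈ Set.Icc 0 t, ‖A τ‖ ≤ a) (hU : IsEvolution t C A d U)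
    (hD : IsTexp t (fun s => canonGen (C s) (A s)) D)
    (hu : ∀ τ ∈ Set.Icc 0 t, IsUnit (lowerRight (D τ)))
    (hI : IntervalIntegrable (fun s => -Complex.I * (1 / 2 * sp (star (A s) *
      (psiBlock (D s) * Ring.inverse (lowerRight (D s)))) + d s)) volume 0 t)
    {τ : ℝ} (hτ : τ ∈ Set.Icc 0 t) :
    inner ℂ (vac ε ι) (U τ (vac ε ι)) = Complex.exp (∫ s in (0 : ℝ)..τ,
      -Complex.I * (1 / 2 * sp (star (A s) *
        (psiBlock (D s) * Ring.inverse (lowerRight (D s)))) + d s)) := by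
  have hsch := fun τ hτ => hU.schrodinger (Occ.zero ε ι) (Occ.zero ε ι) τ hτ
  have hp : IsPrimitive t (fun s => (U s (vac ε ι)) (Occ.zero ε ι))
      (fun s => -Complex.I * hamiltonian (C s) (A s) (d s) (U s (vac ε ι)) (Occ.zero ε ι)) := by
    refine ⟨(hsch t ⟨ht, le_rfl⟩).1.const_mul _, fun τ hτ => ?_⟩
    rw [intervalIntegral.integral_const_mul, neg_mul, ← sub_eq_add_neg, vac, hU.zero_ket ht]
    exact (hsch τ hτ).2
  have hp' := hp.congr ht (g' := fun s => (-Complex.I * (1 / 2 * sp (star (A s) *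
      (psiBlock (D s) * Ring.inverse (lowerRight (D s)))) + d s)) * (U s (vac ε ι)) (Occ.zero ε ι))
    (fun _ _ => rfl) fun s hs => by
      rw [hamiltonian_zero fun α γ => hU.annih_eq ht hC hAm hAb hD hs (hu s hs) α γ]
      ring
  have h := hp'.eq_exp ht hI hτ
  rw [vac, hU.zero_ket ht, ket_apply, if_pos rfl, one_mul] at h
  rw [vac, inner_ket_left]
  exact h

end Evolution

/-! ### The vacuum amplitude and the determinant -/

section Amplitude

variable {ι : Type*} {t : ℝ} {C A : ℝ → Op ι} {ε : ℤˣ} {d : ℝ → ℝ}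
  {D : ℝ → (OneParticle ι × OneParticle ι) →L[ℂ] (OneParticle ι × OneParticle ι)} {R : ℝ → Op ι}

lemma sp_add [DecidableEq ι] {S T : Op ι} (hS : IsTraceClass S) (hT : IsTraceClass T) :
    sp (S + T) = sp S + sp T :=
  ((IsTraceClass.hasSum_entry hS).add (IsTraceClass.hasSum_entry hT)).tsum_eq

lemma sp_conjOp_of_isSelfAdjoint [DecidableEq ι] {T : Op ι} (h : IsSelfAdjoint T) :
    sp (conjOp T) = sp T :=
  tsum_congr fun i => by rw [entry_conjOp, ← entry_star, h.star_eq]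

variable [LinearOrder ι] [Countable ι]

/-- The square root `exp (½ ∫ Sp V)` of `det Φ̄`, where `V` is the logarithmic derivative
of `Φ̄`. -/
def sqrtDet (C A : ℝ → Op ι)
    (D : ℝ → (OneParticle ι × OneParticle ι) →L[ℂ] (OneParticle ι × OneParticle ι)) (τ : ℝ) : ℂ :=
  Complex.exp (∫ s in (0 : ℝ)..τ, 1 / 2 * sp (blockGen (C s) (A s) (D s)))

lemma sp_blockGen (ht : 0 ≤ t) (hC : IsTraceClassPath t C) (hR : IsTexp t C R)
    (hE : EvolutionConditions ε t A d R) (hD : IsTexp t (fun s => canonGen (C s) (A s)) D)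
    (hu : ∀ τ ∈ Set.Icc 0 t, IsUnit (lowerRight (D τ))) {s : ℝ} (hs : s ∈ Set.Icc 0 t) :
    sp (blockGen (C s) (A s) (D s)) = Complex.I * (sp (C s) +
      sp (conjOp (A s) * (psiBlock (D s) * Ring.inverse (lowerRight (D s))))) := by
  rw [blockGen, sp_smul, sp_add (hC.isTraceL1.conjOp.traceClass s hs)
    ((isTraceL1_conjOp_mul_inverse ht hC hR hE hD hu).traceClass s hs),
    sp_conjOp_of_isSelfAdjoint (hC.selfAdjoint s hs)]

/-- The vacuum amplitude in terms of the square root of the determinant: both sides are exponentials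
of primitives, and the exponents have the same derivative because `Sp (A† Z) = ε Sp (Ā Z)`. -/
lemma IsEvolution.vacuum_amplitude_eq (ht : 0 ≤ t) (hC : IsTraceClassPath t C)
    (hR : IsTexp t C R) (hE : EvolutionConditions ε t A d R)
    (hD : IsTexp t (fun s => canonGen (C s) (A s)) D)
    (hu : ∀ τ ∈ Set.Icc 0 t, IsUnit (lowerRight (D τ))) {U : ℝ → Fock ε ι →L[ℂ] Fock ε ι}
    (hU : IsEvolution t C A d U) {τ : ℝ} (hτ : τ ∈ Set.Icc 0 t) :
    inner ℂ (vac ε ι) (U τ (vac ε ι)) = sqrtDet C A D τ ^ (-(ε : ℤ)) * Complex.exp (Complex.I *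
      ∫ s in (0 : ℝ)..τ, ((((ε : ℤ) : ℂ) / 2) * sp (C s) - (d s : ℂ))) := by
  obtain ⟨a, ha⟩ := hE.exists_norm_le
  have h0 : (0 : ℝ) ∈ Set.Icc 0 t := ⟨le_rfl, ht⟩
  have hZ := isTraceL1_conjOp_mul_inverse ht hC hR hE hD hu
  have hd : IntervalIntegrable (fun s => (d s : ℂ)) volume 0 t :=
    ⟨hE.integrable_d.1.ofReal, hE.integrable_d.2.ofReal⟩
  have hspA : ∀ s ∈ Set.Icc 0 t, sp (star (A s) *
      (psiBlock (D s) * Ring.inverse (lowerRight (D s)))) = ((ε : ℤ) : ℂ) * sp (conjOp (A s) *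
      (psiBlock (D s) * Ring.inverse (lowerRight (D s)))) := fun s hs => by
    rw [hE.star_eq hs, smul_mul_assoc, sp_smul]
  have hZ' := (hZ.const_smul ((ε : ℤ) : ℂ)).congr
    (W := fun s => star (A s) * (psiBlock (D s) * Ring.inverse (lowerRight (D s))))
    fun s hs => by rw [hE.star_eq hs, smul_mul_assoc]
  rw [hU.vacuum_amplitude ht hC hE.measurable ha hD hu
    ((((hZ'.intervalIntegrable_sp ht).const_mul (1 / 2)).add hd).const_mul (-Complex.I)) hτ,
    sqrtDet, ← Complex.exp_int_mul, ← Complex.exp_add]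
  congr 1
  have hV := (isTraceL1_blockGen ht hC hR hE hD hu).intervalIntegrable_sp ht
  have hsC := hC.isTraceL1.intervalIntegrable_sp ht
  rw [← intervalIntegral.integral_const_mul, ← intervalIntegral.integral_const_mul,
    ← intervalIntegral.integral_add
      (intervalIntegrable_sub ((hV.const_mul _).const_mul _) h0 hτ)
      (intervalIntegrable_sub (((hsC.const_mul _).sub hd).const_mul _) h0 hτ)]
  refine intervalIntegral.integral_congr fun s hs => ?_
  rw [Set.uIcc_of_le hτ.1] at hs
  have hs' : s ∈ Set.Icc 0 t := ⟨hs.1, hs.2.trans hτ.2⟩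
  rw [hspA s hs', sp_blockGen ht hC hR hE hD hu hs']
  push_cast
  ring

end Amplitude

end QuadraticQFT

end

open QuadraticQFT in
theorem mainTheorem3 {ι : Type*} [Countable ι] [LinearOrder ι] (t : ℝ) (ht : 0 ≤ t)
    (C : ℝ → Op ι) (hC : IsTraceClassPath t C) :
    (∃ R : ℝ → Op ι, IsTexp t C R) ∧
    ∀ R : ℝ → Op ι, IsTexp t C R →
      (∀ τ ∈ Set.Icc 0 t, R τ ∈ unitary (Op ι) ∧ IsTraceClass (R τ - 1)) ∧
      (∀ η : ℝ≥0∞, 0 < η → ∃ δ : ℝ≥0∞, 0 < δ ∧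
        ∀ C' R' : ℝ → Op ι, IsTraceClassPath t C' → IsTexp t C' R' →
          ∫⁻ s in Set.Icc 0 t, traceNorm (C' s - C s) ≤ δ →
          ∀ τ ∈ Set.Icc 0 t, traceNorm (R' τ - R τ) ≤ η) ∧
      IntervalIntegrable (fun s => sp (C s)) volume 0 t ∧
      (∀ τ ∈ Set.Icc 0 t,
        fredholmDet (R τ) = Complex.exp (-Complex.I * ∫ s in (0 : ℝ)..τ, sp (C s))) ∧
      (∀ (ε : ℤˣ) (A : ℝ → Op ι) (d : ℝ → ℝ), EvolutionConditions ε t A d R →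
        (∃ D, IsTexp t (fun s => canonGen (C s) (A s)) D) ∧
        ∀ D, IsTexp t (fun s => canonGen (C s) (A s)) D →
          (ε = -1 → ∀ τ ∈ Set.Icc 0 t, IsUnit (phiBlock (D τ))) →
          (∀ τ ∈ Set.Icc 0 t, IsTraceClass (conjOp (phiBlock (D τ)) - 1) ∧
            fredholmDet (conjOp (phiBlock (D τ))) ≠ 0) ∧
          ∃ q : ℝ → ℂ, ContinuousOn q (Set.Icc 0 t) ∧ q 0 = 1 ∧
            (∀ τ ∈ Set.Icc 0 t, q τ ^ 2 = fredholmDet (conjOp (phiBlock (D τ)))) ∧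
            ∀ U : ℝ → Fock ε ι →L[ℂ] Fock ε ι, IsEvolution t C A d U →
              ∀ τ ∈ Set.Icc 0 t,
                inner ℂ (vac ε ι) (U τ (vac ε ι)) =
                  q τ ^ (-(ε : ℤ)) * Complex.exp (Complex.I *
                    ∫ s in (0 : ℝ)..τ, ((((ε : ℤ) : ℂ) / 2) * sp (C s) - (d s : ℂ)))) := by
  refine ⟨(hC.isTraceL1.isL1Generator ht).exists_isTexp ht, fun R hR => ⟨fun τ hτ => ?_,
    fun η hη => ⟨η, hη, fun C' R' hC' hR' h τ hτ => ?_⟩, hC.isTraceL1.intervalIntegrable_sp ht,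
    fun τ hτ => hR.fredholmDet_eq ht hC hτ, fun ε A d hE => ?_⟩⟩
  · exact ⟨Unitary.mem_iff.2 ⟨hR.star_mul_self ht hC hτ, hR.mul_star_self ht hC hτ⟩,
      hR.isTraceClass_sub_one ht hC hτ⟩
  · exact (traceNorm_texp_sub_le ht hC hR hC' hR' hτ).trans h
  · obtain ⟨a, ha⟩ := hE.exists_norm_le
    refine ⟨(isL1Generator_canonGen ht hC hE.measurable ha).exists_isTexp ht,
      fun D hD hΦ => ?_⟩
    have hu : ∀ τ ∈ Set.Icc 0 t, IsUnit (lowerRight (D τ)) := fun τ hτ =>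
      hD.isUnit_lowerRight ht hC hE hΦ hτ
    have hswap : ∀ τ ∈ Set.Icc 0 t, conjOp (phiBlock (D τ)) = lowerRight (D τ) := fun τ hτ =>
      hD.canon_swap ht hC hE.measurable ha hτ
    refine ⟨fun τ hτ => ?_, sqrtDet C A D, ?_, ?_, fun τ hτ => ?_, fun U hU τ hτ =>
      hU.vacuum_amplitude_eq ht hC hR hE hD hu hτ⟩
    · rw [hswap τ hτ, hR.fredholmDet_lowerRight ht hC hE hD hu hτ]
      exact ⟨hR.isTraceClass_lowerRight_sub_one ht hC hE hD hu hτ, Complex.exp_ne_zero _⟩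
    · exact (isPrimitive_exp_integral ht (((isTraceL1_blockGen ht hC hR hE hD
        hu).intervalIntegrable_sp ht).const_mul (1 / 2))).continuousOn
    · rw [sqrtDet, intervalIntegral.integral_same, Complex.exp_zero]
    · rw [hswap τ hτ, hR.fredholmDet_lowerRight ht hC hE hD hu hτ, sqrtDet, sq, ← Complex.exp_add,
        intervalIntegral.integral_const_mul]
      congr 1
      ring
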